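/- Let $p\ge 2$, $n\ge 2$, let $\omega_2\subset\mathbb R^{n-1}$ be a bounded connected open set, and write $x=(x_1,X_2)\in\mathbb R\times\mathbb R^{n-1}$, $\Omega_\ell=(-\ell,\ell)\times\omega_2$ for $\ell>0$. Let $$A(X_2)=\begin{pmatrix} a_{11}(X_2) & A_{12}(X_2)\\ A_{12}^t(X_2) & A_{22}(X_2)\end{pmatrix}$$ be a measurable field of real symmetric $n\times n$ matrices on $\omega_2$ (with $A_{22}$ of size $(n-1)\times(n-1)$) that is uniformly bounded and uniformly positive definite a.e. on $\omega_2$. Let $\mu_1(\omega_2)$ be the first (smallest) eigenvalue of the Dirichlet problem $$-\operatorname{div}\big(|A_{22}\nabla u\cdot\nabla u|^{\frac{p-2}2}A_{22}\nabla u\big)=\mu|u|^{p-2}u\ \text{ in }\omega_2,\qquad u\in W^{1,p}_0(\omega_2),\ u\ne 0,$$ and let $W\ge 0$, $\|W\|_{L^p(\omega_2)}=1$, be the corresponding eigenfunction. Let $V(\Omega_\ell)$ be the space of functions in $W^{1,p}(\Omega_\ell)$ that vanish on $(-\ell,\ell)\times\partial\omega_2$, i.e. the closure in $W^{1,p}(\Omega_\ell)$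 of the restrictions to $\Omega_\ell$ of functions in $C_c^\infty(\mathbb R\times\omega_2)$. Let $\lambda^1_M(\Omega_\ell)$ be the first (smallest) eigenvalue of the mixed Dirichlet–Neumann problem on $\Omega_\ell$, i.e. the smallest $\lambda\in\mathbb R$ for which there is $u\in V(\Omega_\ell)$, $u\neq 0$, with $$\int_{\Omega_\ell}|A\nabla u\cdot\nabla u|^{\frac{p-2}2}A\nabla u\cdot\nabla v=\lambda\int_{\Omega_\ell}|u|^{p-2}uv\qquad\text{for all }v\in V(\Omega_\ell).$$ (Eigenvalues and eigenfunctions on $\omega_2$ are understood in the same weak sense, with $W_0^{1,p}(\omega_2)$, the closure of $C_c^\infty(\omega_2)$ in $W^{1,p}(\omega_2)$, in place of $V(\Omega_\ell)$.) Then the smallest eigenvalue $\lambda^1_M(\Omega_\ell)$ exists for every $\ell>0$, and: 1. if $A_{12}\cdot\nabla W$ is not a.e. equal to $0$ on $\omega_2$, then $\limsup_{\ell\to\infty}\lambda^1_M(\Omega_\ell)<\mu_1(\omega_2)$; 2. otherwise, i.e. if $A_{12}\cdot\nabla W=0$ a.e. on $\omega_2$, then $\lambda^1_M(\Omega_\ell)=\mu_1(\omega_2)$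 for every $\ell>0$. -/

import Mathlib

open MeasureTheory Filter Topology Matrix
open scoped ENNReal

noncomputable section

namespace MixedGap

/-- The Euclidean space `ℝⁿ`. -/
abbrev E (n : ℕ) : Type := EuclideanSpace ℝ (Fin n)

/-- `X₂ = (x₂, …, xₙ)` for `x = (x₁, X₂)`; the coordinate `x₁` is `x 0`. -/
def tail {d : ℕ} (x : E (d + 1)) : E d := WithLp.toLp 2 (fun j : Fin d => x j.succ)

/-- The infinite cylinder `ℝ × ω`. -/
def strip {d : ℕ} (ω : Set (E d)) : Set (E (d + 1)) := {x | tail x ∈ ω}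

/-- The finite cylinder `(-ℓ, ℓ) × ω`. -/
def cylinder {d : ℕ} (ω : Set (E d)) (ℓ : ℝ) : Set (E (d + 1)) :=
  {x | x 0 ∈ Set.Ioo (-ℓ) ℓ ∧ tail x ∈ ω}

/-- Smooth functions with compact support contained in `U`. -/
def IsTest {n : ℕ} (U : Set (E n)) (φ : E n → ℝ) : Prop :=
  ContDiff ℝ ((⊤ : ℕ∞) : WithTop ℕ∞) φ ∧ HasCompactSupport φ ∧ tsupport φ ⊆ U

/-- `u ∈ W^{1,p}(Ω)` with weak gradient `G`. -/
def MemSobolev {n : ℕ} (p : ℝ) (Ω : Set (E n)) (u : E n → ℝ) (G : E n → E n) : Prop :=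
  MemLp u (ENNReal.ofReal p) (volume.restrict Ω) ∧
  MemLp G (ENNReal.ofReal p) (volume.restrict Ω) ∧
  ∀ φ : E n → ℝ, IsTest Ω φ → ∀ i : Fin n,
    ∫ x in Ω, u x * (gradient φ x) i = - ∫ x in Ω, (G x) i * φ x

/-- `u`, with weak gradient `G`, lies in the closure in `W^{1,p}(Ω)` of (the restrictions to `Ω`
of) the smooth functions with compact support in `U`. For `U = Ω` this is `W₀^{1,p}(Ω)`.
For `Ω = (-ℓ, ℓ) × ω` and `U = ℝ × ω` it is the space of those functions in `W^{1,p}(Ω)` that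
vanish on the lateral boundary `(-ℓ, ℓ) × ∂ω`, with no condition on the two ends. -/
def MemVanishing {n : ℕ} (p : ℝ) (Ω U : Set (E n)) (u : E n → ℝ) (G : E n → E n) : Prop :=
  MemSobolev p Ω u G ∧
  ∃ φ : ℕ → E n → ℝ, (∀ k, IsTest U (φ k)) ∧
    Tendsto (fun k => eLpNorm (fun x => u x - φ k x) (ENNReal.ofReal p) (volume.restrict Ω))
      atTop (𝓝 0) ∧
    Tendsto (fun k => eLpNorm (fun x => G x - gradient (φ k) x) (ENNReal.ofReal p)
      (volume.restrict Ω)) atTop (𝓝 0)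

/-- `B ξ · η`. -/
def form {n : ℕ} (B : Matrix (Fin n) (Fin n) ℝ) (ξ η : E n) : ℝ :=
  (B *ᵥ (fun j => ξ j)) ⬝ᵥ (fun i => η i)

/-- `u ≠ 0`, with weak gradient `G`, is a weak solution of
`-div(|B∇u·∇u|^{(p-2)/2} B∇u) = lam |u|^{p-2} u` in `Ω`, the trial and test functions being
those of `MemVanishing p Ω U`. (The natural boundary condition `B∇u·ν = 0` on the part of `∂Ω`
where the test functions are free is contained in this weak form.) -/
def IsEigenpair {n : ℕ} (p : ℝ) (B : E n → Matrix (Fin n) (Fin n) ℝ) (Ω U : Set (E n))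
    (lam : ℝ) (u : E n → ℝ) (G : E n → E n) : Prop :=
  MemVanishing p Ω U u G ∧
  ¬ u =ᵐ[volume.restrict Ω] 0 ∧
  ∀ (v : E n → ℝ) (H : E n → E n), MemVanishing p Ω U v H →
    ∫ x in Ω, |form (B x) (G x) (G x)| ^ ((p - 2) / 2) * form (B x) (G x) (H x) =
      lam * ∫ x in Ω, |u x| ^ (p - 2) * u x * v x

/-- The block `A₂₂`. -/
def A22 {d : ℕ} (A : E d → Matrix (Fin (d + 1)) (Fin (d + 1)) ℝ) (X : E d) :
    Matrix (Fin d) (Fin d) ℝ := (A X).submatrix Fin.succ Fin.succ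

/-- `A₁₂(X) · ξ`. -/
def A12dot {d : ℕ} (A : E d → Matrix (Fin (d + 1)) (Fin (d + 1)) ℝ) (X ξ : E d) : ℝ :=
  ∑ j : Fin d, A X 0 j.succ * ξ j

/-- `A` is a measurable field of symmetric matrices on `ω`, uniformly bounded and uniformly
positive definite. -/
def IsAdmissible {d : ℕ} (ω : Set (E d)) (A : E d → Matrix (Fin (d + 1)) (Fin (d + 1)) ℝ) :
    Prop :=
  (∀ i j, AEMeasurable (fun X => A X i j) (volume.restrict ω)) ∧
  (∀ᵐ X ∂(volume.restrict ω), (A X).IsSymm) ∧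
  (∃ M : ℝ, ∀ᵐ X ∂(volume.restrict ω), ∀ i j, |A X i j| ≤ M) ∧
  (∃ c : ℝ, 0 < c ∧ ∀ᵐ X ∂(volume.restrict ω), ∀ ξ : E (d + 1), c * ‖ξ‖ ^ 2 ≤ form (A X) ξ ξ)

/-- Eigenvalues of the Dirichlet problem for `A₂₂` on the cross-section `ω`. -/
def crossEigenvalues {d : ℕ} (p : ℝ) (A : E d → Matrix (Fin (d + 1)) (Fin (d + 1)) ℝ)
    (ω : Set (E d)) : Set ℝ :=
  {lam | ∃ u G, IsEigenpair p (A22 A) ω ω lam u G}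

/-- `μ₁(ω)`. -/
def mu1 {d : ℕ} (p : ℝ) (A : E d → Matrix (Fin (d + 1)) (Fin (d + 1)) ℝ) (ω : Set (E d)) : ℝ :=
  sInf (crossEigenvalues p A ω)

/-- `W`, with weak gradient `DW`, is the first eigenfunction on the cross-section, normalized in
`L^p(ω)` and with its sign fixed. -/
def IsFirstEigenfunction {d : ℕ} (p : ℝ) (A : E d → Matrix (Fin (d + 1)) (Fin (d + 1)) ℝ)
    (ω : Set (E d)) (W : E d → ℝ) (DW : E d → E d) : Prop :=
  IsEigenpair p (A22 A) ω ω (mu1 p A ω) W DW ∧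
  ∫ X in ω, |W X| ^ p = 1 ∧
  0 ≤ᵐ[volume.restrict ω] W

/-- Eigenvalues of the mixed problem for `A(X₂)` on `(-ℓ, ℓ) × ω`: Dirichlet condition on
`(-ℓ, ℓ) × ∂ω`, Neumann condition on `{-ℓ, ℓ} × ω`. -/
def mixedEigenvalues {d : ℕ} (p : ℝ) (A : E d → Matrix (Fin (d + 1)) (Fin (d + 1)) ℝ)
    (ω : Set (E d)) (ℓ : ℝ) : Set ℝ :=
  {lam | ∃ u G, IsEigenpair p (fun x => A (tail x)) (cylinder ω ℓ) (strip ω) lam u G}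

/-- `λ¹_M((-ℓ, ℓ) × ω)`. -/
def lambdaM {d : ℕ} (p : ℝ) (A : E d → Matrix (Fin (d + 1)) (Fin (d + 1)) ℝ)
    (ω : Set (E d)) (ℓ : ℝ) : ℝ :=
  sInf (mixedEigenvalues p A ω ℓ)

end MixedGap

end

open scoped ENNReal

noncomputable section

namespace MixedGap

/-! ### Pointwise inequalities in an inner product space -/

/-! The eigenvalue `lambdaM` is the minimum over `V(Ω_ℓ)` of the Rayleigh quotient of the energy `∫
|A∇u·∇u|^(p/2)` by `∫ |u|^p`. The minimum is attained: a minimizing sequence of test functions has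
an `L^p`-Cauchy subsequence (`testCompact_cylinder`), Clarkson's inequality then makes the gradients
Cauchy (`exists_memVanishing_minimizer`), and a first-order expansion yields the weak equation.
Testing any eigenfunction with itself shows that no eigenvalue is smaller
(`exists_isLeast_eigenvalue`).

The function `W(X₂)` has Rayleigh quotient `μ₁` on every cylinder. The question is whether a
dependence on `x₁` can lower it. Perturb the gradient `(0, ∇W)` by a small longitudinal component
`η`. To first order the energy changes by `p ∫ |A₂₂∇W·∇W|^((p-2)/2) (A₁₂·∇W) η`; for `η = θ` the
integral is `drift θ`. This is the only place where `A₁₂` enters (`flux_consE_zero`).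

If `A₁₂·∇W` is not zero, some test function `θ` has nonzero drift (`exists_drift_ne_zero`). With `τ
= x₁ + ℓ` the trial functions are `e^{-κτ}(W + s e^{-τ}θ)`. By homogeneity the slice at `τ`
contributes `e^{-pκτ}` times the energy of a slightly perturbed `W`, and the equation of `W` cancels
every first-order term except the drift (`exists_slice_energy_le`, `exists_trial`). If `drift W ≠
0`, then `s = 0` and a small `κ` of the right sign gain a fixed fraction of the mass in each slice.
If `drift W = 0`, the gain is of order `|s|` and comes from the neighbourhood of the end `x₁ = -ℓ`;
the slow decay costs `κ² ∫ e^{-pκτ}`, which is of order `κ` only, while the total mass stays of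
order `1/κ`. Choosing `s` first and then `κ` gives a gap that does not depend on `ℓ`.

If `A₁₂·∇W = 0`, then `A(0, ∇W)` has no longitudinal component against any gradient, so the weak
equation of `W` on `ω` may be tested with `|v|^p (W + ε)^(1-p)` slice by slice and compared with the
full gradient of `v` by Picone's inequality (`mu1_mul_integral_slice_le`). Letting `ε → 0` requires
`W > 0` almost everywhere. This follows from a logarithmic energy estimate, Poincaré's inequality on
balls and the connectedness of `ω` (`IsEigenpair.ae_pos`). Integration over `x₁` bounds `lambdaM`
below by `μ₁`, and `W` itself gives the opposite bound. -/

theorem young_rpow {r : ℝ} (hr : 1 ≤ r) {x y : ℝ} (hx : 0 ≤ x) (hy : 0 ≤ y) :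
    r * x ^ (r - 1) * y ≤ (r - 1) * x ^ r + y ^ r := by
  rcases eq_or_lt_of_le hr with h | h
  · subst h; simp
  · have hc : (r / (r - 1)).HolderConjugate r := (Real.HolderConjugate.conjExponent h).symm
    have := Real.young_inequality_of_nonneg (Real.rpow_nonneg hx (r - 1)) hy hc
    have h1 : r - 1 ≠ 0 := by linarith
    have h2 : r ≠ 0 := by linarith
    rw [← Real.rpow_mul hx, mul_div_cancel₀ _ h1] at this
    have h3 := mul_le_mul_of_nonneg_left this (by linarith : 0 ≤ r)
    calc r * x ^ (r - 1) * y = r * (x ^ (r - 1) * y) := by ring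
      _ ≤ _ := h3
      _ = _ := by field_simp

theorem rpow_sub_rpow_le {r : ℝ} (hr : 1 ≤ r) {x y : ℝ} (hx : 0 ≤ x) (hy : 0 ≤ y) :
    x ^ r - y ^ r ≤ r * x ^ (r - 1) * (x - y) := by
  have h := young_rpow hr hx hy
  have : x ^ r = x ^ (r - 1) * x := by
    rcases eq_or_lt_of_le hx with h | h
    · subst h; rw [Real.zero_rpow (by linarith)]; simp
    · rw [← Real.rpow_add_one h.ne']; ring_nf
  nlinarith

theorem rpow_two_mul_le {q : ℝ} (hq : 1 ≤ q) {s t : ℝ} (hs : 0 ≤ s) (ht : 0 ≤ t) :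
    (s + t) ^ q ≤ 2 ^ (q - 1) * (s ^ q + t ^ q) := by
  lift s to NNReal using hs
  lift t to NNReal using ht
  exact_mod_cast NNReal.rpow_add_le_mul_rpow_add_rpow s t hq

theorem add_rpow_le_rpow {q : ℝ} (hq : 1 ≤ q) {s t : ℝ} (hs : 0 ≤ s) (ht : 0 ≤ t) :
    s ^ q + t ^ q ≤ (s + t) ^ q := by
  lift s to NNReal using hs
  lift t to NNReal using ht
  exact_mod_cast NNReal.add_rpow_le_rpow_add s t hq

/-- For `2 < p < 3` the power `t^(p-2)` is not Lipschitz at `0`. The extra factor `y` replaces its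
increments by those of `t^(p-1)`, whose derivative is bounded by `(p-1) M^(p-2)`. -/
theorem mul_abs_rpow_sub_le {p : ℝ} (hp : 2 ≤ p) {x y M : ℝ} (hx : 0 ≤ x) (hy : 0 ≤ y)
    (hxM : x ≤ M) (hyM : y ≤ M) :
    |x ^ (p - 2) - y ^ (p - 2)| * y ≤ (p - 1) * M ^ (p - 2) * |x - y| := by
  have e : ∀ z : ℝ, 0 ≤ z → z ^ (p - 1) = z ^ (p - 2) * z := by
    intro z hz
    rcases eq_or_lt_of_le hz with h | h
    · subst h; rw [Real.zero_rpow (by linarith)]; simp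
    · rw [← Real.rpow_add_one h.ne']; ring_nf
  have e2 : p - 1 - 1 = p - 2 := by ring
  rcases le_total y x with h | h
  · have h0 : y ^ (p - 2) ≤ x ^ (p - 2) := Real.rpow_le_rpow hy h (by linarith)
    have h1 := rpow_sub_rpow_le (r := p - 1) (by linarith) hx hy
    rw [e2, e x hx, e y hy] at h1
    have h2 : x ^ (p - 2) ≤ M ^ (p - 2) := Real.rpow_le_rpow hx hxM (by linarith)
    rw [abs_of_nonneg (by linarith), abs_of_nonneg (by linarith)]
    have h3 : (p - 1) * x ^ (p - 2) * (x - y) ≤ (p - 1) * M ^ (p - 2) * (x - y) := by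
      apply mul_le_mul_of_nonneg_right _ (by linarith)
      exact mul_le_mul_of_nonneg_left h2 (by linarith)
    nlinarith [mul_nonneg (Real.rpow_nonneg hx (p - 2)) (sub_nonneg.2 h)]
  · have h0 : x ^ (p - 2) ≤ y ^ (p - 2) := Real.rpow_le_rpow hx h (by linarith)
    have h1 := rpow_sub_rpow_le (r := p - 1) (by linarith) hy hx
    rw [e2, e x hx, e y hy] at h1
    have h2 : y ^ (p - 2) ≤ M ^ (p - 2) := Real.rpow_le_rpow hy hyM (by linarith)
    rw [abs_of_nonpos (by linarith), abs_of_nonpos (by linarith)]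
    have h3 : (p - 1) * y ^ (p - 2) * (y - x) ≤ (p - 1) * M ^ (p - 2) * (y - x) := by
      apply mul_le_mul_of_nonneg_right _ (by linarith)
      exact mul_le_mul_of_nonneg_left h2 (by linarith)
    nlinarith [mul_nonneg (Real.rpow_nonneg hx (p - 2)) (sub_nonneg.2 h)]

section Inner

variable {F : Type*} [NormedAddCommGroup F] [InnerProductSpace ℝ F]

theorem rpow_sub_two_mul_sq {p : ℝ} (hp : 2 ≤ p) {x : ℝ} (hx : 0 ≤ x) :
    x ^ (p - 2) * x ^ 2 = x ^ p := by
  rcases eq_or_lt_of_le hx with h | h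
  · subst h; rw [Real.zero_rpow (by linarith : p ≠ 0)]; simp
  · rw [← Real.rpow_natCast, ← Real.rpow_add h]; norm_num

theorem rpow_sub_two_mul_self {p : ℝ} (hp : 2 ≤ p) {x : ℝ} (hx : 0 ≤ x) :
    x ^ (p - 2) * x = x ^ (p - 1) := by
  rcases eq_or_lt_of_le hx with h | h
  · subst h; rw [Real.zero_rpow (by linarith : p - 1 ≠ 0)]; simp
  · rw [← Real.rpow_add_one h.ne']; ring_nf

/-- Clarkson's inequality for `p ≥ 2`. -/
theorem clarkson {p : ℝ} (hp : 2 ≤ p) (a b : F) :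
    ‖a + b‖ ^ p + ‖a - b‖ ^ p ≤ 2 ^ (p - 1) * (‖a‖ ^ p + ‖b‖ ^ p) := by
  have e : ∀ z : F, ‖z‖ ^ p = (‖z‖ ^ 2) ^ (p / 2) := by
    intro z
    rw [← Real.rpow_natCast, ← Real.rpow_mul (norm_nonneg _)]
    congr 1; push_cast; ring
  have hq : 1 ≤ p / 2 := by linarith
  have par : ‖a + b‖ ^ 2 + ‖a - b‖ ^ 2 = 2 * (‖a‖ ^ 2 + ‖b‖ ^ 2) := by
    have := parallelogram_law_with_norm ℝ a b
    nlinarith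
  rw [e, e, e a, e b]
  calc _ ≤ (‖a + b‖ ^ 2 + ‖a - b‖ ^ 2) ^ (p / 2) := add_rpow_le_rpow hq (by positivity) (by positivity)
    _ = 2 ^ (p / 2) * (‖a‖ ^ 2 + ‖b‖ ^ 2) ^ (p / 2) := by
      rw [par, Real.mul_rpow (by norm_num) (by positivity)]
    _ ≤ 2 ^ (p / 2) * (2 ^ (p / 2 - 1) * ((‖a‖ ^ 2) ^ (p / 2) + (‖b‖ ^ 2) ^ (p / 2))) := by
      gcongr
      exact rpow_two_mul_le hq (by positivity) (by positivity)
    _ = _ := by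
      rw [← mul_assoc, ← Real.rpow_add (by norm_num)]
      congr 2; ring

theorem abs_norm_rpow_mul_inner_le {p : ℝ} (hp : 2 ≤ p) (a b : F) :
    |‖a‖ ^ (p - 2) * inner ℝ a b| ≤ ‖a‖ ^ (p - 1) * ‖b‖ := by
  rw [abs_mul, abs_of_nonneg (Real.rpow_nonneg (norm_nonneg _) _), ← rpow_sub_two_mul_self hp
    (norm_nonneg a), mul_assoc]
  exact mul_le_mul_of_nonneg_left (abs_real_inner_le_norm a b) (by positivity)

/-- Cauchy–Schwarz followed by Young. Both the convexity of `‖·‖^p` and Picone's inequality are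
instances of it. -/
theorem picone_pointwise {p : ℝ} (hp : 2 ≤ p) (a b : F) :
    p * (‖a‖ ^ (p - 2) * inner ℝ a b) ≤ (p - 1) * ‖a‖ ^ p + ‖b‖ ^ p := by
  refine le_trans ?_ (young_rpow (by linarith : 1 ≤ p) (norm_nonneg a) (norm_nonneg b))
  rw [mul_assoc]
  exact mul_le_mul_of_nonneg_left ((le_abs_self _).trans (abs_norm_rpow_mul_inner_le hp a b))
    (by linarith)

theorem norm_rpow_tangent_le {p : ℝ} (hp : 2 ≤ p) (a h : F) :
    ‖a‖ ^ p + p * (‖a‖ ^ (p - 2) * inner ℝ a h) ≤ ‖a + h‖ ^ p := by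
  have := picone_pointwise hp a (a + h)
  rw [inner_add_right, real_inner_self_eq_norm_sq, mul_add, rpow_sub_two_mul_sq hp (norm_nonneg a)]
    at this
  linarith

/-- The tangent inequality at `a + h` with increment `-h` leaves the difference of the derivatives
at `a + h` and at `a`. Splitting that difference into the change of the weight and the change of the
vector bounds it by `p M ‖h‖²`; the second factor `p` comes from the derivative of the power. -/
theorem norm_add_rpow_le_taylor {p : ℝ} (hp : 2 ≤ p) (a h : F) :
    ‖a + h‖ ^ p ≤ ‖a‖ ^ p + p * (‖a‖ ^ (p - 2) * inner ℝ a h) +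
      p ^ 2 * ((‖a‖ + ‖h‖) ^ (p - 2) * ‖h‖ ^ 2) := by
  have h1 := norm_rpow_tangent_le hp (a + h) (-h)
  rw [add_neg_cancel_right, inner_neg_right] at h1
  have hM : ‖a + h‖ ≤ ‖a‖ + ‖h‖ := norm_add_le _ _
  have h2 := mul_abs_rpow_sub_le hp (norm_nonneg (a + h)) (norm_nonneg a) hM
    (by linarith [norm_nonneg h])
  have h3 : |‖a + h‖ - ‖a‖| ≤ ‖h‖ := by
    simpa using abs_norm_sub_norm_le (a + h) a
  set M := (‖a‖ + ‖h‖) ^ (p - 2) with hMdef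
  have hM0 : 0 ≤ M := by positivity
  have h4 : ‖a + h‖ ^ (p - 2) ≤ M := Real.rpow_le_rpow (norm_nonneg _) hM (by linarith)
  have h5 : ‖a + h‖ ^ (p - 2) * inner ℝ (a + h) h - ‖a‖ ^ (p - 2) * inner ℝ a h ≤
      p * (M * ‖h‖ ^ 2) := by
    have e : ‖a + h‖ ^ (p - 2) * inner ℝ (a + h) h - ‖a‖ ^ (p - 2) * inner ℝ a h =
      (‖a + h‖ ^ (p - 2) - ‖a‖ ^ (p - 2)) * inner ℝ a h + ‖a + h‖ ^ (p - 2) * ‖h‖ ^ 2 := by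
      rw [inner_add_left, real_inner_self_eq_norm_sq]; ring
    have f1 : (‖a + h‖ ^ (p - 2) - ‖a‖ ^ (p - 2)) * inner ℝ a h ≤
        |‖a + h‖ ^ (p - 2) - ‖a‖ ^ (p - 2)| * ‖a‖ * ‖h‖ := by
      refine (le_abs_self _).trans ?_
      rw [abs_mul, mul_assoc]
      exact mul_le_mul_of_nonneg_left (abs_real_inner_le_norm a h) (abs_nonneg _)
    have f2 : |‖a + h‖ ^ (p - 2) - ‖a‖ ^ (p - 2)| * ‖a‖ * ‖h‖ ≤ (p - 1) * M * ‖h‖ * ‖h‖ := by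
      refine mul_le_mul_of_nonneg_right (h2.trans ?_) (norm_nonneg _)
      exact mul_le_mul_of_nonneg_left h3 (mul_nonneg (by linarith) hM0)
    have f3 : ‖a + h‖ ^ (p - 2) * ‖h‖ ^ 2 ≤ M * ‖h‖ ^ 2 :=
      mul_le_mul_of_nonneg_right h4 (by positivity)
    rw [e]; nlinarith
  have h6 := mul_le_mul_of_nonneg_left h5 (by linarith : 0 ≤ p)
  nlinarith

end Inner

/-! ### Elliptic fields -/

/-- Factoring `B = TᵗT` turns each pointwise inequality for the quadratic form into one for the
Euclidean norm. Only existence at each point is used, so the root need not depend measurably on the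
point. -/
theorem exists_form_eq_inner {n : ℕ} {B : Matrix (Fin n) (Fin n) ℝ} (hs : B.IsSymm)
    (hpos : ∀ ξ : E n, 0 ≤ form B ξ ξ) :
    ∃ S : E n →ₗ[ℝ] E n, ∀ ξ η, form B ξ η = inner ℝ (S ξ) (S η) := by
  have hB : B.PosSemidef := by
    refine Matrix.PosSemidef.of_dotProduct_mulVec_nonneg ?_ ?_
    · rw [Matrix.IsHermitian, Matrix.conjTranspose_eq_transpose_of_trivial]; exact hs
    · intro x
      have := hpos (WithLp.toLp 2 x)
      simp only [form] at this
      rw [dotProduct_comm] at this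
      simpa using this
  obtain ⟨T, hT⟩ : ∃ T : Matrix (Fin n) (Fin n) ℝ, B = Tᴴ * T := by
    open scoped MatrixOrder in
    obtain ⟨T, hT⟩ := CStarAlgebra.nonneg_iff_eq_star_mul_self.1 (Matrix.nonneg_iff_posSemidef.2 hB)
    exact ⟨T, hT⟩
  refine ⟨Matrix.toEuclideanLin T, fun ξ η => ?_⟩
  rw [EuclideanSpace.inner_eq_star_dotProduct]
  simp only [form, hT, Matrix.conjTranspose_eq_transpose_of_trivial]
  rw [← Matrix.mulVec_mulVec, dotProduct_comm, dotProduct_mulVec, vecMul_transpose]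
  simp [Matrix.toLpLin_apply]

/-! ### Convergence in `L^p` -/

section Lp

variable {α F : Type*} [MeasurableSpace α] {m : Measure α} [NormedAddCommGroup F]

theorem ofReal_ne_zero_of_two_le {p : ℝ} (hp : 2 ≤ p) : ENNReal.ofReal p ≠ 0 := by
  simpa using by linarith

theorem one_le_ofReal_of_two_le {p : ℝ} (hp : 2 ≤ p) : 1 ≤ ENNReal.ofReal p := by
  simpa using by linarith

theorem toReal_ofReal_of_two_le {p : ℝ} (hp : 2 ≤ p) : (ENNReal.ofReal p).toReal = p :=
  ENNReal.toReal_ofReal (by linarith)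

theorem integrable_norm_rpow_of_memLp {p : ℝ} (hp : 2 ≤ p) {f : α → F}
    (hf : MemLp f (ENNReal.ofReal p) m) : Integrable (fun x => ‖f x‖ ^ p) m := by
  have := hf.integrable_norm_rpow (ofReal_ne_zero_of_two_le hp) ENNReal.ofReal_ne_top
  rwa [toReal_ofReal_of_two_le hp] at this

theorem norm_toLp_rpow {p : ℝ} (hp : 2 ≤ p) {f : α → F}
    (hf : MemLp f (ENNReal.ofReal p) m) : ‖hf.toLp f‖ ^ p = ∫ x, ‖f x‖ ^ p ∂m := by
  have h0 : 0 ≤ ∫ x, ‖f x‖ ^ p ∂m := integral_nonneg fun x => by positivity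
  rw [Lp.norm_toLp, hf.eLpNorm_eq_integral_rpow_norm (ofReal_ne_zero_of_two_le hp)
    ENNReal.ofReal_ne_top, toReal_ofReal_of_two_le hp,
    ENNReal.toReal_ofReal (Real.rpow_nonneg h0 _), ← Real.rpow_mul h0,
    inv_mul_cancel₀ (by linarith), Real.rpow_one]

theorem tendsto_integral_norm_rpow {p : ℝ} (hp : 2 ≤ p) {f : ℕ → α → F} {g : α → F}
    (hf : ∀ k, MemLp (f k) (ENNReal.ofReal p) m) (hg : MemLp g (ENNReal.ofReal p) m)
    (h : Tendsto (fun k => eLpNorm (fun x => g x - f k x) (ENNReal.ofReal p) m) atTop (𝓝 0)) :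
    Tendsto (fun k => ∫ x, ‖f k x‖ ^ p ∂m) atTop (𝓝 (∫ x, ‖g x‖ ^ p ∂m)) := by
  have : Fact (1 ≤ ENNReal.ofReal p) := ⟨one_le_ofReal_of_two_le hp⟩
  have h2 : Tendsto (fun k => (hf k).toLp (f k)) atTop (𝓝 (hg.toLp g)) := by
    rw [Lp.tendsto_Lp_iff_tendsto_eLpNorm'']
    refine h.congr fun k => ?_
    rw [eLpNorm_sub_comm]; rfl
  have h3 := (h2.norm).rpow_const (p := p) (Or.inr (by linarith))
  rw [norm_toLp_rpow hp] at h3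
  exact h3.congr fun k => norm_toLp_rpow hp (hf k)

theorem tendsto_integral_mul_of_tendsto_eLpNorm [IsFiniteMeasure m] {p : ℝ} (hp : 2 ≤ p)
    {f : ℕ → α → ℝ} {g b : α → ℝ} (hf : ∀ k, MemLp (f k) (ENNReal.ofReal p) m)
    (hg : MemLp g (ENNReal.ofReal p) m) (hb : AEStronglyMeasurable b m) {C : ℝ}
    (hC : ∀ x, |b x| ≤ C)
    (h : Tendsto (fun k => eLpNorm (fun x => g x - f k x) (ENNReal.ofReal p) m) atTop (𝓝 0)) :
    Tendsto (fun k => ∫ x, f k x * b x ∂m) atTop (𝓝 (∫ x, g x * b x ∂m)) := by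
  refine tendsto_integral_of_L1' _ (hg.1.mul hb) (Eventually.of_forall fun k => ?_) ?_
  · exact ((hf k).integrable (one_le_ofReal_of_two_le hp)).mul_bdd hb
      (Eventually.of_forall fun x => hC x)
  · have h1 : ∀ k, eLpNorm ((fun x => f k x * b x) - fun x => g x * b x) 1 m ≤
        ENNReal.ofReal C * (eLpNorm (fun x => g x - f k x) (ENNReal.ofReal p) m *
          m Set.univ ^ (1 / (1 : ℝ≥0∞).toReal - 1 / (ENNReal.ofReal p).toReal)) := by
      intro k
      refine le_trans ?_ (mul_le_mul_right (eLpNorm_le_eLpNorm_mul_rpow_measure_univ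
        (one_le_ofReal_of_two_le hp) (hg.1.sub (hf k).1)) _)
      refine eLpNorm_le_mul_eLpNorm_of_ae_le_mul (Eventually.of_forall fun x => ?_) 1
      simp only [Pi.sub_apply, Real.norm_eq_abs]
      rw [← sub_mul, abs_mul, abs_sub_comm, mul_comm]
      exact mul_le_mul_of_nonneg_right (hC x) (abs_nonneg _)
    have hfin : m Set.univ ^ (1 / (1 : ℝ≥0∞).toReal - 1 / (ENNReal.ofReal p).toReal) ≠ ⊤ := by
      refine ENNReal.rpow_ne_top_of_nonneg ?_ (measure_ne_top _ _)
      rw [toReal_ofReal_of_two_le hp]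
      simp only [ENNReal.toReal_one, div_one, one_div, sub_nonneg]
      exact inv_le_one_of_one_le₀ (by linarith)
    have h2 := ENNReal.Tendsto.const_mul (a := ENNReal.ofReal C)
      (ENNReal.Tendsto.mul_const h (Or.inr hfin)) (Or.inr ENNReal.ofReal_ne_top)
    rw [zero_mul, mul_zero] at h2
    exact tendsto_of_tendsto_of_tendsto_of_le_of_le tendsto_const_nhds h2 (fun _ => zero_le) h1

theorem tendsto_eLpNorm_sub_of_norm_sub_le [IsFiniteMeasure m] {p : ℝ} (hp : 2 ≤ p)
    {f : ℕ → α → F} {g : α → F} {h : ℕ → α → F} (hg : AEStronglyMeasurable g m)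
    (hf : ∀ k, AEStronglyMeasurable (f k) m) (hh : ∀ k, AEStronglyMeasurable (h k) m)
    (hfh : ∀ (k : ℕ) (x : α), ‖f k x - h k x‖ ≤ 1 / ((k : ℝ) + 1))
    (ht : Tendsto (fun k => eLpNorm (fun x => g x - f k x) (ENNReal.ofReal p) m) atTop (𝓝 0)) :
    Tendsto (fun k => eLpNorm (fun x => g x - h k x) (ENNReal.ofReal p) m) atTop (𝓝 0) := by
  set c := m Set.univ ^ (ENNReal.ofReal p).toReal⁻¹ with hc
  have hcfin : c ≠ ⊤ := ENNReal.rpow_ne_top_of_nonneg (by positivity) (measure_ne_top _ _)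
  have hz : Tendsto (fun k : ℕ => c * ENNReal.ofReal (1 / ((k : ℝ) + 1))) atTop (𝓝 0) := by
    have := ENNReal.Tendsto.const_mul (a := c)
      (ENNReal.tendsto_ofReal tendsto_one_div_add_atTop_nhds_zero_nat) (Or.inr hcfin)
    simpa using this
  have := ht.add hz
  rw [add_zero] at this
  refine tendsto_of_tendsto_of_tendsto_of_le_of_le tendsto_const_nhds this (fun _ => zero_le)
    fun k => ?_
  have e : (fun x => g x - h k x) = (fun x => g x - f k x) + fun x => f k x - h k x := by
    ext x; simp
  rw [e]
  refine (eLpNorm_add_le (hg.sub (hf k)) ((hf k).sub (hh k))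
    (one_le_ofReal_of_two_le hp)).trans ?_
  exact add_le_add le_rfl (eLpNorm_le_of_ae_bound (Eventually.of_forall fun x => hfh k x))

end Lp

/-! ### `C¹` test functions -/

/-- Continuously differentiable functions with compact support contained in `U`. -/
def IsC1Test {n : ℕ} (U : Set (E n)) (φ : E n → ℝ) : Prop :=
  ContDiff ℝ 1 φ ∧ HasCompactSupport φ ∧ tsupport φ ⊆ U

section Tests

variable {n : ℕ} {U : Set (E n)} {φ ψ : E n → ℝ}

theorem IsTest.isC1Test (h : IsTest U φ) : IsC1Test U φ :=
  ⟨h.1.of_le (by exact_mod_cast le_top), h.2.1, h.2.2⟩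

theorem gradient_apply_eq (φ : E n → ℝ) (x : E n) (i : Fin n) :
    (gradient φ x) i = fderiv ℝ φ x (EuclideanSpace.single i 1) := by
  rw [← inner_gradient_left, EuclideanSpace.inner_single_right]; simp

theorem continuous_gradient (h : ContDiff ℝ 1 φ) : Continuous (gradient φ) :=
  (InnerProductSpace.toDual ℝ (E n)).symm.continuous.comp (h.continuous_fderiv (by simp))

theorem gradient_eq_zero_of_notMem_tsupport {x : E n} (h : x ∉ tsupport φ) :
    gradient φ x = 0 := by
  have : fderiv ℝ φ x = 0 := by
    by_contra h0
    exact h (support_fderiv_subset ℝ h0)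
  simp [gradient, this]

theorem IsC1Test.hasCompactSupport_gradient (h : IsC1Test U φ) :
    HasCompactSupport (gradient φ) :=
  HasCompactSupport.intro h.2.1 fun _ hx => gradient_eq_zero_of_notMem_tsupport hx

theorem IsC1Test.memLp (h : IsC1Test U φ) (p : ℝ≥0∞) (m : Measure (E n))
    [IsFiniteMeasureOnCompacts m] : MemLp φ p m :=
  h.1.continuous.memLp_of_hasCompactSupport h.2.1

theorem IsC1Test.memLp_gradient (h : IsC1Test U φ) (p : ℝ≥0∞) (m : Measure (E n))
    [IsFiniteMeasureOnCompacts m] : MemLp (gradient φ) p m :=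
  (continuous_gradient h.1).memLp_of_hasCompactSupport h.hasCompactSupport_gradient

theorem IsC1Test.add (h : IsC1Test U φ) (h' : IsC1Test U ψ) : IsC1Test U (φ + ψ) :=
  ⟨h.1.add h'.1, h.2.1.add h'.2.1, (tsupport_add _ _).trans (Set.union_subset h.2.2 h'.2.2)⟩

theorem IsC1Test.const_mul (c : ℝ) (h : IsC1Test U φ) : IsC1Test U (fun x => c * φ x) :=
  ⟨contDiff_const.mul h.1, h.2.1.mul_left,
    (tsupport_mul_subset_right).trans h.2.2⟩

theorem IsTest.add (h : IsTest U φ) (h' : IsTest U ψ) : IsTest U (φ + ψ) :=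
  ⟨h.1.add h'.1, h.2.1.add h'.2.1, (tsupport_add _ _).trans (Set.union_subset h.2.2 h'.2.2)⟩

theorem IsTest.const_mul (c : ℝ) (h : IsTest U φ) : IsTest U (fun x => c * φ x) :=
  ⟨contDiff_const.mul h.1, h.2.1.mul_left,
    (tsupport_mul_subset_right).trans h.2.2⟩

theorem gradient_eq_of_hasFDerivAt {f : E n → ℝ} {x g : E n}
    (h : HasFDerivAt f (InnerProductSpace.toDual ℝ (E n) g) x) : gradient f x = g :=
  (hasGradientAt_iff_hasFDerivAt.2 h).gradient

theorem gradient_const_mul_add (hφ : ContDiff ℝ 1 φ) (hψ : ContDiff ℝ 1 ψ) (a b : ℝ) (x : E n) :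
    gradient (fun x => a * φ x + b * ψ x) x = a • gradient φ x + b • gradient ψ x := by
  have h1 := (hφ.differentiable (by simp) x).hasGradientAt.hasFDerivAt
  have h2 := (hψ.differentiable (by simp) x).hasGradientAt.hasFDerivAt
  apply gradient_eq_of_hasFDerivAt
  refine ((h1.const_mul a).add (h2.const_mul b)).congr_fderiv ?_
  ext y; simp

theorem norm_gradient_sub (φ ψ : E n → ℝ) (x : E n) :
    ‖gradient φ x - gradient ψ x‖ = ‖fderiv ℝ φ x - fderiv ℝ ψ x‖ := by
  rw [gradient, gradient, ← map_sub, LinearIsometryEquiv.norm_map]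

/-- Mollification: a `C¹` test function is a `C¹`-uniform limit of smooth ones. -/
theorem IsC1Test.exists_isTest (hU : IsOpen U) (h : IsC1Test U φ) {ε : ℝ} (hε : 0 < ε) :
    ∃ ψ, IsTest U ψ ∧ ∀ x, |φ x - ψ x| ≤ ε ∧ ‖gradient φ x - gradient ψ x‖ ≤ ε := by
  obtain ⟨hφ, hcs, hsub⟩ := h
  have hfc : Continuous (fderiv ℝ φ) := hφ.continuous_fderiv (by simp)
  have u1 := Metric.uniformContinuous_iff.1 (hcs.uniformContinuous_of_continuous hφ.continuous) ε hε
  have u2 := Metric.uniformContinuous_iff.1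
    ((hcs.fderiv ℝ).uniformContinuous_of_continuous hfc) ε hε
  obtain ⟨δ1, hδ1, H1⟩ := u1
  obtain ⟨δ2, hδ2, H2⟩ := u2
  -- Three radii: the first two control the oscillation of `φ` and of its derivative, the third
  -- keeps the support of the mollification inside `U`.
  obtain ⟨δ3, hδ3, H3⟩ := hcs.isCompact.exists_cthickening_subset_open hU hsub
  set δ := min (min δ1 δ2) δ3 with hδ
  have hδ0 : 0 < δ := by positivity
  let ρ : ContDiffBump (0 : E n) := ⟨δ / 2, δ, by positivity, by linarith⟩
  have hρo : ρ.rOut = δ := rfl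
  set ψ : E n → ℝ := convolution (ρ.normed volume) φ (ContinuousLinearMap.lsmul ℝ ℝ) volume with hψ
  have hfd : ∀ x, fderiv ℝ ψ x =
      convolution (ρ.normed volume) (fderiv ℝ φ) (ContinuousLinearMap.lsmul ℝ ℝ) volume x := by
    intro x
    have := hcs.hasFDerivAt_convolution_right (ContinuousLinearMap.lsmul ℝ ℝ)
      (f := ρ.normed volume) (μ := volume) (ρ.continuous_normed.locallyIntegrable) hφ x
    rw [this.fderiv]
    rfl
  have hsupp : tsupport ψ ⊆ Metric.cthickening δ3 (tsupport φ) := by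
    apply closure_minimal _ Metric.isClosed_cthickening
    refine (support_convolution_subset _).trans ?_
    rintro _ ⟨a, ha, b, hb, rfl⟩
    have ha' : a ∈ Metric.ball (0 : E n) δ := by
      have := ρ.support_normed_eq (μ := volume) ▸ ha
      simpa [hρo] using this
    refine Metric.mem_cthickening_of_dist_le _ b _ _ (subset_tsupport _ hb) ?_
    have : dist (a + b) b = ‖a‖ := by simp [dist_eq_norm]
    rw [this]
    have h2 : ‖a‖ < δ := by simpa using ha'
    exact h2.le.trans (min_le_right _ _)
  refine ⟨ψ, ⟨?_, ?_, hsupp.trans H3⟩, fun x => ⟨?_, ?_⟩⟩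
  · exact ρ.hasCompactSupport_normed.contDiff_convolution_left _ ρ.contDiff_normed
      hφ.continuous.locallyIntegrable
  · exact ρ.hasCompactSupport_normed.convolution _ hcs
  · rw [abs_sub_comm, ← Real.dist_eq]
    refine ContDiffBump.dist_normed_convolution_le hφ.continuous.aestronglyMeasurable ?_
    intro y hy
    refine (H1 ?_).le
    exact (Metric.mem_ball.1 hy).trans_le ((min_le_left _ _).trans (min_le_left _ _))
  · rw [norm_gradient_sub, hfd, norm_sub_rev, ← dist_eq_norm]
    refine ContDiffBump.dist_normed_convolution_le hfc.aestronglyMeasurable ?_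
    intro y hy
    refine (H2 ?_).le
    exact (Metric.mem_ball.1 hy).trans_le ((min_le_left _ _).trans (min_le_right _ _))

/-- Integration by parts against a smooth test function. -/
theorem integral_mul_gradient_eq {Ω : Set (E n)} {η : E n → ℝ} (hφ : ContDiff ℝ 1 φ)
    (hη : IsTest Ω η) (i : Fin n) :
    ∫ x in Ω, φ x * (gradient η x) i = - ∫ x in Ω, (gradient φ x) i * η x := by
  have h0 : ∀ x ∉ Ω, x ∉ tsupport η := fun x hx hx' => hx (hη.2.2 hx')
  have hηc := hη.isC1Test.1
  rw [setIntegral_eq_integral_of_forall_compl_eq_zero fun x hx => by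
      rw [gradient_eq_zero_of_notMem_tsupport (h0 x hx)]; simp,
    setIntegral_eq_integral_of_forall_compl_eq_zero fun x hx => by
      rw [image_eq_zero_of_notMem_tsupport (h0 x hx)]; simp]
  simp only [gradient_apply_eq]
  have c1 : Continuous fun x => fderiv ℝ φ x (EuclideanSpace.single i 1) :=
    (hφ.continuous_fderiv (by simp)).clm_apply continuous_const
  have c2 : Continuous fun x => fderiv ℝ η x (EuclideanSpace.single i 1) :=
    (hηc.continuous_fderiv (by simp)).clm_apply continuous_const
  have s2 : HasCompactSupport fun x => fderiv ℝ η x (EuclideanSpace.single i (1 : ℝ)) :=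
    hη.2.1.fderiv_apply ℝ _
  refine integral_mul_fderiv_eq_neg_fderiv_mul_of_integrable ?_ ?_ ?_ ?_ ?_
  · exact (c1.mul hηc.continuous).integrable_of_hasCompactSupport hη.2.1.mul_left
  · exact (hφ.continuous.mul c2).integrable_of_hasCompactSupport s2.mul_left
  · exact (hφ.continuous.mul hηc.continuous).integrable_of_hasCompactSupport hη.2.1.mul_left
  · exact fun x _ => hφ.differentiable (by simp) x
  · exact fun x _ => hηc.differentiable (by simp) x

end Tests

/-! ### The closure of the test functions -/

section Vanishing

variable {n : ℕ} {Ω U : Set (E n)} {p : ℝ}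

theorem IsTest.integrable_gradient_bound {η : E n → ℝ} (hη : IsTest Ω η) :
    ∃ C, ∀ x, ‖gradient η x‖ ≤ C :=
  (continuous_gradient hη.isC1Test.1).bounded_above_of_compact_support
    hη.isC1Test.hasCompactSupport_gradient

/-- Mollification shows that `C¹` approximants suffice, and the weak-gradient identity is inherited
from them in the limit. All memberships in the closure rest on this; the approximants that occur
later, such as tensor products and `ψ h(φ)`, are only `C¹`. -/
theorem memVanishing_of_tendsto [IsFiniteMeasure (volume.restrict Ω)] (hp : 2 ≤ p)
    (hU : IsOpen U) {u : E n → ℝ} {G : E n → E n}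
    (hu : MemLp u (ENNReal.ofReal p) (volume.restrict Ω))
    (hG : MemLp G (ENNReal.ofReal p) (volume.restrict Ω)) {φ : ℕ → E n → ℝ}
    (hφ : ∀ k, IsC1Test U (φ k))
    (h1 : Tendsto (fun k => eLpNorm (fun x => u x - φ k x) (ENNReal.ofReal p) (volume.restrict Ω))
      atTop (𝓝 0))
    (h2 : Tendsto (fun k => eLpNorm (fun x => G x - gradient (φ k) x) (ENNReal.ofReal p)
      (volume.restrict Ω)) atTop (𝓝 0)) :
    MemVanishing p Ω U u G := by
  refine ⟨⟨hu, hG, ?_⟩, ?_⟩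
  · intro η hη i
    have hηc := hη.isC1Test
    obtain ⟨C1, hC1⟩ := hη.integrable_gradient_bound
    obtain ⟨C2, hC2⟩ := hηc.1.continuous.bounded_above_of_compact_support hη.2.1
    have t1 := tendsto_integral_mul_of_tendsto_eLpNorm hp
      (fun k => (hφ k).memLp _ (volume.restrict Ω)) hu
      (b := fun x => (gradient η x) i) (C := C1)
      ((EuclideanSpace.proj (𝕜 := ℝ) i).continuous.comp
        (continuous_gradient hηc.1)).aestronglyMeasurable
      (fun x => (PiLp.norm_apply_le _ i).trans (hC1 x)) h1
    have t2 := tendsto_integral_mul_of_tendsto_eLpNorm hp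
      (f := fun k x => (gradient (φ k) x) i) (g := fun x => G x i)
      (fun k => MemLp.of_le ((hφ k).memLp_gradient _ (volume.restrict Ω))
        ((EuclideanSpace.proj (𝕜 := ℝ) i).continuous.comp
          (continuous_gradient (hφ k).1)).aestronglyMeasurable
        (Eventually.of_forall fun x => PiLp.norm_apply_le _ i))
      (MemLp.of_le hG ((EuclideanSpace.proj (𝕜 := ℝ) i).continuous.comp_aestronglyMeasurable hG.1)
        (Eventually.of_forall fun x => PiLp.norm_apply_le _ i))
      (b := η) (C := C2) hηc.1.continuous.aestronglyMeasurable hC2 ?_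
    · refine tendsto_nhds_unique t1 (t2.neg.congr fun k => ?_)
      exact (integral_mul_gradient_eq (hφ k).1 hη i).symm
    · refine tendsto_of_tendsto_of_tendsto_of_le_of_le tendsto_const_nhds h2 (fun _ => zero_le)
        fun k => eLpNorm_mono fun x => ?_
      exact PiLp.norm_apply_le (G x - gradient (φ k) x) i
  · have hex : ∀ k : ℕ, ∃ ψ, IsTest U ψ ∧ ∀ x, |φ k x - ψ x| ≤ 1 / ((k : ℝ) + 1) ∧
        ‖gradient (φ k) x - gradient ψ x‖ ≤ 1 / ((k : ℝ) + 1) :=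
      fun k => (hφ k).exists_isTest hU (by positivity)
    choose ψ hψ hψ2 using hex
    exact ⟨ψ, hψ, tendsto_eLpNorm_sub_of_norm_sub_le hp hu.1
        (fun k => ((hφ k).memLp (ENNReal.ofReal p) _).1)
        (fun k => ((hψ k).isC1Test.memLp (ENNReal.ofReal p) _).1)
        (fun k x => (hψ2 k x).1) h1,
      tendsto_eLpNorm_sub_of_norm_sub_le hp hG.1
        (fun k => ((hφ k).memLp_gradient (ENNReal.ofReal p) _).1)
        (fun k => ((hψ k).isC1Test.memLp_gradient (ENNReal.ofReal p) _).1)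
        (fun k x => (hψ2 k x).2) h2⟩

theorem IsC1Test.memVanishing [IsFiniteMeasure (volume.restrict Ω)] (hp : 2 ≤ p) (hU : IsOpen U)
    {φ : E n → ℝ} (h : IsC1Test U φ) : MemVanishing p Ω U φ (gradient φ) :=
  memVanishing_of_tendsto hp hU (h.memLp _ _) (h.memLp_gradient _ _) (φ := fun _ => φ)
    (fun _ => h) (by simp) (by simp)

theorem MemVanishing.add_smul [IsFiniteMeasure (volume.restrict Ω)] (hp : 2 ≤ p) (hU : IsOpen U)
    {u v : E n → ℝ} {G H : E n → E n} (hu : MemVanishing p Ω U u G) (hv : MemVanishing p Ω U v H)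
    (a b : ℝ) :
    MemVanishing p Ω U (fun x => a * u x + b * v x) (fun x => a • G x + b • H x) := by
  obtain ⟨⟨hu1, hG1, -⟩, φ, hφ, hφ1, hφ2⟩ := hu
  obtain ⟨⟨hv1, hH1, -⟩, ψ, hψ, hψ1, hψ2⟩ := hv
  have key : ∀ {F : Type} [NormedAddCommGroup F] [NormedSpace ℝ F]
      {f g : E n → F} {f' g' : ℕ → E n → F}
      (_ : AEStronglyMeasurable f (volume.restrict Ω))
      (_ : AEStronglyMeasurable g (volume.restrict Ω))
      (_ : ∀ k, AEStronglyMeasurable (f' k) (volume.restrict Ω))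
      (_ : ∀ k, AEStronglyMeasurable (g' k) (volume.restrict Ω))
      (_ : Tendsto (fun k => eLpNorm (fun x => f x - f' k x) (ENNReal.ofReal p)
        (volume.restrict Ω)) atTop (𝓝 0))
      (_ : Tendsto (fun k => eLpNorm (fun x => g x - g' k x) (ENNReal.ofReal p)
        (volume.restrict Ω)) atTop (𝓝 0)),
      Tendsto (fun k => eLpNorm (fun x => (a • f x + b • g x) - (a • f' k x + b • g' k x))
        (ENNReal.ofReal p) (volume.restrict Ω)) atTop (𝓝 0) := by
    intro F _ _ f g f' g' mf mg mf' mg' h1 h2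
    have t := (ENNReal.Tendsto.const_mul (a := ‖a‖ₑ) h1 (Or.inr enorm_ne_top)).add
      (ENNReal.Tendsto.const_mul (a := ‖b‖ₑ) h2 (Or.inr enorm_ne_top))
    rw [mul_zero, mul_zero, add_zero] at t
    refine tendsto_of_tendsto_of_tendsto_of_le_of_le tendsto_const_nhds t (fun _ => zero_le)
        fun k => ?_
    have e : (fun x => (a • f x + b • g x) - (a • f' k x + b • g' k x)) =
        a • (fun x => f x - f' k x) + b • fun x => g x - g' k x := by
      ext x; simp only [Pi.add_apply, Pi.smul_apply, smul_sub]; abel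
    rw [e]
    refine (eLpNorm_add_le ((mf.sub (mf' k)).const_smul a) ((mg.sub (mg' k)).const_smul b)
      (one_le_ofReal_of_two_le hp)).trans ?_
    rw [eLpNorm_const_smul, eLpNorm_const_smul]
    exact le_rfl
  refine memVanishing_of_tendsto hp hU ((hu1.const_mul a).add (hv1.const_mul b))
    ((hG1.const_smul a).add (hH1.const_smul b)) (φ := fun k x => a * φ k x + b * ψ k x)
    (fun k => ((hφ k).isC1Test.const_mul a).add ((hψ k).isC1Test.const_mul b)) ?_ ?_
  · exact key hu1.1 hv1.1 (fun k => ((hφ k).isC1Test.memLp (ENNReal.ofReal p) _).1)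
      (fun k => ((hψ k).isC1Test.memLp (ENNReal.ofReal p) _).1) hφ1 hψ1
  · have := key hG1.1 hH1.1 (fun k => ((hφ k).isC1Test.memLp_gradient (ENNReal.ofReal p) _).1)
      (fun k => ((hψ k).isC1Test.memLp_gradient (ENNReal.ofReal p) _).1) hφ2 hψ2
    refine this.congr fun k => ?_
    congr 1
    ext1 x
    rw [gradient_const_mul_add (hφ k).isC1Test.1 (hψ k).isC1Test.1]

end Vanishing

/-! ### Elliptic fields of matrices -/

section Pointwise

variable {n : ℕ}

/-- The norm `√(B ξ · ξ)`. -/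
def bnorm (B : Matrix (Fin n) (Fin n) ℝ) (ξ : E n) : ℝ := √(form B ξ ξ)

/-- `|B ξ · ξ|^((p-2)/2) B ξ · η`. -/
def flux (p : ℝ) (B : Matrix (Fin n) (Fin n) ℝ) (ξ η : E n) : ℝ :=
  |form B ξ ξ| ^ ((p - 2) / 2) * form B ξ η

/-- `S` is a square root of the quadratic form of `B`, bounded above and below. -/
def IsRoot (B : Matrix (Fin n) (Fin n) ℝ) (c K : ℝ) (S : E n →ₗ[ℝ] E n) : Prop :=
  (∀ ξ η, form B ξ η = inner ℝ (S ξ) (S η)) ∧ ∀ ξ, c * ‖ξ‖ ≤ ‖S ξ‖ ∧ ‖S ξ‖ ≤ K * ‖ξ‖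

variable {B : Matrix (Fin n) (Fin n) ℝ} {c K : ℝ} {S : E n →ₗ[ℝ] E n}

theorem IsRoot.bnorm_eq (h : IsRoot B c K S) (ξ : E n) : bnorm B ξ = ‖S ξ‖ := by
  rw [bnorm, h.1, real_inner_self_eq_norm_sq, Real.sqrt_sq (norm_nonneg _)]

theorem IsRoot.flux_eq (h : IsRoot B c K S) (p : ℝ) (ξ η : E n) :
    flux p B ξ η = ‖S ξ‖ ^ (p - 2) * inner ℝ (S ξ) (S η) := by
  rw [flux, h.1, h.1, real_inner_self_eq_norm_sq, abs_of_nonneg (by positivity),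
    ← Real.rpow_natCast, ← Real.rpow_mul (norm_nonneg _)]
  congr 2; push_cast; ring

theorem IsRoot.flux_self (h : IsRoot B c K S) {p : ℝ} (hp : 2 ≤ p) (ξ : E n) :
    flux p B ξ ξ = bnorm B ξ ^ p := by
  rw [h.flux_eq, h.bnorm_eq, real_inner_self_eq_norm_sq, rpow_sub_two_mul_sq hp (norm_nonneg _)]

theorem IsRoot.abs_flux_le (h : IsRoot B c K S) {p : ℝ} (hp : 2 ≤ p) (ξ η : E n) :
    |flux p B ξ η| ≤ bnorm B ξ ^ (p - 1) * bnorm B η := by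
  rw [h.flux_eq, h.bnorm_eq, h.bnorm_eq]
  exact abs_norm_rpow_mul_inner_le hp _ _

theorem bnorm_nonneg (B : Matrix (Fin n) (Fin n) ℝ) (ξ : E n) : 0 ≤ bnorm B ξ := Real.sqrt_nonneg _

theorem rpow_sub_one_mul_le {p : ℝ} (hp : 2 ≤ p) {x y : ℝ} (hx : 0 ≤ x) (hy : 0 ≤ y) :
    x ^ (p - 1) * y ≤ (x + y) ^ p := by
  rw [← rpow_sub_two_mul_sq hp (by positivity : 0 ≤ x + y), sq, ← mul_assoc,
    rpow_sub_two_mul_self hp (by positivity)]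
  gcongr
  · linarith
  · linarith
  · linarith

/-- The remainder becomes `δ²` times a majorant that does not depend on the perturbation, so one
constant serves a whole family after integration. -/
theorem norm_add_rpow_le_of_norm_le {F : Type*} [NormedAddCommGroup F] [InnerProductSpace ℝ F]
    {p : ℝ} (hp : 2 ≤ p) {a h : F} {δ M : ℝ} (hδ0 : 0 ≤ δ) (hδ : δ ≤ 1) (hM : 0 ≤ M)
    (hh : ‖h‖ ≤ δ * M) :
    ‖a + h‖ ^ p ≤ ‖a‖ ^ p + p * (‖a‖ ^ (p - 2) * inner ℝ a h) +
      p ^ 2 * (δ ^ 2 * (‖a‖ + M) ^ p) := by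
  refine (norm_add_rpow_le_taylor hp a h).trans ?_
  have h1 : ‖h‖ ≤ M := hh.trans (by nlinarith)
  have h2 : (‖a‖ + ‖h‖) ^ (p - 2) ≤ (‖a‖ + M) ^ (p - 2) :=
    Real.rpow_le_rpow (by positivity) (by linarith) (by linarith)
  have h3 : ‖h‖ ^ 2 ≤ δ ^ 2 * (‖a‖ + M) ^ 2 := by
    rw [← mul_pow]
    refine pow_le_pow_left₀ (norm_nonneg _) (hh.trans ?_) 2
    exact mul_le_mul_of_nonneg_left (by linarith [norm_nonneg a]) hδ0
  have h4 : (‖a‖ + ‖h‖) ^ (p - 2) * ‖h‖ ^ 2 ≤ (‖a‖ + M) ^ (p - 2) * (δ ^ 2 * (‖a‖ + M) ^ 2) :=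
    mul_le_mul h2 h3 (by positivity) (by positivity)
  have h5 : (‖a‖ + M) ^ (p - 2) * (δ ^ 2 * (‖a‖ + M) ^ 2) = δ ^ 2 * (‖a‖ + M) ^ p := by
    rw [← rpow_sub_two_mul_sq hp (by positivity : 0 ≤ ‖a‖ + M)]; ring
  rw [h5] at h4
  have := mul_le_mul_of_nonneg_left h4 (sq_nonneg p)
  linarith

theorem exists_isRoot (hs : B.IsSymm) {M : ℝ} (hM : ∀ i j, |B i j| ≤ M) {c : ℝ} (hc : 0 < c)
    (hB : ∀ ξ : E n, c * ‖ξ‖ ^ 2 ≤ form B ξ ξ) :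
    -- The upper constant comes from the crude entrywise bound `n² |M|` on the form; the `+ 1` keeps
    -- it positive when that bound vanishes.
    ∃ S, IsRoot B (√c) (√(n * n * |M| + 1)) S := by
  obtain ⟨S, hS⟩ := exists_form_eq_inner hs fun ξ => (by positivity : 0 ≤ c * ‖ξ‖ ^ 2).trans (hB ξ)
  refine ⟨S, hS, fun ξ => ⟨?_, ?_⟩⟩
  · have h := hB ξ
    rw [hS, real_inner_self_eq_norm_sq] at h
    refine abs_le_of_sq_le_sq' ?_ (norm_nonneg _) |>.2
    rw [mul_pow, Real.sq_sqrt hc.le]; exact h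
  · have h0 : ‖S ξ‖ ^ 2 = form B ξ ξ := by rw [hS, real_inner_self_eq_norm_sq]
    have hi : ∀ i, |ξ i| ≤ ‖ξ‖ := fun i => PiLp.norm_apply_le ξ i
    have h1 : form B ξ ξ ≤ n * n * |M| * ‖ξ‖ ^ 2 := by
      have : form B ξ ξ = ∑ i, ∑ j, B i j * ξ j * ξ i := by
        simp only [form, dotProduct, Matrix.mulVec, Finset.sum_mul]
      rw [this]
      calc _ ≤ ∑ _i : Fin n, ∑ _j : Fin n, |M| * ‖ξ‖ ^ 2 := by
            refine Finset.sum_le_sum fun i _ => Finset.sum_le_sum fun j _ => ?_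
            refine (le_abs_self _).trans ?_
            rw [abs_mul, abs_mul, sq, ← mul_assoc]
            have := (hM i j).trans (le_abs_self M)
            gcongr
            · exact hi j
            · exact hi i
        _ = _ := by simp; ring
    refine abs_le_of_sq_le_sq' ?_ (by positivity) |>.2
    rw [mul_pow, Real.sq_sqrt (by positivity), h0]
    nlinarith [sq_nonneg ‖ξ‖]

end Pointwise

/-- A measurable field of symmetric matrices, uniformly bounded and uniformly positive
definite. -/
def Elliptic {α : Type*} [MeasurableSpace α] {n : ℕ} (m : Measure α)
    (B : α → Matrix (Fin n) (Fin n) ℝ) : Prop :=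
  (∀ i j, AEMeasurable (fun x => B x i j) m) ∧
  ∃ c K : ℝ, 0 < c ∧ 0 < K ∧ ∀ᵐ x ∂m, ∃ S, IsRoot (B x) c K S

section Field

variable {α : Type*} [MeasurableSpace α] {m : Measure α} {n : ℕ}
  {B : α → Matrix (Fin n) (Fin n) ℝ} {p : ℝ}

theorem elliptic_of_bounds (hmeas : ∀ i j, AEMeasurable (fun x => B x i j) m)
    (hs : ∀ᵐ x ∂m, (B x).IsSymm) {M : ℝ} (hM : ∀ᵐ x ∂m, ∀ i j, |B x i j| ≤ M) {c : ℝ} (hc : 0 < c)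
    (hB : ∀ᵐ x ∂m, ∀ ξ : E n, c * ‖ξ‖ ^ 2 ≤ form (B x) ξ ξ) : Elliptic m B := by
  refine ⟨hmeas, √c, √(n * n * |M| + 1), Real.sqrt_pos.2 hc, Real.sqrt_pos.2 (by positivity), ?_⟩
  filter_upwards [hs, hM, hB] with x h1 h2 h3 using exists_isRoot h1 h2 hc h3

theorem aestronglyMeasurable_form (hmeas : ∀ i j, AEMeasurable (fun x => B x i j) m)
    {G H : α → E n} (hG : AEStronglyMeasurable G m) (hH : AEStronglyMeasurable H m) :
    AEStronglyMeasurable (fun x => form (B x) (G x) (H x)) m := by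
  have hi : ∀ {G : α → E n}, AEStronglyMeasurable G m → ∀ i, AEMeasurable (fun x => G x i) m :=
    fun h i => ((EuclideanSpace.proj (𝕜 := ℝ) i).continuous.comp_aestronglyMeasurable h).aemeasurable
  have : (fun x => form (B x) (G x) (H x)) =
      fun x => ∑ i, (∑ j, B x i j * G x j) * H x i := by
    ext x; simp only [form, dotProduct, Matrix.mulVec]
  rw [this]
  refine (Finset.aemeasurable_fun_sum _ fun i _ => ?_).aestronglyMeasurable
  exact (Finset.aemeasurable_fun_sum _ fun j _ => (hmeas i j).mul (hi hG j)).mul (hi hH i)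

theorem aestronglyMeasurable_bnorm (hmeas : ∀ i j, AEMeasurable (fun x => B x i j) m)
    {G : α → E n} (hG : AEStronglyMeasurable G m) :
    AEStronglyMeasurable (fun x => bnorm (B x) (G x)) m :=
  Real.continuous_sqrt.comp_aestronglyMeasurable (aestronglyMeasurable_form hmeas hG hG)

theorem aestronglyMeasurable_flux (hmeas : ∀ i j, AEMeasurable (fun x => B x i j) m)
    {G H : α → E n} (hG : AEStronglyMeasurable G m) (hH : AEStronglyMeasurable H m) :
    AEStronglyMeasurable (fun x => flux p (B x) (G x) (H x)) m := by
  refine AEMeasurable.aestronglyMeasurable ?_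
  have h1 := (aestronglyMeasurable_form hmeas hG hG).aemeasurable
  have h2 := (aestronglyMeasurable_form hmeas hG hH).aemeasurable
  exact ((continuous_abs.measurable.comp_aemeasurable h1).pow_const _).mul h2

theorem Elliptic.memLp_bnorm (hB : Elliptic m B) {G : α → E n} {q : ℝ≥0∞} (hG : MemLp G q m) :
    MemLp (fun x => bnorm (B x) (G x)) q m := by
  obtain ⟨hm, c, K, -, -, h⟩ := hB
  refine hG.of_le_mul (c := K) (aestronglyMeasurable_bnorm hm hG.1) ?_
  filter_upwards [h] with x ⟨S, hS⟩
  rw [hS.bnorm_eq, norm_norm]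
  exact (hS.2 _).2

theorem Elliptic.integrable_bnorm_rpow (hB : Elliptic m B) (hp : 2 ≤ p) {G : α → E n}
    (hG : MemLp G (ENNReal.ofReal p) m) : Integrable (fun x => bnorm (B x) (G x) ^ p) m := by
  refine (integrable_norm_rpow_of_memLp hp (hB.memLp_bnorm hG)).congr ?_
  exact Eventually.of_forall fun x => by simp [abs_of_nonneg (bnorm_nonneg _ _)]

theorem Elliptic.integrable_flux (hB : Elliptic m B) (hp : 2 ≤ p) {G H : α → E n}
    (hG : MemLp G (ENNReal.ofReal p) m) (hH : MemLp H (ENNReal.ofReal p) m) :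
    Integrable (fun x => flux p (B x) (G x) (H x)) m := by
  have h1 := integrable_norm_rpow_of_memLp hp ((hB.memLp_bnorm hG).add (hB.memLp_bnorm hH))
  refine h1.mono' (aestronglyMeasurable_flux hB.1 hG.1 hH.1) ?_
  obtain ⟨hm, c, K, -, -, h⟩ := hB
  filter_upwards [h] with x ⟨S, hS⟩
  refine (hS.abs_flux_le hp _ _).trans ?_
  rw [Pi.add_apply, Real.norm_of_nonneg (add_nonneg (bnorm_nonneg _ _) (bnorm_nonneg _ _))]
  exact rpow_sub_one_mul_le hp (bnorm_nonneg _ _) (bnorm_nonneg _ _)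

theorem integrable_abs_rpow (hp : 2 ≤ p) {u : α → ℝ} (hu : MemLp u (ENNReal.ofReal p) m) :
    Integrable (fun x => |u x| ^ p) m := integrable_norm_rpow_of_memLp hp hu

theorem integrable_rpow_sub_two_mul (hp : 2 ≤ p) {u v : α → ℝ}
    (hu : MemLp u (ENNReal.ofReal p) m) (hv : MemLp v (ENNReal.ofReal p) m) :
    Integrable (fun x => |u x| ^ (p - 2) * u x * v x) m := by
  have h1 := integrable_norm_rpow_of_memLp hp (hu.norm.add hv.norm)
  refine h1.mono' ?_ (Eventually.of_forall fun x => ?_)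
  · exact ((((continuous_abs.measurable.comp_aemeasurable hu.1.aemeasurable).pow_const _).mul
      hu.1.aemeasurable).mul hv.1.aemeasurable).aestronglyMeasurable
  · rw [Pi.add_apply, Real.norm_of_nonneg (by positivity : 0 ≤ ‖u x‖ + ‖v x‖), norm_mul, norm_mul,
      Real.norm_of_nonneg (Real.rpow_nonneg (abs_nonneg _) _)]
    simp only [Real.norm_eq_abs]
    rw [rpow_sub_two_mul_self hp (abs_nonneg _)]
    exact rpow_sub_one_mul_le hp (abs_nonneg _) (abs_nonneg _)

theorem abs_rpow_tangent_le (hp : 2 ≤ p) (a h : ℝ) :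
    |a| ^ p + p * (|a| ^ (p - 2) * a * h) ≤ |a + h| ^ p := by
  have := norm_rpow_tangent_le hp a h
  simp only [Real.norm_eq_abs, Real.inner_apply] at this
  linarith

theorem integral_abs_rpow_tangent_le (hp : 2 ≤ p) {u v : α → ℝ}
    (hu : MemLp u (ENNReal.ofReal p) m) (hv : MemLp v (ENNReal.ofReal p) m) (t : ℝ) :
    ∫ x, |u x| ^ p ∂m + t * (p * ∫ x, |u x| ^ (p - 2) * u x * v x ∂m) ≤
      ∫ x, |u x + t * v x| ^ p ∂m := by
  have i1 := integrable_abs_rpow hp hu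
  have i2 := integrable_rpow_sub_two_mul hp hu hv
  have i3 : Integrable (fun x => |u x + t * v x| ^ p) m :=
    integrable_abs_rpow hp (hu.add (hv.const_mul t))
  rw [← integral_const_mul, ← integral_const_mul, ← integral_add i1 ((i2.const_mul p).const_mul t)]
  refine integral_mono (i1.add ((i2.const_mul p).const_mul t)) i3 fun x => ?_
  have := abs_rpow_tangent_le hp (u x) (t * v x)
  simp only
  linarith

/-- Second order Taylor estimate for the energy, uniform over perturbations of size `δ M`. -/
theorem Elliptic.exists_integral_bnorm_add_le (hB : Elliptic m B) (hp : 2 ≤ p) {G : α → E n}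
    {M : α → ℝ} (hG : MemLp G (ENNReal.ofReal p) m) (hM : MemLp M (ENNReal.ofReal p) m) :
    ∃ C, 0 ≤ C ∧ ∀ (δ : ℝ) (H : α → E n), 0 ≤ δ → δ ≤ 1 → MemLp H (ENNReal.ofReal p) m →
      (∀ x, ‖H x‖ ≤ δ * M x) → ∫ x, bnorm (B x) (G x + H x) ^ p ∂m ≤
      ∫ x, bnorm (B x) (G x) ^ p ∂m + p * ∫ x, flux p (B x) (G x) (H x) ∂m + δ ^ 2 * C := by
  obtain ⟨c, K, -, hK, h⟩ := hB.2
  have j1 := hB.integrable_bnorm_rpow hp hG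
  have j3 := integrable_norm_rpow_of_memLp hp ((hB.memLp_bnorm hG).add (hM.norm.const_mul K))
  refine ⟨p ^ 2 * ∫ x, ‖((fun x => bnorm (B x) (G x)) + fun x => K * ‖M x‖) x‖ ^ p ∂m,
    by positivity, fun δ H hδ0 hδ hH hHM => ?_⟩
  have j2 := hB.integrable_flux hp hG hH
  have j4 : Integrable (fun x => bnorm (B x) (G x + H x) ^ p) m :=
    hB.integrable_bnorm_rpow hp (hG.add hH)
  have k2 := j2.const_mul p
  have k3 := (j3.const_mul (p ^ 2)).const_mul (δ ^ 2)
  rw [← integral_const_mul, ← integral_const_mul, ← integral_const_mul,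
    ← integral_add j1 k2, ← integral_add (show Integrable (fun x => bnorm (B x) (G x) ^ p +
      p * flux p (B x) (G x) (H x)) m from j1.add k2) k3]
  refine integral_mono_ae j4 ((j1.add k2).add k3) ?_
  filter_upwards [h] with x ⟨S, hS⟩
  have hSH : ‖S (H x)‖ ≤ δ * (K * ‖M x‖) := by
    refine ((hS.2 _).2.trans (mul_le_mul_of_nonneg_left ((hHM x).trans
      (mul_le_mul_of_nonneg_left (le_abs_self _) hδ0)) hK.le)).trans (le_of_eq ?_)
    rw [Real.norm_eq_abs]; ring
  have := norm_add_rpow_le_of_norm_le hp (a := S (G x)) hδ0 hδ (by positivity) hSH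
  simp only [Pi.add_apply]
  rw [hS.bnorm_eq, hS.bnorm_eq, hS.flux_eq, map_add, Real.norm_of_nonneg (by positivity)]
  refine this.trans (le_of_eq ?_)
  ring

theorem flux_smul_right (p : ℝ) (B : Matrix (Fin n) (Fin n) ℝ) (ξ η : E n) (t : ℝ) :
    flux p B ξ (t • η) = t * flux p B ξ η := by
  have : form B ξ (t • η) = t * form B ξ η := by
    rw [form, form, ← smul_eq_mul, ← dotProduct_smul]; rfl
  rw [flux, flux, this]; ring

theorem Elliptic.exists_integral_bnorm_taylor (hB : Elliptic m B) (hp : 2 ≤ p) {G H : α → E n}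
    (hG : MemLp G (ENNReal.ofReal p) m) (hH : MemLp H (ENNReal.ofReal p) m) :
    ∃ C, ∀ t : ℝ, |t| ≤ 1 → ∫ x, bnorm (B x) (G x + t • H x) ^ p ∂m ≤
      ∫ x, bnorm (B x) (G x) ^ p ∂m + t * (p * ∫ x, flux p (B x) (G x) (H x) ∂m) + t ^ 2 * C := by
  obtain ⟨C, -, hC⟩ := hB.exists_integral_bnorm_add_le hp hG hH.norm
  refine ⟨C, fun t ht => ?_⟩
  have := hC |t| (fun x => t • H x) (abs_nonneg t) ht (hH.const_smul t)
    fun x => (norm_smul t (H x)).le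
  simp only [flux_smul_right, integral_const_mul, sq_abs] at this
  linarith

/-- Clarkson's inequality for the energy. -/
theorem Elliptic.integral_clarkson (hB : Elliptic m B) (hp : 2 ≤ p) {G H : α → E n}
    (hG : MemLp G (ENNReal.ofReal p) m) (hH : MemLp H (ENNReal.ofReal p) m) :
    ∫ x, bnorm (B x) (G x + H x) ^ p ∂m + ∫ x, bnorm (B x) (G x - H x) ^ p ∂m ≤
      2 ^ (p - 1) * (∫ x, bnorm (B x) (G x) ^ p ∂m + ∫ x, bnorm (B x) (H x) ^ p ∂m) := by
  have j1 := hB.integrable_bnorm_rpow hp hG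
  have j2 := hB.integrable_bnorm_rpow hp hH
  have j3 : Integrable (fun x => bnorm (B x) (G x + H x) ^ p) m :=
    hB.integrable_bnorm_rpow hp (hG.add hH)
  have j4 : Integrable (fun x => bnorm (B x) (G x - H x) ^ p) m :=
    hB.integrable_bnorm_rpow hp (hG.sub hH)
  rw [← integral_add j3 j4, ← integral_add j1 j2, ← integral_const_mul]
  refine integral_mono_ae (j3.add j4) ((j1.add j2).const_mul _) ?_
  obtain ⟨hm, c, K, -, -, h⟩ := hB
  filter_upwards [h] with x ⟨S, hS⟩
  simp only [hS.bnorm_eq, map_add, map_sub]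
  exact clarkson hp _ _

theorem Elliptic.tendsto_integral_bnorm_rpow (hB : Elliptic m B) (hp : 2 ≤ p) {f : ℕ → α → E n}
    {g : α → E n} (hf : ∀ k, MemLp (f k) (ENNReal.ofReal p) m)
    (hg : MemLp g (ENNReal.ofReal p) m)
    (h : Tendsto (fun k => eLpNorm (fun x => g x - f k x) (ENNReal.ofReal p) m) atTop (𝓝 0)) :
    Tendsto (fun k => ∫ x, bnorm (B x) (f k x) ^ p ∂m) atTop
      (𝓝 (∫ x, bnorm (B x) (g x) ^ p ∂m)) := by
  have hB' := hB
  obtain ⟨hm, c, K, -, hK, hS⟩ := hB'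
  have := tendsto_integral_norm_rpow hp (f := fun k x => bnorm (B x) (f k x))
    (g := fun x => bnorm (B x) (g x)) (fun k => hB.memLp_bnorm (hf k)) (hB.memLp_bnorm hg) ?_
  · simpa only [Real.norm_of_nonneg (bnorm_nonneg _ _)] using this
  · have t := ENNReal.Tendsto.const_mul (a := ENNReal.ofReal K) h (Or.inr ENNReal.ofReal_ne_top)
    rw [mul_zero] at t
    refine tendsto_of_tendsto_of_tendsto_of_le_of_le tendsto_const_nhds t (fun _ => zero_le)
      fun k => eLpNorm_le_mul_eLpNorm_of_ae_le_mul ?_ _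
    filter_upwards [hS] with x ⟨S, hS⟩
    rw [hS.bnorm_eq, hS.bnorm_eq]
    refine (abs_norm_sub_norm_le _ _).trans ?_
    rw [← map_sub]
    exact (hS.2 _).2

theorem Elliptic.integral_flux_self (hB : Elliptic m B) (hp : 2 ≤ p) (G : α → E n) :
    ∫ x, flux p (B x) (G x) (G x) ∂m = ∫ x, bnorm (B x) (G x) ^ p ∂m := by
  obtain ⟨hm, c, K, -, -, h⟩ := hB
  refine integral_congr_ae ?_
  filter_upwards [h] with x ⟨S, hS⟩ using hS.flux_self hp _

theorem integral_rpow_sub_two_mul_self (hp : 2 ≤ p) (u : α → ℝ) :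
    ∫ x, |u x| ^ (p - 2) * u x * u x ∂m = ∫ x, |u x| ^ p ∂m := by
  refine integral_congr_ae (Eventually.of_forall fun x => ?_)
  simp only
  rw [← rpow_sub_two_mul_sq hp (abs_nonneg _), sq_abs]; ring

theorem integral_bnorm_rpow_nonneg (B : α → Matrix (Fin n) (Fin n) ℝ) (G : α → E n) :
    0 ≤ ∫ x, bnorm (B x) (G x) ^ p ∂m :=
  integral_nonneg fun _ => Real.rpow_nonneg (bnorm_nonneg _ _) _

theorem integral_abs_rpow_pos (hp : 2 ≤ p) {u : α → ℝ}
    (hu : MemLp u (ENNReal.ofReal p) m) (h0 : ¬ u =ᵐ[m] 0) : 0 < ∫ x, |u x| ^ p ∂m := by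
  have h1 : 0 ≤ ∫ x, |u x| ^ p ∂m := integral_nonneg fun _ => by positivity
  refine lt_of_le_of_ne h1 fun h => h0 ?_
  have := (integral_eq_zero_iff_of_nonneg (fun _ => by positivity)
    (integrable_abs_rpow hp hu)).1 h.symm
  filter_upwards [this] with x hx
  by_contra hne
  have : 0 < |u x| ^ p := Real.rpow_pos_of_pos (abs_pos.2 hne) _
  exact this.ne' hx

end Field

/-! ### Existence of the first eigenvalue -/

section Existence

variable {n : ℕ} {p : ℝ} {Ω U : Set (E n)} {B : E n → Matrix (Fin n) (Fin n) ℝ}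

theorem Elliptic.integral_bnorm_smul {α : Type*} [MeasurableSpace α] {m : Measure α}
    {B : α → Matrix (Fin n) (Fin n) ℝ} (hB : Elliptic m B) (c : ℝ) (G : α → E n) :
    ∫ x, bnorm (B x) (c • G x) ^ p ∂m = |c| ^ p * ∫ x, bnorm (B x) (G x) ^ p ∂m := by
  obtain ⟨hm, _, K, -, -, h⟩ := hB
  rw [← integral_const_mul]
  refine integral_congr_ae ?_
  filter_upwards [h] with x ⟨S, hS⟩
  rw [hS.bnorm_eq, hS.bnorm_eq, map_smul, norm_smul, Real.mul_rpow (norm_nonneg _) (norm_nonneg _),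
    Real.norm_eq_abs]

/-- Mass and energy are continuous in `W^{1,p}`, so Rayleigh bounds pass from test functions to
their closure. -/
theorem MemVanishing.mul_integral_le_of_forall_isTest (hp : 2 ≤ p)
    (hB : Elliptic (volume.restrict Ω) B) {μ : ℝ}
    (hμ : ∀ φ, IsTest U φ → μ * ∫ x in Ω, |φ x| ^ p ≤ ∫ x in Ω, bnorm (B x) (gradient φ x) ^ p)
    {u : E n → ℝ} {G : E n → E n} (h : MemVanishing p Ω U u G) :
    μ * ∫ x in Ω, |u x| ^ p ≤ ∫ x in Ω, bnorm (B x) (G x) ^ p := by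
  obtain ⟨⟨hu, hG, -⟩, φ, hφ, h1, h2⟩ := h
  have t1 := tendsto_integral_norm_rpow hp (fun k => (hφ k).isC1Test.memLp _ _) hu h1
  have t2 := hB.tendsto_integral_bnorm_rpow hp (fun k => (hφ k).isC1Test.memLp_gradient _ _) hG h2
  exact le_of_tendsto_of_tendsto' (t1.const_mul μ) t2 fun k => hμ _ (hφ k)

theorem IsEigenpair.energy_eq (hp : 2 ≤ p) (hB : Elliptic (volume.restrict Ω) B) {lam : ℝ}
    {u : E n → ℝ} {G : E n → E n} (h : IsEigenpair p B Ω U lam u G) :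
    ∫ x in Ω, bnorm (B x) (G x) ^ p = lam * ∫ x in Ω, |u x| ^ p := by
  rw [← hB.integral_flux_self hp, ← integral_rpow_sub_two_mul_self hp]
  exact h.2.2 u G h.1

theorem eq_zero_of_forall_mul_le {a C : ℝ} (h : ∀ t : ℝ, |t| ≤ 1 → t * a ≤ t ^ 2 * C) : a = 0 := by
  have key : ∀ a : ℝ, (∀ t : ℝ, |t| ≤ 1 → t * a ≤ t ^ 2 * C) → a ≤ 0 := by
    intro a h
    by_contra! ha
    have hd : 0 < |C| + a + 1 := by positivity
    -- The value `t = a / (|C| + a + 1)` is admissible and satisfies `t |C| < a`, which contradicts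
    -- the inequality divided by `t`.
    have hq : a / (|C| + a + 1) ≤ 1 := by
      rw [div_le_one hd]; linarith [abs_nonneg C]
    have hq0 : 0 < a / (|C| + a + 1) := by positivity
    have h1 := h (a / (|C| + a + 1)) (by rwa [abs_of_pos hq0])
    have h2 : a ≤ a / (|C| + a + 1) * |C| := by
      have : a / (|C| + a + 1) * a ≤ a / (|C| + a + 1) * (a / (|C| + a + 1) * |C|) := by
        nlinarith [le_abs_self C, sq_nonneg (a / (|C| + a + 1))]
      exact le_of_mul_le_mul_left this hq0
    have h3 : a / (|C| + a + 1) * |C| < a := by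
      rw [div_mul_eq_mul_div, div_lt_iff₀ hd]
      nlinarith
    linarith
  refine le_antisymm (key a h) ?_
  have := key (-a) fun t ht => by
    have := h (-t) (by rwa [abs_neg])
    rw [neg_sq] at this; linarith
  linarith

/-- A minimizer of the Rayleigh quotient is an eigenfunction. -/
theorem isEigenpair_of_minimizer [IsFiniteMeasure (volume.restrict Ω)] (hp : 2 ≤ p)
    (hU : IsOpen U) (hB : Elliptic (volume.restrict Ω) B) {lam : ℝ} (hlam : 0 ≤ lam)
    {u : E n → ℝ} {G : E n → E n} (hu : MemVanishing p Ω U u G)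
    (hu0 : ¬ u =ᵐ[volume.restrict Ω] 0)
    (heq : ∫ x in Ω, bnorm (B x) (G x) ^ p = lam * ∫ x in Ω, |u x| ^ p)
    (hmin : ∀ v H, MemVanishing p Ω U v H →
      lam * ∫ x in Ω, |v x| ^ p ≤ ∫ x in Ω, bnorm (B x) (H x) ^ p) :
    IsEigenpair p B Ω U lam u G := by
  refine ⟨hu, hu0, fun v H hv => ?_⟩
  obtain ⟨C, hC⟩ := hB.exists_integral_bnorm_taylor hp hu.1.2.1 hv.1.2.1
  -- Along `u + t v` the energy is bounded above by its second-order expansion and the mass below by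
  -- its tangent. Since the quotient is minimal at `t = 0`, a linear function of `t` is dominated by
  -- a quadratic one for both signs of `t`, hence its slope is zero.
  have := eq_zero_of_forall_mul_le (C := C)
    (a := p * (lam * ∫ x in Ω, |u x| ^ (p - 2) * u x * v x) -
      p * ∫ x in Ω, flux p (B x) (G x) (H x)) fun t ht => by
    have h1 := hC t ht
    have h2 := hmin _ _ (hu.add_smul hp hU hv 1 t)
    simp only [one_mul, one_smul] at h2
    have h3 := integral_abs_rpow_tangent_le hp hu.1.1 hv.1.1 t
    have h4 := mul_le_mul_of_nonneg_left h3 hlam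
    rw [heq] at h1
    linarith
  have hp0 : p ≠ 0 := by linarith
  have h5 : lam * ∫ x in Ω, |u x| ^ (p - 2) * u x * v x = ∫ x in Ω, flux p (B x) (G x) (H x) :=
    mul_left_cancel₀ hp0 (by linarith)
  exact h5.symm

/-- Sequences of test functions bounded in `W^{1,p}(Ω)` have subsequences that are Cauchy in
`L^p(Ω)`. -/
def TestCompact (p : ℝ) (Ω U : Set (E n)) : Prop :=
  ∀ φ : ℕ → E n → ℝ, (∀ k, IsTest U (φ k)) →
    (∃ C, ∀ k, ∫ x in Ω, |φ k x| ^ p ≤ C ∧ ∫ x in Ω, ‖gradient (φ k) x‖ ^ p ≤ C) →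
    ∃ σ : ℕ → ℕ, StrictMono σ ∧ ∀ ε > 0, ∃ N, ∀ j ≥ N, ∀ k ≥ N,
      ∫ x in Ω, |φ (σ j) x - φ (σ k) x| ^ p ≤ ε

theorem tendsto_of_rpow_tendsto_zero {ι : Type*} {l : Filter ι} (hp : 2 ≤ p) {f : ι → ℝ}
    (hf : ∀ i, 0 ≤ f i) (h : Tendsto (fun i => f i ^ p) l (𝓝 0)) : Tendsto f l (𝓝 0) := by
  have := h.rpow_const (p := p⁻¹) (Or.inr (by positivity))
  rw [Real.zero_rpow (by positivity)] at this
  refine this.congr fun i => ?_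
  rw [← Real.rpow_mul (hf i), mul_inv_cancel₀ (by linarith), Real.rpow_one]

/-- A minimizing sequence of test functions converges strongly, after extraction. -/
theorem exists_memVanishing_minimizer [IsFiniteMeasure (volume.restrict Ω)] (hp : 2 ≤ p)
    (hU : IsOpen U) (hB : Elliptic (volume.restrict Ω) B) (hcomp : TestCompact p Ω U) {lam : ℝ}
    (hmin : ∀ φ, IsTest U φ →
      lam * ∫ x in Ω, |φ x| ^ p ≤ ∫ x in Ω, bnorm (B x) (gradient φ x) ^ p)
    {φ : ℕ → E n → ℝ} (hφ : ∀ k, IsTest U (φ k)) (hφ1 : ∀ k, ∫ x in Ω, |φ k x| ^ p = 1)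
    (hlim : Tendsto (fun k => ∫ x in Ω, bnorm (B x) (gradient (φ k) x) ^ p) atTop (𝓝 lam)) :
    ∃ u G, MemVanishing p Ω U u G ∧ ∫ x in Ω, |u x| ^ p = 1 ∧
      ∫ x in Ω, bnorm (B x) (G x) ^ p = lam := by
  have : Fact (1 ≤ ENNReal.ofReal p) := ⟨one_le_ofReal_of_two_le hp⟩
  have hB' := hB
  obtain ⟨-, c, K, hc, hK, hS⟩ := hB'
  have hcp : 0 < c ^ p := Real.rpow_pos_of_pos hc p
  have coer : ∀ {G : E n → E n}, MemLp G (ENNReal.ofReal p) (volume.restrict Ω) →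
      c ^ p * ∫ x in Ω, ‖G x‖ ^ p ≤ ∫ x in Ω, bnorm (B x) (G x) ^ p := by
    intro G hG
    rw [← integral_const_mul]
    refine integral_mono_ae ((integrable_norm_rpow_of_memLp hp hG).const_mul _)
      (hB.integrable_bnorm_rpow hp hG) ?_
    filter_upwards [hS] with x ⟨S, hS⟩
    rw [hS.bnorm_eq, ← Real.mul_rpow hc.le (norm_nonneg _)]
    exact Real.rpow_le_rpow (by positivity) (hS.2 _).1 (by linarith)
  have m0 : ∀ k, MemLp (φ k) (ENNReal.ofReal p) (volume.restrict Ω) :=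
    fun k => (hφ k).isC1Test.memLp _ _
  have m1 : ∀ k, MemLp (gradient (φ k)) (ENNReal.ofReal p) (volume.restrict Ω) :=
    fun k => (hφ k).isC1Test.memLp_gradient _ _
  obtain ⟨C, hC⟩ := hlim.bddAbove_range
  obtain ⟨σ, hσ, hcau⟩ := hcomp φ hφ ⟨max 1 ((c ^ p)⁻¹ * C), fun k => ⟨by
      rw [hφ1]; exact le_max_left _ _, by
      refine le_trans ?_ (le_max_right _ _)
      rw [← div_eq_inv_mul, le_div_iff₀ hcp, mul_comm]
      exact (coer (m1 k)).trans (hC ⟨k, rfl⟩)⟩⟩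
  let X : ℕ → Lp ℝ (ENNReal.ofReal p) (volume.restrict Ω) := fun k => (m0 (σ k)).toLp _
  let Y : ℕ → Lp (E n) (ENNReal.ofReal p) (volume.restrict Ω) := fun k => (m1 (σ k)).toLp _
  have hXsub : ∀ j k, ‖X j - X k‖ ^ p = ∫ x in Ω, |φ (σ j) x - φ (σ k) x| ^ p := fun j k => by
    simp only [X]
    rw [← MemLp.toLp_sub, norm_toLp_rpow hp]; rfl
  have hXadd : ∀ j k, ‖X j + X k‖ ^ p = ∫ x in Ω, |φ (σ j) x + φ (σ k) x| ^ p := fun j k => by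
    simp only [X]
    rw [← MemLp.toLp_add, norm_toLp_rpow hp]; rfl
  have hYsub : ∀ j k, ‖Y j - Y k‖ ^ p =
      ∫ x in Ω, ‖gradient (φ (σ j)) x - gradient (φ (σ k)) x‖ ^ p := fun j k => by
    simp only [Y]
    rw [← MemLp.toLp_sub, norm_toLp_rpow hp]; rfl
  have hXc : CauchySeq X := by
    rw [cauchySeq_iff_tendsto_dist_atTop_0]
    refine tendsto_of_rpow_tendsto_zero hp (fun _ => dist_nonneg) ?_
    rw [Metric.tendsto_atTop]
    intro ε hε
    obtain ⟨N, hN⟩ := hcau (ε / 2) (by positivity)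
    refine ⟨(N, N), fun jk hjk => ?_⟩
    rw [dist_eq_norm (X _), hXsub, Real.dist_eq, sub_zero,
      abs_of_nonneg (integral_nonneg fun _ => by positivity)]
    exact (hN _ hjk.1 _ hjk.2).trans_lt (by linarith)
  obtain ⟨X₀, hX₀⟩ := cauchySeq_tendsto_of_complete hXc
  have hX1 : ‖X₀‖ ^ p = 1 := by
    refine tendsto_nhds_unique (hX₀.norm.rpow_const (p := p) (Or.inr (by linarith))) ?_
    refine tendsto_const_nhds.congr fun k => ?_
    simp only [X]
    rw [norm_toLp_rpow hp]; exact (hφ1 _).symm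
  -- Clarkson bounds the energy of `φⱼ - φₖ` by `2^(p-1)(Eⱼ + Eₖ)` minus the energy of `φⱼ + φₖ`.
  -- The latter is at least `lam ‖Xⱼ + Xₖ‖^p`, which tends to `2^p lam` because the functions
  -- already converge in `L^p`. The bound therefore tends to `0`, and no weak compactness is needed.
  have hYc : CauchySeq Y := by
    rw [cauchySeq_iff_tendsto_dist_atTop_0]
    refine tendsto_of_rpow_tendsto_zero hp (fun _ => dist_nonneg) ?_
    have e1 : Tendsto (fun jk : ℕ × ℕ => X jk.1) atTop (𝓝 X₀) := by
      rw [← prod_atTop_atTop_eq]; exact hX₀.comp tendsto_fst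
    have e2 : Tendsto (fun jk : ℕ × ℕ => X jk.2) atTop (𝓝 X₀) := by
      rw [← prod_atTop_atTop_eq]; exact hX₀.comp tendsto_snd
    have hlim' := hlim.comp hσ.tendsto_atTop
    have e3 : Tendsto (fun jk : ℕ × ℕ =>
        ∫ x in Ω, bnorm (B x) (gradient (φ (σ jk.1)) x) ^ p) atTop (𝓝 lam) := by
      rw [← prod_atTop_atTop_eq]; exact hlim'.comp tendsto_fst
    have e4 : Tendsto (fun jk : ℕ × ℕ =>
        ∫ x in Ω, bnorm (B x) (gradient (φ (σ jk.2)) x) ^ p) atTop (𝓝 lam) := by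
      rw [← prod_atTop_atTop_eq]; exact hlim'.comp tendsto_snd
    have e5 := (((e3.add e4).const_mul (2 ^ (p - 1))).sub
      (((e1.add e2).norm.rpow_const (p := p) (Or.inr (by linarith))).const_mul lam)).const_mul
      (c ^ p)⁻¹
    have e6 : (c ^ p)⁻¹ * (2 ^ (p - 1) * (lam + lam) - lam * ‖X₀ + X₀‖ ^ p) = 0 := by
      rw [← two_smul ℝ X₀, norm_smul, Real.mul_rpow (norm_nonneg _) (norm_nonneg _), hX1]
      have : (2 : ℝ) ^ (p - 1) * 2 = 2 ^ p := by
        rw [← Real.rpow_add_one (by norm_num)]; congr 1; ring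
      simp only [Real.norm_ofNat, mul_one, mul_eq_zero]
      right
      rw [← two_mul, ← mul_assoc, this]; ring
    rw [e6] at e5
    refine tendsto_of_tendsto_of_tendsto_of_le_of_le tendsto_const_nhds e5
      (fun _ => by positivity) fun jk => ?_
    simp only
    rw [dist_eq_norm, hYsub, ← div_eq_inv_mul, le_div_iff₀ hcp, mul_comm]
    refine (coer ((m1 _).sub (m1 _))).trans ?_
    have h1 := hB.integral_clarkson hp (m1 (σ jk.1)) (m1 (σ jk.2))
    have h2 := hmin _ ((hφ (σ jk.1)).add (hφ (σ jk.2)))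
    have h3 : ∀ x, gradient (φ (σ jk.1) + φ (σ jk.2)) x =
        gradient (φ (σ jk.1)) x + gradient (φ (σ jk.2)) x := fun x => by
      have := gradient_const_mul_add (hφ (σ jk.1)).isC1Test.1 (hφ (σ jk.2)).isC1Test.1 1 1 x
      simp only [one_mul, one_smul] at this
      exact this
    simp only [h3, Pi.add_apply] at h2
    rw [hXadd]
    simp only [Pi.sub_apply]
    linarith
  obtain ⟨Y₀, hY₀⟩ := cauchySeq_tendsto_of_complete hYc
  have t1 : Tendsto (fun k => eLpNorm (fun x => X₀ x - φ (σ k) x) (ENNReal.ofReal p)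
      (volume.restrict Ω)) atTop (𝓝 0) := by
    have := (Lp.tendsto_Lp_iff_tendsto_eLpNorm' _ _).1 hX₀
    refine this.congr fun k => ?_
    rw [eLpNorm_sub_comm]
    refine eLpNorm_congr_ae ?_
    filter_upwards [(m0 (σ k)).coeFn_toLp] with x hx
    simp only [Pi.sub_apply, X]; rw [hx]
  have t2 : Tendsto (fun k => eLpNorm (fun x => Y₀ x - gradient (φ (σ k)) x) (ENNReal.ofReal p)
      (volume.restrict Ω)) atTop (𝓝 0) := by
    have := (Lp.tendsto_Lp_iff_tendsto_eLpNorm' _ _).1 hY₀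
    refine this.congr fun k => ?_
    rw [eLpNorm_sub_comm]
    refine eLpNorm_congr_ae ?_
    filter_upwards [(m1 (σ k)).coeFn_toLp] with x hx
    simp only [Pi.sub_apply, Y]; rw [hx]
  refine ⟨X₀, Y₀, memVanishing_of_tendsto hp hU (Lp.memLp _) (Lp.memLp _)
    (fun k => (hφ (σ k)).isC1Test) t1 t2, ?_, ?_⟩
  · refine tendsto_nhds_unique (tendsto_integral_norm_rpow hp (fun k => m0 (σ k)) (Lp.memLp _) t1)
      (tendsto_const_nhds.congr fun k => (hφ1 _).symm)
  · exact tendsto_nhds_unique (hB.tendsto_integral_bnorm_rpow hp (fun k => m1 (σ k)) (Lp.memLp _) t2)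
      (hlim.comp hσ.tendsto_atTop)

/-- The candidate is the infimum of the quotient over normalized test functions. It is an eigenvalue
since it is attained in the closure, and it is the least one since an eigenvalue equals the quotient
of its own eigenfunction. The last clause allows lower bounds to be checked on smooth functions
only. -/
theorem exists_isLeast_eigenvalue [IsFiniteMeasure (volume.restrict Ω)] (hp : 2 ≤ p)
    (hU : IsOpen U) (hB : Elliptic (volume.restrict Ω) B) (hcomp : TestCompact p Ω U)
    (hne : ∃ φ, IsTest U φ ∧ 0 < ∫ x in Ω, |φ x| ^ p) :
    ∃ lam, IsLeast {lam | ∃ u G, IsEigenpair p B Ω U lam u G} lam ∧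
      (∀ u G, MemVanishing p Ω U u G →
        lam * ∫ x in Ω, |u x| ^ p ≤ ∫ x in Ω, bnorm (B x) (G x) ^ p) ∧
      ∀ μ, (∀ φ, IsTest U φ →
        μ * ∫ x in Ω, |φ x| ^ p ≤ ∫ x in Ω, bnorm (B x) (gradient φ x) ^ p) → μ ≤ lam := by
  set R : Set ℝ := {r | ∃ φ, IsTest U φ ∧ ∫ x in Ω, |φ x| ^ p = 1 ∧
    r = ∫ x in Ω, bnorm (B x) (gradient φ x) ^ p} with hR
  have norm1 : ∀ φ, IsTest U φ → 0 < ∫ x in Ω, |φ x| ^ p →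
      (∫ x in Ω, bnorm (B x) (gradient φ x) ^ p) / ∫ x in Ω, |φ x| ^ p ∈ R := by
    intro φ hφ hpos
    set M := ∫ x in Ω, |φ x| ^ p
    have hM : |M ^ (-p⁻¹)| ^ p = M⁻¹ := by
      rw [abs_of_nonneg (by positivity), ← Real.rpow_mul hpos.le, neg_mul,
        inv_mul_cancel₀ (by linarith), Real.rpow_neg_one]
    refine ⟨fun x => M ^ (-p⁻¹) * φ x, hφ.const_mul _, ?_, ?_⟩
    · simp only [abs_mul, Real.mul_rpow (abs_nonneg _) (abs_nonneg _)]
      rw [integral_const_mul, hM, inv_mul_cancel₀ hpos.ne']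
    · have : ∀ x, gradient (fun x => M ^ (-p⁻¹) * φ x) x = M ^ (-p⁻¹) • gradient φ x := fun x => by
        simpa using gradient_const_mul_add hφ.isC1Test.1 hφ.isC1Test.1 (M ^ (-p⁻¹)) 0 x
      simp only [this]
      rw [hB.integral_bnorm_smul, hM, div_eq_inv_mul]
  have hRne : R.Nonempty := by
    obtain ⟨φ, hφ, hpos⟩ := hne
    exact ⟨_, norm1 φ hφ hpos⟩
  have hRb : BddBelow R := ⟨0, by
    rintro _ ⟨φ, -, -, rfl⟩; exact integral_bnorm_rpow_nonneg _ _⟩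
  have h0 : 0 ≤ sInf R := le_csInf hRne (by
    rintro _ ⟨φ, -, -, rfl⟩; exact integral_bnorm_rpow_nonneg _ _)
  have htest : ∀ φ, IsTest U φ →
      sInf R * ∫ x in Ω, |φ x| ^ p ≤ ∫ x in Ω, bnorm (B x) (gradient φ x) ^ p := by
    intro φ hφ
    rcases (integral_nonneg fun x => by positivity : 0 ≤ ∫ x in Ω, |φ x| ^ p).eq_or_lt with h | h
    · rw [← h, mul_zero]; exact integral_bnorm_rpow_nonneg _ _
    · rw [← le_div_iff₀ h]
      exact csInf_le hRb (norm1 φ hφ h)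
  have hV : ∀ u G, MemVanishing p Ω U u G →
      sInf R * ∫ x in Ω, |u x| ^ p ≤ ∫ x in Ω, bnorm (B x) (G x) ^ p :=
    fun u G h => h.mul_integral_le_of_forall_isTest hp hB htest
  obtain ⟨r, -, hr, hrR⟩ := exists_seq_tendsto_sInf hRne hRb
  choose φ hφ hφ1 hφ2 using hrR
  obtain ⟨u, G, hu, hu1, hG⟩ := exists_memVanishing_minimizer hp hU hB hcomp htest hφ hφ1
    (hr.congr hφ2)
  have hu0 : ¬ u =ᵐ[volume.restrict Ω] 0 := by
    intro h
    have : ∫ x in Ω, |u x| ^ p = 0 := by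
      rw [← integral_zero (E n) ℝ (μ := volume.restrict Ω)]
      refine integral_congr_ae ?_
      filter_upwards [h] with x hx
      rw [hx]; simp [Real.zero_rpow (by linarith : p ≠ 0)]
    rw [hu1] at this; exact one_ne_zero this
  refine ⟨sInf R, ⟨⟨u, G, isEigenpair_of_minimizer hp hU hB h0 hu hu0 (by rw [hG, hu1, mul_one])
    hV⟩, ?_⟩, hV, fun μ hμ => le_csInf hRne ?_⟩
  · rintro lam ⟨v, H, hv⟩
    have hpos := integral_abs_rpow_pos hp hv.1.1.1 hv.2.1
    have h1 := hV v H hv.1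
    rw [hv.energy_eq hp hB] at h1
    exact le_of_mul_le_mul_right h1 hpos
  · rintro _ ⟨φ, hφ, h1, rfl⟩
    have := hμ φ hφ
    rwa [h1, mul_one] at this

end Existence

/-! ### Poincaré inequality on convex sets -/

section Poincare

theorem lintegral_rpow_le_of_jensen {α : Type*} [MeasurableSpace α] (m : Measure α) {p : ℝ}
    (hp : 1 < p) {g : α → ℝ≥0∞} (hg : AEMeasurable g m) :
    (∫⁻ x, g x ∂m) ^ p ≤ m Set.univ ^ (p - 1) * ∫⁻ x, g x ^ p ∂m := by
  have hpq := Real.HolderConjugate.conjExponent hp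
  have h := ENNReal.lintegral_mul_le_Lp_mul_Lq m hpq hg (aemeasurable_const (b := (1 : ℝ≥0∞)))
  simp only [Pi.mul_apply, mul_one, ENNReal.one_rpow, lintegral_const, one_mul] at h
  have h2 := ENNReal.rpow_le_rpow h (by linarith : 0 ≤ p)
  rw [ENNReal.mul_rpow_of_nonneg _ _ (by linarith), ← ENNReal.rpow_mul, ← ENNReal.rpow_mul,
    one_div_mul_cancel (by linarith), ENNReal.rpow_one, mul_comm] at h2
  convert h2 using 3
  have : p - 1 ≠ 0 := by linarith
  have : p ≠ 0 := by linarith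
  simp only [Real.conjExponent]
  field_simp

variable {n : ℕ} {p : ℝ}

/-- The contraction `x ↦ y + t(x - y)` maps the convex set into itself with Jacobian `t^n`, and `t ≥
1/2` keeps `t^(-n)` below `2^n`. -/
theorem setLIntegral_comp_segment_le {K : Set (E n)} (hK : Convex ℝ K) (hKm : MeasurableSet K)
    {g : E n → ℝ≥0∞} (hg : Measurable g) {y : E n} (hy : y ∈ K) {t : ℝ} (ht : 1 / 2 ≤ t)
    (ht1 : t ≤ 1) :
    ∫⁻ x in K, g (y + t • (x - y)) ≤ 2 ^ n * ∫⁻ x in K, g x := by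
  have ht0 : 0 < t := by linarith
  set h := K.indicator g with hh
  have hm : Measurable h := hg.indicator hKm
  have h1 : ∫⁻ x in K, g (y + t • (x - y)) ≤ ∫⁻ x, h (t • x + (y - t • y)) := by
    rw [← lintegral_indicator hKm]
    refine lintegral_mono fun x => ?_
    by_cases hx : x ∈ K
    · have e : y + t • (x - y) = t • x + (y - t • y) := by rw [smul_sub]; abel
      have hin : t • x + (y - t • y) ∈ K := by
        rw [← e]
        exact hK.add_smul_sub_mem hy hx ⟨ht0.le, ht1⟩
      rw [Set.indicator_of_mem hx, hh, Set.indicator_of_mem hin, e]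
    · rw [Set.indicator_of_notMem hx]; exact zero_le
  have h2 : ∫⁻ x, h (t • x + (y - t • y)) = ENNReal.ofReal |(t ^ n)⁻¹| * ∫⁻ x, h x := by
    have hm2 : Measurable fun z => h (z + (y - t • y)) := hm.comp (measurable_add_const _)
    rw [← lintegral_map (f := fun z => h (z + (y - t • y))) (g := fun x => t • x) hm2
      (measurable_const_smul t), Measure.map_addHaar_smul volume ht0.ne', lintegral_smul_measure,
      lintegral_add_right_eq_self h, finrank_euclideanSpace_fin, smul_eq_mul]
  have h3 : ENNReal.ofReal |(t ^ n)⁻¹| ≤ 2 ^ n := by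
    rw [abs_of_nonneg (by positivity)]
    have : (t ^ n)⁻¹ ≤ (2 : ℝ) ^ n := by
      rw [← inv_pow]
      refine pow_le_pow_left₀ (by positivity) ?_ n
      rw [inv_le_comm₀ ht0 (by norm_num)]; linarith
    calc _ ≤ ENNReal.ofReal ((2 : ℝ) ^ n) := ENNReal.ofReal_le_ofReal this
      _ = 2 ^ n := by rw [ENNReal.ofReal_pow (by norm_num)]; norm_num
  rw [h2, hh, lintegral_indicator hKm] at h1
  exact h1.trans (mul_le_mul_left h3 _)

theorem enorm_gradient (f : E n → ℝ) (x : E n) : ‖gradient f x‖ₑ = ‖fderiv ℝ f x‖ₑ := by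
  rw [← ofReal_norm, ← ofReal_norm, gradient, LinearIsometryEquiv.norm_map]

/-- Fundamental theorem of calculus along the segment, then Jensen on `(0, 1]`. -/
theorem enorm_sub_rpow_le (hp : 1 < p) {f : E n → ℝ} (hf : ContDiff ℝ 1 f) {x y : E n} {D : ℝ}
    (hD : ‖x - y‖ ≤ D) :
    ‖f x - f y‖ₑ ^ p ≤ ENNReal.ofReal D ^ p *
      ∫⁻ t in Set.Ioc (0 : ℝ) 1, ‖gradient f (y + t • (x - y))‖ₑ ^ p := by
  have hc : Continuous fun t : ℝ => y + t • (x - y) := by fun_prop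
  have hfd : Continuous (fderiv ℝ f) := hf.continuous_fderiv (by simp)
  have hd : ∀ t : ℝ, HasDerivAt (fun t : ℝ => f (y + t • (x - y)))
      (fderiv ℝ f (y + t • (x - y)) (x - y)) t := by
    intro t
    have h1 : HasDerivAt (fun t : ℝ => y + t • (x - y)) (x - y) t := by
      simpa using ((hasDerivAt_id t).smul_const (x - y)).const_add y
    exact ((hf.differentiable (by simp) _).hasFDerivAt).comp_hasDerivAt t h1
  have hint := intervalIntegral.integral_eq_sub_of_hasDerivAt (a := 0) (b := 1)
    (fun t _ => hd t) (((hfd.comp hc).clm_apply continuous_const).intervalIntegrable _ _)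
  simp only [one_smul, zero_smul, add_zero, add_sub_cancel] at hint
  rw [← hint, intervalIntegral.integral_of_le zero_le_one]
  have hmg : Measurable fun t : ℝ => ‖gradient f (y + t • (x - y))‖ₑ :=
    ((continuous_gradient hf).comp hc).enorm.measurable
  have h1 : ‖∫ t in Set.Ioc (0 : ℝ) 1, fderiv ℝ f (y + t • (x - y)) (x - y)‖ₑ ≤
      ENNReal.ofReal D * ∫⁻ t in Set.Ioc (0 : ℝ) 1, ‖gradient f (y + t • (x - y))‖ₑ := by
    refine (enorm_integral_le_lintegral_enorm _).trans ?_
    rw [← lintegral_const_mul _ hmg]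
    refine lintegral_mono fun t => ?_
    rw [enorm_gradient, mul_comm]
    refine (ContinuousLinearMap.le_opENorm _ _).trans ?_
    gcongr
    rw [← ofReal_norm]
    exact ENNReal.ofReal_le_ofReal hD
  refine (ENNReal.rpow_le_rpow h1 (by linarith)).trans ?_
  rw [ENNReal.mul_rpow_of_nonneg _ _ (by linarith)]
  gcongr
  refine (lintegral_rpow_le_of_jensen _ hp hmg.aemeasurable).trans ?_
  simp

/-- For `t < 1/2` the two endpoints exchange roles, since `y + t(x - y) = x + (1 - t)(y - x)` and `1
- t ≥ 1/2`. The bad Jacobian near `t = 0` never appears. -/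
theorem lintegral_prod_comp_segment_le {K : Set (E n)} (hK : Convex ℝ K) (hKm : MeasurableSet K)
    {g : E n → ℝ≥0∞} (hg : Measurable g) {t : ℝ} (ht : 0 ≤ t) (ht1 : t ≤ 1) :
    ∫⁻ z, g (z.2 + t • (z.1 - z.2)) ∂((volume.restrict K).prod (volume.restrict K)) ≤
      2 ^ n * (volume K * ∫⁻ x in K, g x) := by
  have hseg : Continuous fun z : E n × E n => z.2 + t • (z.1 - z.2) := by fun_prop
  have hmt : AEMeasurable (fun z : E n × E n => g (z.2 + t • (z.1 - z.2)))
      ((volume.restrict K).prod (volume.restrict K)) := (hg.comp hseg.measurable).aemeasurable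
  have hconst : ∫⁻ _ in K, 2 ^ n * ∫⁻ x in K, g x = 2 ^ n * (volume K * ∫⁻ x in K, g x) := by
    rw [lintegral_const, Measure.restrict_apply_univ]; ring
  rcases le_total (1 / 2) t with h | h
  · rw [lintegral_prod_symm _ hmt, ← hconst]
    exact setLIntegral_mono' hKm fun y hy => setLIntegral_comp_segment_le hK hKm hg hy h ht1
  · rw [lintegral_prod _ hmt, ← hconst]
    refine setLIntegral_mono' hKm fun x hx => ?_
    have := setLIntegral_comp_segment_le hK hKm hg hx (t := 1 - t) (by linarith) (by linarith)
    refine le_trans (le_of_eq ?_) this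
    refine lintegral_congr fun y => ?_
    congr 1
    rw [sub_smul, one_smul, smul_sub, smul_sub]; abel

/-- Poincaré's inequality in double-integral form, without means. It serves twice: for compactness
on small cells and for the logarithm of an eigenfunction on balls. -/
theorem lintegral_enorm_sub_rpow_le (hp : 1 < p) {f : E n → ℝ} (hf : ContDiff ℝ 1 f)
    {K : Set (E n)} (hK : Convex ℝ K) (hKm : MeasurableSet K) {D : ℝ}
    (hD : ∀ x ∈ K, ∀ y ∈ K, ‖x - y‖ ≤ D) :
    ∫⁻ z, ‖f z.1 - f z.2‖ₑ ^ p ∂((volume.restrict K).prod (volume.restrict K)) ≤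
      ENNReal.ofReal D ^ p * (2 ^ n * (volume K * ∫⁻ x in K, ‖gradient f x‖ₑ ^ p)) := by
  set g : E n → ℝ≥0∞ := fun x => ‖gradient f x‖ₑ ^ p with hgdef
  have hg : Measurable g :=
    ((ENNReal.continuous_rpow_const).comp (continuous_gradient hf).enorm).measurable
  have hseg : Continuous fun q : (E n × E n) × ℝ => q.1.2 + q.2 • (q.1.1 - q.1.2) := by fun_prop
  have hmeas : Measurable fun q : (E n × E n) × ℝ => g (q.1.2 + q.2 • (q.1.1 - q.1.2)) :=
    hg.comp hseg.measurable
  have hKK : ∀ᵐ z ∂((volume.restrict K).prod (volume.restrict K)), z ∈ K ×ˢ K := by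
    rw [Measure.prod_restrict]
    exact ae_restrict_mem (hKm.prod hKm)
  have h1 : ∫⁻ z, ‖f z.1 - f z.2‖ₑ ^ p ∂((volume.restrict K).prod (volume.restrict K)) ≤
      ∫⁻ z, (ENNReal.ofReal D ^ p * ∫⁻ t in Set.Ioc (0 : ℝ) 1, g (z.2 + t • (z.1 - z.2)))
        ∂((volume.restrict K).prod (volume.restrict K)) := by
    refine lintegral_mono_ae ?_
    filter_upwards [hKK] with z hz
    exact enorm_sub_rpow_le hp hf (hD _ hz.1 _ hz.2)
  refine h1.trans ?_
  rw [lintegral_const_mul _ hmeas.lintegral_prod_right',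
    lintegral_lintegral_swap (f := fun (z : E n × E n) (t : ℝ) => g (z.2 + t • (z.1 - z.2)))
      hmeas.aemeasurable]
  refine mul_le_mul_right ?_ _
  calc _ ≤ ∫⁻ _ in Set.Ioc (0 : ℝ) 1, 2 ^ n * (volume K * ∫⁻ x in K, g x) :=
        setLIntegral_mono' measurableSet_Ioc fun t ht =>
          lintegral_prod_comp_segment_le hK hKm hg ht.1.le ht.2
    _ = _ := by simp

/-- Write `f` as its mean plus the deviation from it. Jensen bounds the deviation at `x` by the
average over `y` of `|f x - f y|^p`, and the double-integral estimate applies, its factor `volume K`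
cancelling the normalization. -/
theorem lintegral_enorm_rpow_le_average (hp : 1 < p) {f : E n → ℝ} (hf : ContDiff ℝ 1 f)
    {K : Set (E n)} (hK : Convex ℝ K) (hKm : MeasurableSet K) (hKfin : volume K ≠ ⊤)
    (hfi : IntegrableOn f K) {D : ℝ} (hD : ∀ x ∈ K, ∀ y ∈ K, ‖x - y‖ ≤ D) :
    ∫⁻ x in K, ‖f x‖ₑ ^ p ≤ 2 ^ (p - 1) * (volume K * ‖⨍ x in K, f x‖ₑ ^ p +
      ENNReal.ofReal D ^ p * (2 ^ n * ∫⁻ x in K, ‖gradient f x‖ₑ ^ p)) := by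
  rcases eq_or_ne (volume K) 0 with h0 | h0
  · rw [setLIntegral_measure_zero _ _ h0]; exact zero_le
  set V := volume K with hV
  set ν : Measure (E n) := V⁻¹ • volume.restrict K with hν
  have hνp : IsProbabilityMeasure ν := ⟨by
    simp [hν, hV]; exact ENNReal.inv_mul_cancel h0 hKfin⟩
  have hav : ⨍ x in K, f x = ∫ x, f x ∂ν := by
    rw [average]; simp [hν, hV]
  have hfν : Integrable f ν := hfi.smul_measure (ENNReal.inv_ne_top.2 h0)
  have hpt : ∀ x, ‖f x - ∫ y, f y ∂ν‖ₑ ^ p ≤ V⁻¹ * ∫⁻ y in K, ‖f x - f y‖ₑ ^ p := by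
    intro x
    have e : f x - ∫ y, f y ∂ν = ∫ y, (f x - f y) ∂ν := by
      rw [integral_sub (integrable_const _) hfν]; simp
    have hmy : AEMeasurable (fun y => ‖f x - f y‖ₑ) ν :=
      (continuous_const.sub hf.continuous).enorm.measurable.aemeasurable
    rw [e]
    refine (ENNReal.rpow_le_rpow (enorm_integral_le_lintegral_enorm _) (by linarith)).trans ?_
    refine (lintegral_rpow_le_of_jensen ν hp hmy).trans ?_
    rw [measure_univ, ENNReal.one_rpow, one_mul, hν, lintegral_smul_measure, smul_eq_mul]
  have hmeas : Measurable fun z : E n × E n => ‖f z.1 - f z.2‖ₑ ^ p :=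
    (ENNReal.continuous_rpow_const.comp ((hf.continuous.comp continuous_fst).sub
      (hf.continuous.comp continuous_snd)).enorm).measurable
  set a := ∫ y, f y ∂ν with ha
  rw [hav]
  calc ∫⁻ x in K, ‖f x‖ₑ ^ p
      ≤ ∫⁻ x in K, 2 ^ (p - 1) * (‖a‖ₑ ^ p + V⁻¹ * ∫⁻ y in K, ‖f x - f y‖ₑ ^ p) := by
        refine lintegral_mono fun x => ?_
        have h1 : ‖f x‖ₑ ≤ ‖a‖ₑ + ‖f x - a‖ₑ := by
          refine le_trans (le_of_eq ?_) (enorm_add_le a (f x - a))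
          congr 1; ring
        refine (ENNReal.rpow_le_rpow h1 (by linarith)).trans ?_
        refine (ENNReal.rpow_add_le_mul_rpow_add_rpow _ _ hp.le).trans ?_
        gcongr
        exact hpt x
    _ = 2 ^ (p - 1) * (V * ‖a‖ₑ ^ p + V⁻¹ * ∫⁻ x in K, ∫⁻ y in K, ‖f x - f y‖ₑ ^ p) := by
        have hm1 : Measurable fun x => ∫⁻ y in K, ‖f x - f y‖ₑ ^ p := hmeas.lintegral_prod_right'
        rw [lintegral_const_mul _ (show Measurable fun x => ‖a‖ₑ ^ p + V⁻¹ * ∫⁻ y in K,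
          ‖f x - f y‖ₑ ^ p from measurable_const.add (hm1.const_mul _)),
          lintegral_add_left measurable_const, lintegral_const_mul _ hm1]
        simp only [lintegral_const, Measure.restrict_apply_univ]
        rw [mul_comm (‖a‖ₑ ^ p)]
    _ ≤ _ := by
        have h2 := lintegral_enorm_sub_rpow_le hp hf hK hKm hD
        rw [lintegral_prod _ hmeas.aemeasurable] at h2
        refine mul_le_mul_right (add_le_add le_rfl ?_) _
        refine (mul_le_mul_right h2 V⁻¹).trans (le_of_eq ?_)
        have : V⁻¹ * V = 1 := ENNReal.inv_mul_cancel h0 hKfin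
        calc _ = (V⁻¹ * V) * (ENNReal.ofReal D ^ p * (2 ^ n * ∫⁻ x in K, ‖gradient f x‖ₑ ^ p)) := by
              ring
          _ = _ := by rw [this, one_mul]

theorem volume_mul_enorm_average_rpow_le (hp : 1 < p) {f : E n → ℝ} (hf : Continuous f)
    {K : Set (E n)} (hKfin : volume K ≠ ⊤) :
    volume K * ‖⨍ x in K, f x‖ₑ ^ p ≤ ∫⁻ x in K, ‖f x‖ₑ ^ p := by
  rcases eq_or_ne (volume K) 0 with h0 | h0
  · rw [h0, zero_mul]; exact zero_le
  set ν : Measure (E n) := (volume K)⁻¹ • volume.restrict K with hν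
  have hνp : IsProbabilityMeasure ν := ⟨by
    simp [hν]; exact ENNReal.inv_mul_cancel h0 hKfin⟩
  have hav : ⨍ x in K, f x = ∫ x, f x ∂ν := by
    rw [average]; simp [hν]
  have h1 : ‖∫ x, f x ∂ν‖ₑ ^ p ≤ (volume K)⁻¹ * ∫⁻ y in K, ‖f y‖ₑ ^ p := by
    refine (ENNReal.rpow_le_rpow (enorm_integral_le_lintegral_enorm _) (by linarith)).trans ?_
    refine (lintegral_rpow_le_of_jensen ν hp hf.enorm.measurable.aemeasurable).trans ?_
    rw [measure_univ, ENNReal.one_rpow, one_mul, hν, lintegral_smul_measure, smul_eq_mul]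
  rw [hav]
  refine (mul_le_mul_right h1 _).trans (le_of_eq ?_)
  rw [← mul_assoc, ENNReal.mul_inv_cancel h0 hKfin, one_mul]

end Poincare

/-! ### The cylinder as a product -/

section Product

variable {d : ℕ}

/-- The point `(t, X)` of `ℝ × ℝᵈ`. -/
def consE (t : ℝ) (X : E d) : E (d + 1) := WithLp.toLp 2 (Fin.cons t fun j => X j)

@[simp] theorem consE_zero (t : ℝ) (X : E d) : consE t X 0 = t := rfl

@[simp] theorem consE_succ (t : ℝ) (X : E d) (j : Fin d) : consE t X j.succ = X j := rfl

@[simp] theorem tail_apply (x : E (d + 1)) (j : Fin d) : tail x j = x j.succ := rfl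

@[simp] theorem tail_consE (t : ℝ) (X : E d) : tail (consE t X) = X := by
  ext j; simp

@[simp] theorem consE_tail (x : E (d + 1)) : consE (x 0) (tail x) = x := by
  ext i; refine Fin.cases ?_ (fun j => ?_) i <;> simp

theorem continuous_tail : Continuous (tail : E (d + 1) → E d) := by
  unfold tail
  fun_prop

theorem continuous_consE : Continuous fun z : ℝ × E d => consE z.1 z.2 := by
  unfold consE
  refine (PiLp.continuous_toLp 2 _).comp (continuous_pi fun i => ?_)
  refine Fin.cases ?_ (fun j => ?_) i
  · simpa using continuous_fst
  · simp only [Fin.cons_succ]; fun_prop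

/-- The splitting `x ↦ (x₁, X₂)`. -/
def splitE (d : ℕ) : E (d + 1) ≃ᵐ ℝ × E d where
  toFun x := (x 0, tail x)
  invFun z := consE z.1 z.2
  left_inv x := by simp
  right_inv z := by simp
  measurable_toFun := by
    refine Continuous.measurable ?_
    exact (by fun_prop : Continuous fun x : E (d + 1) => x 0).prodMk continuous_tail
  measurable_invFun := continuous_consE.measurable

theorem splitE_apply (x : E (d + 1)) : splitE d x = (x 0, tail x) := rfl

theorem measurePreserving_splitE (d : ℕ) :
    MeasurePreserving (splitE d) volume ((volume : Measure ℝ).prod volume) := by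
  have h1 := PiLp.volume_preserving_ofLp (Fin (d + 1))
  have h2 := volume_preserving_piFinSuccAbove (fun _ : Fin (d + 1) => ℝ) 0
  have h3 := (MeasurePreserving.id (volume : Measure ℝ)).prod (PiLp.volume_preserving_toLp (Fin d))
  exact h3.comp (h2.comp h1)

theorem cylinder_eq_preimage (ω : Set (E d)) (ℓ : ℝ) :
    cylinder ω ℓ = splitE d ⁻¹' (Set.Ioo (-ℓ) ℓ ×ˢ ω) := rfl

theorem measurePreserving_splitE_cylinder {ω : Set (E d)} (hω : MeasurableSet ω) (ℓ : ℝ) :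
    MeasurePreserving (splitE d) (volume.restrict (cylinder ω ℓ))
      ((volume.restrict (Set.Ioo (-ℓ) ℓ)).prod (volume.restrict ω)) := by
  rw [Measure.prod_restrict, cylinder_eq_preimage]
  exact (measurePreserving_splitE d).restrict_preimage (measurableSet_Ioo.prod hω)

theorem ae_cylinder_of_ae {ω : Set (E d)} (hω : MeasurableSet ω) {ℓ : ℝ} {P : E d → Prop}
    (h : ∀ᵐ X ∂(volume.restrict ω), P X) :
    ∀ᵐ x ∂(volume.restrict (cylinder ω ℓ)), P (tail x) :=
  ((Measure.quasiMeasurePreserving_snd (μ := volume.restrict (Set.Ioo (-ℓ) ℓ))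
    (ν := volume.restrict ω)).comp
      (measurePreserving_splitE_cylinder hω ℓ).quasiMeasurePreserving).ae h

theorem integral_cylinder {F : Type*} [NormedAddCommGroup F] [NormedSpace ℝ F] {ω : Set (E d)}
    (hω : MeasurableSet ω) {ℓ : ℝ} {f : E (d + 1) → F} (hf : IntegrableOn f (cylinder ω ℓ)) :
    Integrable (fun t => ∫ X in ω, f (consE t X)) (volume.restrict (Set.Ioo (-ℓ) ℓ)) ∧
    ∫ x in cylinder ω ℓ, f x = ∫ t in Set.Ioo (-ℓ) ℓ, ∫ X in ω, f (consE t X) := by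
  have hmp := measurePreserving_splitE_cylinder hω ℓ
  have e : ∀ x, f x = (fun z : ℝ × E d => f (consE z.1 z.2)) (splitE d x) := fun x => by
    simp [splitE_apply]
  have hi : Integrable (fun z : ℝ × E d => f (consE z.1 z.2))
      ((volume.restrict (Set.Ioo (-ℓ) ℓ)).prod (volume.restrict ω)) := by
    rw [← hmp.integrable_comp_emb (splitE d).measurableEmbedding]
    refine hf.congr (Eventually.of_forall fun x => e x)
  refine ⟨hi.integral_prod_left, ?_⟩
  rw [← integral_prod _ hi, ← hmp.integral_comp (splitE d).measurableEmbedding]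
  exact integral_congr_ae (Eventually.of_forall e)

theorem memLp_cylinder_mul {F : Type*} [NormedAddCommGroup F] {ω : Set (E d)}
    (hω : MeasurableSet ω) {ℓ : ℝ} {q : ℝ≥0∞} {g : E d → F}
    (hg : MemLp g q (volume.restrict ω)) :
    MemLp (fun x => g (tail x)) q (volume.restrict (cylinder ω ℓ)) := by
  have hmp := measurePreserving_splitE_cylinder hω ℓ
  have := (hg.comp_snd (μ := volume.restrict (Set.Ioo (-ℓ) ℓ))).comp_measurePreserving hmp
  exact this

theorem isBounded_cylinder {ω : Set (E d)} (hω : Bornology.IsBounded ω) (ℓ : ℝ) :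
    Bornology.IsBounded (cylinder ω ℓ) := by
  obtain ⟨R, hR⟩ := hω.subset_closedBall 0
  have hc : IsCompact ((fun z : ℝ × E d => consE z.1 z.2) ''
      (Set.Icc (-ℓ) ℓ ×ˢ Metric.closedBall (0 : E d) R)) :=
    (isCompact_Icc.prod (isCompact_closedBall _ _)).image continuous_consE
  refine hc.isBounded.subset fun x hx => ⟨(x 0, tail x), ⟨⟨hx.1.1.le, hx.1.2.le⟩, hR hx.2⟩, ?_⟩
  simp

theorem isOpen_strip {ω : Set (E d)} (hω : IsOpen ω) : IsOpen (strip ω) :=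
  hω.preimage continuous_tail

theorem isOpen_cylinder {ω : Set (E d)} (hω : IsOpen ω) (ℓ : ℝ) : IsOpen (cylinder ω ℓ) :=
  (isOpen_Ioo.preimage (by fun_prop : Continuous fun x : E (d + 1) => x 0)).inter
    (hω.preimage continuous_tail)

theorem volume_slice_eq_zero (t : ℝ) : volume {x : E (d + 1) | x 0 = t} = 0 := by
  have : {x : E (d + 1) | x 0 = t} = splitE d ⁻¹' ({t} ×ˢ Set.univ) := by
    ext x; simp [splitE_apply]
  rw [this, (measurePreserving_splitE d).measure_preimage
    ((measurableSet_singleton t).prod MeasurableSet.univ).nullMeasurableSet,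
    Measure.prod_prod, Real.volume_singleton, zero_mul]

end Product

/-! ### Compactness -/

section Compactness

variable {n : ℕ} {p : ℝ}

theorem lintegral_enorm_rpow_eq_ofReal {α F : Type*} [MeasurableSpace α] {m : Measure α}
    [NormedAddCommGroup F] (hp : 2 ≤ p) {f : α → F} (hf : MemLp f (ENNReal.ofReal p) m) :
    ∫⁻ x, ‖f x‖ₑ ^ p ∂m = ENNReal.ofReal (∫ x, ‖f x‖ ^ p ∂m) := by
  rw [ofReal_integral_eq_lintegral_ofReal (integrable_norm_rpow_of_memLp hp hf)
    (Eventually.of_forall fun _ => by positivity)]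
  refine lintegral_congr fun x => ?_
  rw [← ofReal_norm, ENNReal.ofReal_rpow_of_nonneg (norm_nonneg _) (by linarith)]

/-- Compactness from approximation by finitely many functionals. -/
theorem testCompact_of_functionals (hp : 2 ≤ p) {Ω U : Set (E n)}
    (h : ∀ δ : ℝ, 0 < δ → ∃ (ι : Type) (_ : Fintype ι) (a : ι → (E n → ℝ) → ℝ) (K : ℝ),
      (∀ i f g, IsTest U f → IsTest U g → a i (fun x => f x - g x) = a i f - a i g) ∧
      (∀ i f, IsTest U f → |a i f| ≤ K * (1 + ∫ x in Ω, |f x| ^ p)) ∧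
      ∀ f, IsTest U f → ∫ x in Ω, |f x| ^ p ≤
        K * ∑ i, |a i f| ^ p + δ * ∫ x in Ω, ‖gradient f x‖ ^ p) :
    TestCompact p Ω U := by
  intro φ hφ ⟨C, hC⟩
  choose ι hι a K ha hb hineq using fun m : ℕ => h (1 / ((m : ℝ) + 1)) (by positivity)
  let x : ℕ → (Σ m, ι m) → ℝ := fun k j => a j.1 j.2 (φ k)
  have hxb : ∀ k, x k ∈ Set.univ.pi fun j : Σ m, ι m =>
      Set.Icc (-(|K j.1| * (1 + C))) (|K j.1| * (1 + C)) := by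
    intro k j _
    have h1 : |a j.1 j.2 (φ k)| ≤ |K j.1| * (1 + C) := by
      refine (hb j.1 j.2 _ (hφ k)).trans ?_
      have h0 : 0 ≤ ∫ x in Ω, |φ k x| ^ p := integral_nonneg fun _ => by positivity
      exact mul_le_mul (le_abs_self _) (by linarith [(hC k).1]) (by linarith) (abs_nonneg _)
    exact abs_le.1 h1
  -- All functionals, for all accuracies `1/(m+1)`, are treated at once: the values lie in a
  -- countable product of compact intervals, so one extraction replaces the diagonal argument.
  obtain ⟨y, -, σ, hσ, hlim⟩ := (isCompact_univ_pi fun j : Σ m, ι m =>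
    (isCompact_Icc : IsCompact (Set.Icc (-(|K j.1| * (1 + C))) (|K j.1| * (1 + C))))).tendsto_subseq
      hxb
  refine ⟨σ, hσ, fun ε hε => ?_⟩
  have hC0 : 0 ≤ C :=
    (integral_nonneg fun _ => by positivity : 0 ≤ ∫ x in Ω, |φ 0 x| ^ p).trans (hC 0).1
  -- `C'` bounds the gradient term of every difference; `m` is then taken so large that this term
  -- contributes at most `ε/2`.
  set C' := 2 ^ (p - 1) * (C + C) with hC'
  have hC'0 : 0 ≤ C' := by positivity
  obtain ⟨m, hm⟩ := exists_nat_gt (2 * C' / ε)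
  have hδ : 1 / ((m : ℝ) + 1) * C' ≤ ε / 2 := by
    rw [div_mul_eq_mul_div, one_mul, div_le_iff₀ (by positivity)]
    rw [div_lt_iff₀ hε] at hm
    nlinarith
  have hcoord : ∀ j : Σ m, ι m, Tendsto (fun k => a j.1 j.2 (φ (σ k))) atTop (𝓝 (y j)) :=
    fun j => (tendsto_pi_nhds.1 hlim) j
  have hsum : Tendsto (fun jk : ℕ × ℕ =>
      K m * ∑ i, |a m i (φ (σ jk.1)) - a m i (φ (σ jk.2))| ^ p) atTop (𝓝 0) := by
    have : Tendsto (fun jk : ℕ × ℕ =>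
      K m * ∑ i, |a m i (φ (σ jk.1)) - a m i (φ (σ jk.2))| ^ p) atTop
        (𝓝 (K m * ∑ i, |y ⟨m, i⟩ - y ⟨m, i⟩| ^ p)) := by
      rw [← prod_atTop_atTop_eq]
      refine (tendsto_finsetSum _ fun i _ => ?_).const_mul _
      exact (((hcoord ⟨m, i⟩).comp tendsto_fst).sub
        ((hcoord ⟨m, i⟩).comp tendsto_snd)).abs.rpow_const (Or.inr (by linarith))
    simpa [Real.zero_rpow (by linarith : p ≠ 0)] using this
  have hev := hsum.eventually (gt_mem_nhds (half_pos hε))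
  rw [eventually_atTop] at hev
  obtain ⟨⟨N1, N2⟩, hN⟩ := hev
  refine ⟨max N1 N2, fun j hj k hk => ?_⟩
  have h1 := hN (j, k) ⟨(le_max_left _ _).trans hj, (le_max_right _ _).trans hk⟩
  have hsubtest : IsTest U fun x => φ (σ j) x - φ (σ k) x := by
    have := (hφ (σ j)).add ((hφ (σ k)).const_mul (-1))
    refine (congrArg (IsTest U) ?_).mp this
    ext x; simp [sub_eq_add_neg]
  have h2 := hineq m _ hsubtest
  have h3 : ∫ x in Ω, ‖gradient (fun x => φ (σ j) x - φ (σ k) x) x‖ ^ p ≤ C' := by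
    have e : ∀ x, gradient (fun x => φ (σ j) x - φ (σ k) x) x =
        gradient (φ (σ j)) x - gradient (φ (σ k)) x := fun x => by
      have := gradient_const_mul_add (hφ (σ j)).isC1Test.1 (hφ (σ k)).isC1Test.1 1 (-1) x
      simpa only [one_mul, one_smul, neg_mul, neg_smul, ← sub_eq_add_neg] using this
    simp only [e]
    have i1 : ∀ k, Integrable (fun x => ‖gradient (φ k) x‖ ^ p) (volume.restrict Ω) :=
      fun k => integrable_norm_rpow_of_memLp hp ((hφ k).isC1Test.memLp_gradient _ _)
    have i2 : Integrable (fun x => ‖gradient (φ (σ j)) x - gradient (φ (σ k)) x‖ ^ p)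
        (volume.restrict Ω) := integrable_norm_rpow_of_memLp hp
      (((hφ (σ j)).isC1Test.memLp_gradient _ _).sub ((hφ (σ k)).isC1Test.memLp_gradient _ _))
    calc _ ≤ ∫ x in Ω, 2 ^ (p - 1) * (‖gradient (φ (σ j)) x‖ ^ p + ‖gradient (φ (σ k)) x‖ ^ p) := by
          refine integral_mono i2 (((i1 _).add (i1 _)).const_mul _) fun x => ?_
          refine (Real.rpow_le_rpow (norm_nonneg _) (norm_sub_le _ _) (by linarith)).trans ?_
          exact rpow_two_mul_le (by linarith) (norm_nonneg _) (norm_nonneg _)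
      _ = 2 ^ (p - 1) * ((∫ x in Ω, ‖gradient (φ (σ j)) x‖ ^ p) +
            ∫ x in Ω, ‖gradient (φ (σ k)) x‖ ^ p) := by
          rw [integral_const_mul, integral_add (i1 _) (i1 _)]
      _ ≤ _ := by
          rw [hC']; gcongr
          · exact (hC _).2
          · exact (hC _).2
  have h4 : ∀ i, a m i (fun x => φ (σ j) x - φ (σ k) x) = a m i (φ (σ j)) - a m i (φ (σ k)) :=
    fun i => ha m i _ _ (hφ _) (hφ _)
  simp only [h4] at h2
  have h5 : 1 / ((m : ℝ) + 1) * ∫ x in Ω, ‖gradient (fun x => φ (σ j) x - φ (σ k) x) x‖ ^ p ≤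
      1 / ((m : ℝ) + 1) * C' := mul_le_mul_of_nonneg_left h3 (by positivity)
  simp only at h1
  linarith

/-- The half-open cube with corner `ε k` and side `ε`. -/
def cell (ε : ℝ) (k : Fin n → ℤ) : Set (E n) := {x | ∀ i, ε * k i ≤ x i ∧ x i < ε * (k i + 1)}

theorem convex_cell (ε : ℝ) (k : Fin n → ℤ) : Convex ℝ (cell ε k) := by
  have : cell ε k = ⋂ i, ((EuclideanSpace.proj (𝕜 := ℝ) i : E n →L[ℝ] ℝ) ⁻¹'
      Set.Ico (ε * k i) (ε * (k i + 1))) := by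
    ext x; simp [cell]
  rw [this]
  exact convex_iInter fun i => (convex_Ico _ _).linear_preimage
    (EuclideanSpace.proj (𝕜 := ℝ) i : E n →L[ℝ] ℝ).toLinearMap

theorem measurableSet_cell (ε : ℝ) (k : Fin n → ℤ) : MeasurableSet (cell ε k) := by
  have : cell ε k = ⋂ i, ((fun x : E n => x i) ⁻¹' Set.Ico (ε * k i) (ε * (k i + 1))) := by
    ext x; simp [cell]
  rw [this]
  exact MeasurableSet.iInter fun i =>
    (by fun_prop : Continuous fun x : E n => x i).measurable measurableSet_Ico

theorem norm_sub_le_of_mem_cell {ε : ℝ} {k : Fin n → ℤ} {x y : E n}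
    (hx : x ∈ cell ε k) (hy : y ∈ cell ε k) : ‖x - y‖ ≤ n * ε := by
  have h1 : ‖x - y‖ ≤ ∑ i, ‖(x - y) i‖ := by
    have := (EuclideanSpace.basisFun (Fin n) ℝ).sum_repr (x - y)
    calc ‖x - y‖ = ‖∑ i, (x - y) i • (EuclideanSpace.basisFun (Fin n) ℝ) i‖ := by
          conv_lhs => rw [← this]
          simp
      _ ≤ _ := by
          refine (norm_sum_le _ _).trans (Finset.sum_le_sum fun i _ => ?_)
          rw [norm_smul, OrthonormalBasis.norm_eq_one, mul_one]
  refine h1.trans ?_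
  calc _ ≤ ∑ _i : Fin n, ε := by
        refine Finset.sum_le_sum fun i _ => ?_
        have a := hx i
        have b := hy i
        rw [PiLp.sub_apply, Real.norm_eq_abs, abs_le]
        constructor <;> linarith
    _ = _ := by simp

theorem mem_cell_floor {ε : ℝ} (hε : 0 < ε) (x : E n) : x ∈ cell ε fun i => ⌊x i / ε⌋ := by
  intro i
  constructor
  · rw [mul_comm, ← le_div_iff₀ hε]; exact Int.floor_le _
  · rw [mul_comm, ← div_lt_iff₀ hε]; exact Int.lt_floor_add_one _

theorem eq_floor_of_mem_cell {ε : ℝ} (hε : 0 < ε) {k : Fin n → ℤ} {x : E n} (hx : x ∈ cell ε k) :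
    k = fun i => ⌊x i / ε⌋ := by
  ext i
  symm
  rw [Int.floor_eq_iff, le_div_iff₀ hε, div_lt_iff₀ hε, mul_comm, mul_comm _ ε]
  exact hx i

theorem volume_cell_ne_top (ε : ℝ) (k : Fin n → ℤ) : volume (cell ε k) ≠ ⊤ := by
  refine (Bornology.IsBounded.measure_lt_top ?_).ne
  exact Metric.isBounded_iff.2 ⟨n * ε, fun x hx y hy => by
    rw [dist_eq_norm]; exact norm_sub_le_of_mem_cell hx hy⟩

/-- Cells may stick out of the cylinder sideways, but there a test function of the strip vanishes
together with its gradient; at the ends the half-open slab exceeds the cylinder only by the null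
face `x₁ = -ℓ`. Thus Poincaré on whole cells is controlled by integrals over the cylinder, with no
regularity of `∂ω` and no extension operator. -/
theorem lintegral_slab_le {d : ℕ} {ω : Set (E d)} {ℓ : ℝ} {T : Set (E (d + 1))}
    (hT : IsClosed T) (hTω : T ⊆ strip ω) {g : E (d + 1) → ℝ≥0∞} (hg : ∀ x ∉ T, g x = 0) :
    ∫⁻ x in {x : E (d + 1) | -ℓ ≤ x 0 ∧ x 0 < ℓ}, g x ≤ ∫⁻ x in cylinder ω ℓ, g x := by
  have hc0 : Continuous fun x : E (d + 1) => x 0 := by fun_prop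
  have hslab : MeasurableSet {x : E (d + 1) | -ℓ ≤ x 0 ∧ x 0 < ℓ} :=
    hc0.measurable measurableSet_Ico
  have hsub : {x : E (d + 1) | -ℓ ≤ x 0 ∧ x 0 < ℓ} ∩ T ⊆ {x | x 0 = -ℓ} ∪ cylinder ω ℓ := by
    rintro x ⟨⟨h1, h2⟩, h3⟩
    rcases h1.eq_or_lt with h | h
    · left; exact h.symm
    · right; exact ⟨⟨h, h2⟩, hTω h3⟩
  calc _ = ∫⁻ x in {x : E (d + 1) | -ℓ ≤ x 0 ∧ x 0 < ℓ} ∩ T, g x := by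
        rw [← lintegral_indicator hslab, ← lintegral_indicator (hslab.inter hT.measurableSet)]
        refine lintegral_congr fun x => ?_
        by_cases hx : x ∈ T
        · by_cases hy : x ∈ {x : E (d + 1) | -ℓ ≤ x 0 ∧ x 0 < ℓ}
          · rw [Set.indicator_of_mem hy, Set.indicator_of_mem (Set.mem_inter hy hx)]
          · rw [Set.indicator_of_notMem hy, Set.indicator_of_notMem fun h => hy h.1]
        · rw [Set.indicator_of_notMem (fun h : x ∈ _ ∩ T => hx h.2)]
          exact Set.indicator_apply_eq_zero.2 fun _ => hg x hx
    _ ≤ ∫⁻ x in {x | x 0 = -ℓ} ∪ cylinder ω ℓ, g x := lintegral_mono_set hsub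
    _ ≤ _ := by
        refine (lintegral_union_le _ _ _).trans ?_
        rw [setLIntegral_measure_zero _ _ (volume_slice_eq_zero _), zero_add]

/-- The cells that meet the finite cylinder over a set of coordinates at most `ε M`. -/
def cellIndex (d N : ℕ) (M : ℤ) : Finset (Fin (d + 1) → ℤ) :=
  Fintype.piFinset fun i => Fin.cases (Finset.Ico (-(N : ℤ)) N) (fun _ => Finset.Icc (-M) M) i

theorem mem_cellIndex {d N : ℕ} {M : ℤ} {k : Fin (d + 1) → ℤ} :
    k ∈ cellIndex d N M ↔ (-(N : ℤ) ≤ k 0 ∧ k 0 < N) ∧ ∀ j : Fin d, -M ≤ k j.succ ∧ k j.succ ≤ M := by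
  simp only [cellIndex, Fintype.mem_piFinset, Fin.forall_fin_succ, Fin.cases_zero, Fin.cases_succ,
    Finset.mem_Ico, Finset.mem_Icc]

theorem pairwiseDisjoint_cell {ε : ℝ} (hε : 0 < ε) (s : Set (Fin n → ℤ)) :
    s.PairwiseDisjoint (cell ε) := by
  intro j _ k _ hjk
  refine Set.disjoint_left.2 fun x hx hx' => hjk ?_
  rw [eq_floor_of_mem_cell hε hx, ← eq_floor_of_mem_cell hε hx']

theorem cell_subset_slab {d N : ℕ} (hN : 0 < N) {M : ℤ} {ℓ : ℝ} (hℓ : 0 < ℓ)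
    {k : Fin (d + 1) → ℤ} (hk : k ∈ cellIndex d N M) :
    cell (ℓ / N) k ⊆ {x : E (d + 1) | -ℓ ≤ x 0 ∧ x 0 < ℓ} := by
  intro x hx
  have hN' : (0 : ℝ) < N := by exact_mod_cast hN
  have hk0 := (mem_cellIndex.1 hk).1
  have h1 : (-(N : ℝ)) ≤ k 0 := by exact_mod_cast hk0.1
  have h2 : (k 0 : ℝ) + 1 ≤ N := by exact_mod_cast hk0.2
  have hε : 0 < ℓ / N := by positivity
  have e : ℓ / N * N = ℓ := by field_simp
  have h3 := hx 0
  constructor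
  · nlinarith [mul_le_mul_of_nonneg_left h1 hε.le]
  · nlinarith [mul_le_mul_of_nonneg_left h2 hε.le]

theorem cylinder_subset_iUnion_cell {d N : ℕ} (hN : 0 < N) {ω : Set (E d)} {R : ℝ}
    (hR : ∀ X ∈ ω, ‖X‖ ≤ R) {ℓ : ℝ} (hℓ : 0 < ℓ) :
    cylinder ω ℓ ⊆ ⋃ k ∈ cellIndex d N (⌈R / (ℓ / N)⌉ + 1), cell (ℓ / N) k := by
  intro x hx
  have hN' : (0 : ℝ) < N := by exact_mod_cast hN
  have hε : 0 < ℓ / N := by positivity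
  have e : ℓ / N * N = ℓ := by field_simp
  refine Set.mem_iUnion₂.2 ⟨_, ?_, mem_cell_floor hε x⟩
  rw [mem_cellIndex]
  refine ⟨⟨?_, ?_⟩, fun j => ?_⟩
  · rw [Int.le_floor, le_div_iff₀ hε]
    push_cast
    linarith [hx.1.1]
  · rw [Int.floor_lt, div_lt_iff₀ hε]
    push_cast
    linarith [hx.1.2]
  · have h1 : |x j.succ| ≤ R := (PiLp.norm_apply_le (tail x) j).trans (hR _ hx.2)
    have h2 := Int.le_ceil (R / (ℓ / N))
    have h3 := abs_le.1 h1
    have h4 : -(R / (ℓ / N)) ≤ x j.succ / (ℓ / N) := by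
      rw [← neg_div]; gcongr; exact h3.1
    have h5 : x j.succ / (ℓ / N) ≤ R / (ℓ / N) := by
      gcongr; exact h3.2
    constructor
    · rw [Int.le_floor]; push_cast; linarith
    · have := Int.floor_le (x j.succ / (ℓ / N))
      have h6 : (⌊x j.succ / (ℓ / N)⌋ : ℝ) ≤ (⌈R / (ℓ / N)⌉ : ℝ) := by linarith
      have h7 : ⌊x j.succ / (ℓ / N)⌋ ≤ ⌈R / (ℓ / N)⌉ := by exact_mod_cast h6
      linarith

/-- The Poincaré inequality on all cells of a grid aligned with the ends of the cylinder. -/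
theorem integral_cylinder_le_sum_average (hp : 2 ≤ p) {d N : ℕ} (hN : 0 < N) {ω : Set (E d)}
    {R : ℝ} (hR : ∀ X ∈ ω, ‖X‖ ≤ R) {ℓ : ℝ} (hℓ : 0 < ℓ) {f : E (d + 1) → ℝ}
    (hf : IsTest (strip ω) f) :
    ∫ x in cylinder ω ℓ, |f x| ^ p ≤
      2 ^ (p - 1) * ((∑ k ∈ cellIndex d N (⌈R / (ℓ / N)⌉ + 1),
        (volume (cell (ℓ / N) k)).toReal * |⨍ x in cell (ℓ / N) k, f x| ^ p) +
      (((d + 1 : ℕ) : ℝ) * (ℓ / N)) ^ p * (2 ^ (d + 1) *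
        ∫ x in cylinder ω ℓ, ‖gradient f x‖ ^ p)) := by
  have hN' : (0 : ℝ) < N := by exact_mod_cast hN
  set ε := ℓ / N with hε'
  have hε : 0 < ε := by positivity
  set I := cellIndex d N (⌈R / ε⌉ + 1) with hI
  have hc := hf.isC1Test
  have hp1 : 1 < p := by linarith
  set D := ((d + 1 : ℕ) : ℝ) * ε with hD
  have hD0 : 0 ≤ D := by positivity
  have hdis := pairwiseDisjoint_cell hε (I : Set (Fin (d + 1) → ℤ))
  have h1 : ∫⁻ x in cylinder ω ℓ, ‖f x‖ₑ ^ p ≤ 2 ^ (p - 1) *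
      ((∑ k ∈ I, volume (cell ε k) * ‖⨍ x in cell ε k, f x‖ₑ ^ p) +
        ENNReal.ofReal D ^ p * (2 ^ (d + 1) * ∫⁻ x in cylinder ω ℓ, ‖gradient f x‖ₑ ^ p)) := by
    calc _ ≤ ∫⁻ x in ⋃ k ∈ I, cell ε k, ‖f x‖ₑ ^ p :=
          lintegral_mono_set (cylinder_subset_iUnion_cell hN hR hℓ)
      _ = ∑ k ∈ I, ∫⁻ x in cell ε k, ‖f x‖ₑ ^ p :=
          lintegral_biUnion_finset hdis (fun k _ => measurableSet_cell ε k) _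
      _ ≤ ∑ k ∈ I, 2 ^ (p - 1) * (volume (cell ε k) * ‖⨍ x in cell ε k, f x‖ₑ ^ p +
            ENNReal.ofReal D ^ p * (2 ^ (d + 1) * ∫⁻ x in cell ε k, ‖gradient f x‖ₑ ^ p)) :=
          Finset.sum_le_sum fun k _ => lintegral_enorm_rpow_le_average hp1 hc.1 (convex_cell ε k)
            (measurableSet_cell ε k) (volume_cell_ne_top _ k)
            (hc.1.continuous.integrable_of_hasCompactSupport hc.2.1).integrableOn
            fun x hx y hy => norm_sub_le_of_mem_cell hx hy
      _ = 2 ^ (p - 1) * ((∑ k ∈ I, volume (cell ε k) * ‖⨍ x in cell ε k, f x‖ₑ ^ p) +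
            ENNReal.ofReal D ^ p * (2 ^ (d + 1) *
              ∫⁻ x in ⋃ k ∈ I, cell ε k, ‖gradient f x‖ₑ ^ p)) := by
          rw [lintegral_biUnion_finset hdis (fun k _ => measurableSet_cell ε k), ← Finset.mul_sum,
            Finset.sum_add_distrib, ← Finset.mul_sum, ← Finset.mul_sum]
      _ ≤ _ := by
          refine mul_le_mul_right (add_le_add le_rfl (mul_le_mul_right (mul_le_mul_right ?_ _) _)) _
          refine (lintegral_mono_set (Set.iUnion₂_subset fun k hk =>
            cell_subset_slab hN hℓ hk)).trans ?_
          refine lintegral_slab_le (isClosed_tsupport f) hf.2.2 fun x hx => ?_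
          rw [gradient_eq_zero_of_notMem_tsupport hx]; simp [show 0 < p by linarith]
  rw [lintegral_enorm_rpow_eq_ofReal hp (hc.memLp _ _),
    lintegral_enorm_rpow_eq_ofReal hp (hc.memLp_gradient _ _)] at h1
  have e1 : (2 : ℝ≥0∞) ^ (p - 1) = ENNReal.ofReal (2 ^ (p - 1)) := by
    rw [← ENNReal.ofReal_rpow_of_nonneg (by norm_num) (by linarith)]; norm_num
  have e2 : (2 : ℝ≥0∞) ^ (d + 1) = ENNReal.ofReal (2 ^ (d + 1)) := by
    rw [ENNReal.ofReal_pow (by norm_num)]; norm_num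
  have e3 : ∀ k, volume (cell ε k) * ‖⨍ x in cell ε k, f x‖ₑ ^ p =
      ENNReal.ofReal ((volume (cell ε k)).toReal * |⨍ x in cell ε k, f x| ^ p) := fun k => by
    rw [ENNReal.ofReal_mul ENNReal.toReal_nonneg, ENNReal.ofReal_toReal (volume_cell_ne_top _ k),
      ← ENNReal.ofReal_rpow_of_nonneg (abs_nonneg _) (by linarith), ← Real.norm_eq_abs, ofReal_norm]
  have i0 : 0 ≤ ∫ x in cylinder ω ℓ, ‖gradient f x‖ ^ p := integral_nonneg fun _ => by positivity
  have s0 : ∀ k ∈ I, 0 ≤ (volume (cell ε k)).toReal * |⨍ x in cell ε k, f x| ^ p :=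
    fun k _ => by positivity
  rw [Finset.sum_congr rfl fun k _ => e3 k, ← ENNReal.ofReal_sum_of_nonneg s0, e1, e2,
    ENNReal.ofReal_rpow_of_nonneg hD0 (by linarith), ← ENNReal.ofReal_mul (by positivity),
    ← ENNReal.ofReal_mul (by positivity),
    ← ENNReal.ofReal_add (Finset.sum_nonneg s0) (by positivity),
    ← ENNReal.ofReal_mul (by positivity), ENNReal.ofReal_le_ofReal_iff] at h1
  · exact h1
  · exact mul_nonneg (by positivity) (add_nonneg (Finset.sum_nonneg s0) (by positivity))

/-- Jensen bounds the `p`-th power of the average, and `|a| ≤ max 1 (|a|^p)` turns this into the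
affine bound asked for by `testCompact_of_functionals`. -/
theorem abs_average_cell_le (hp : 2 ≤ p) {d N : ℕ} (hN : 0 < N) {ω : Set (E d)} {M : ℤ}
    {ℓ : ℝ} (hℓ : 0 < ℓ) {f : E (d + 1) → ℝ} (hf : IsTest (strip ω) f) {k : Fin (d + 1) → ℤ}
    (hk : k ∈ cellIndex d N M) :
    |⨍ x in cell (ℓ / N) k, f x| ≤ 1 + (volume (cell (ℓ / N) k)).toReal⁻¹ *
      ∫ x in cylinder ω ℓ, |f x| ^ p := by
  have hN' : (0 : ℝ) < N := by exact_mod_cast hN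
  have hε : 0 < ℓ / N := by positivity
  have hc := hf.isC1Test
  set a := ⨍ x in cell (ℓ / N) k, f x with ha
  set V := volume (cell (ℓ / N) k) with hV
  have i0 : 0 ≤ ∫ x in cylinder ω ℓ, |f x| ^ p := integral_nonneg fun _ => by positivity
  have h1 : V * ‖a‖ₑ ^ p ≤ ∫⁻ x in cylinder ω ℓ, ‖f x‖ₑ ^ p := by
    refine (volume_mul_enorm_average_rpow_le (by linarith) hc.1.continuous
      (volume_cell_ne_top _ k)).trans ?_
    refine (lintegral_mono_set (cell_subset_slab hN hℓ hk)).trans ?_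
    refine lintegral_slab_le (isClosed_tsupport f) hf.2.2 fun x hx => ?_
    rw [image_eq_zero_of_notMem_tsupport hx]; simp [show 0 < p by linarith]
  rw [lintegral_enorm_rpow_eq_ofReal hp (hc.memLp _ _),
    ← ENNReal.ofReal_toReal (show V ≠ ⊤ from volume_cell_ne_top _ k), ← ofReal_norm,
    ENNReal.ofReal_rpow_of_nonneg (norm_nonneg _) (by linarith),
    ← ENNReal.ofReal_mul ENNReal.toReal_nonneg] at h1
  simp only [Real.norm_eq_abs] at h1
  rw [ENNReal.ofReal_le_ofReal_iff i0] at h1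
  rcases (ENNReal.toReal_nonneg : 0 ≤ V.toReal).eq_or_lt with h0 | h0
  · have : a = 0 := by
      have : V = 0 := by
        rcases (ENNReal.toReal_eq_zero_iff V).1 h0.symm with h | h
        · exact h
        · exact absurd h (volume_cell_ne_top _ k)
      rw [ha, setAverage_eq, Measure.restrict_eq_zero.2 this]; simp
    rw [this, abs_zero]; positivity
  · have h2 : |a| ^ p ≤ V.toReal⁻¹ * ∫ x in cylinder ω ℓ, |f x| ^ p := by
      rw [← div_eq_inv_mul, le_div_iff₀ h0, mul_comm]; exact h1
    rcases le_total |a| 1 with h | h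
    · have : 0 ≤ V.toReal⁻¹ * ∫ x in cylinder ω ℓ, |f x| ^ p := by positivity
      linarith
    · have := Real.rpow_le_rpow_of_exponent_le h (by linarith : (1 : ℝ) ≤ p)
      rw [Real.rpow_one] at this
      linarith

/-- A Rellich argument: the finitely many functionals are the averages over grid cells, and the
Poincaré error is proportional to `(ℓ/N)^p`, hence below any `δ` for a fine grid. Taking the side as
`ℓ/N` aligns the grid with both ends. -/
theorem testCompact_cylinder (hp : 2 ≤ p) {d : ℕ} {ω : Set (E d)}
    (hωb : Bornology.IsBounded ω) {ℓ : ℝ} (hℓ : 0 < ℓ) :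
    TestCompact p (cylinder ω ℓ) (strip ω) := by
  obtain ⟨R, hR⟩ := hωb.exists_norm_le
  refine testCompact_of_functionals hp fun δ hδ => ?_
  obtain ⟨N, hN, hNδ⟩ : ∃ N : ℕ, 0 < N ∧
      2 ^ (p - 1) * ((((d + 1 : ℕ) : ℝ) * (ℓ / N)) ^ p * 2 ^ (d + 1)) < δ := by
    have t1 : Tendsto (fun N : ℕ => ((d + 1 : ℕ) : ℝ) * (ℓ / N)) atTop (𝓝 0) := by
      simpa using (tendsto_const_div_atTop_nhds_zero_nat ℓ).const_mul ((d + 1 : ℕ) : ℝ)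
    have t2 := ((t1.rpow_const (p := p) (Or.inr (by linarith))).mul_const
      ((2 : ℝ) ^ (d + 1))).const_mul ((2 : ℝ) ^ (p - 1))
    rw [Real.zero_rpow (by linarith), zero_mul, mul_zero] at t2
    obtain ⟨N, h1, h2⟩ := ((t2.eventually (gt_mem_nhds hδ)).and (eventually_gt_atTop 0)).exists
    exact ⟨N, h2, h1⟩
  set I := cellIndex d N (⌈R / (ℓ / N)⌉ + 1) with hI
  let V : (Fin (d + 1) → ℤ) → ℝ := fun k => (volume (cell (ℓ / N) k)).toReal
  have hV : ∀ k, 0 ≤ V k := fun k => ENNReal.toReal_nonneg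
  set K := 1 + ∑ k ∈ I, ((V k)⁻¹ + 2 ^ (p - 1) * V k) with hK
  have hterm : ∀ k ∈ I, 0 ≤ (V k)⁻¹ + 2 ^ (p - 1) * V k := fun k _ =>
    add_nonneg (inv_nonneg.2 (hV k)) (mul_nonneg (by positivity) (hV k))
  have hKk : ∀ k ∈ I, (V k)⁻¹ + 2 ^ (p - 1) * V k ≤ K - 1 := fun k hk => by
    rw [hK, add_sub_cancel_left]
    exact Finset.single_le_sum hterm hk
  refine ⟨I, inferInstance, fun k f => ⨍ x in cell (ℓ / N) k.1, f x, K, ?_, ?_, ?_⟩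
  · intro k f g hf hg
    simp only [setAverage_eq]
    rw [integral_sub, smul_sub]
    · exact (hf.isC1Test.1.continuous.integrable_of_hasCompactSupport hf.2.1).integrableOn
    · exact (hg.isC1Test.1.continuous.integrable_of_hasCompactSupport hg.2.1).integrableOn
  · intro k f hf
    have i0 : 0 ≤ ∫ x in cylinder ω ℓ, |f x| ^ p := integral_nonneg fun _ => by positivity
    refine (abs_average_cell_le hp hN hℓ hf k.2).trans ?_
    have h1 := hKk k.1 k.2
    have h2 := inv_nonneg.2 (hV k.1)
    have h3 : 0 ≤ 2 ^ (p - 1) * V k.1 := mul_nonneg (by positivity) (hV _)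
    have h4 : (V k.1)⁻¹ * ∫ x in cylinder ω ℓ, |f x| ^ p ≤ K * ∫ x in cylinder ω ℓ, |f x| ^ p :=
      mul_le_mul_of_nonneg_right (by linarith) i0
    simp only [V] at h4 h1 h2
    nlinarith
  · intro f hf
    have i0 : 0 ≤ ∫ x in cylinder ω ℓ, ‖gradient f x‖ ^ p := integral_nonneg fun _ => by positivity
    refine (integral_cylinder_le_sum_average hp hN hR hℓ hf).trans ?_
    rw [mul_add]
    refine add_le_add ?_ ?_
    · rw [Finset.sum_coe_sort I fun k => |⨍ x in cell (ℓ / N) k, f x| ^ p, Finset.mul_sum,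
        Finset.mul_sum]
      refine Finset.sum_le_sum fun k hk => ?_
      rw [← mul_assoc]
      refine mul_le_mul_of_nonneg_right ?_ (by positivity)
      have h1 := hKk k hk
      have h2 := inv_nonneg.2 (hV k)
      simp only [V] at h1 h2
      linarith
    · rw [← mul_assoc, ← mul_assoc, mul_assoc (2 ^ (p - 1)), ← mul_assoc]
      refine mul_le_mul_of_nonneg_right ?_ i0
      rw [mul_assoc (2 ^ (p - 1))]
      exact hNδ.le

end Compactness

/-! ### Calculus on the product -/

section Calculus

variable {d : ℕ}

/-- `tail` as a continuous linear map. -/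
def tailL (d : ℕ) : E (d + 1) →L[ℝ] E d where
  toFun := tail
  map_add' _ _ := rfl
  map_smul' _ _ := rfl
  cont := continuous_tail

@[simp] theorem tailL_apply (x : E (d + 1)) : tailL d x = tail x := rfl

/-- `X ↦ (0, X)` as a continuous linear map. -/
def consL (d : ℕ) : E d →L[ℝ] E (d + 1) where
  toFun X := consE 0 X
  map_add' X Y := by ext i; refine Fin.cases ?_ (fun j => ?_) i <;> simp
  map_smul' c X := by ext i; refine Fin.cases ?_ (fun j => ?_) i <;> simp
  cont := continuous_consE.comp (continuous_const.prodMk continuous_id)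

@[simp] theorem consL_apply (X : E d) : consL d X = consE 0 X := rfl

theorem inner_consE (a : ℝ) (b : E d) (y : E (d + 1)) :
    inner ℝ (consE a b) y = a * y 0 + inner ℝ b (tail y) := by
  simp only [PiLp.inner_apply, Fin.sum_univ_succ, consE_zero, consE_succ, tail_apply]
  simp [mul_comm]

theorem norm_consE_le (a : ℝ) (b : E d) : ‖consE a b‖ ≤ |a| + ‖b‖ := by
  have h : ‖consE a b‖ ^ 2 = a ^ 2 + ‖b‖ ^ 2 := by
    rw [← real_inner_self_eq_norm_sq, inner_consE, tail_consE, consE_zero,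
      real_inner_self_eq_norm_sq]; ring
  refine abs_le_of_sq_le_sq' ?_ (by positivity) |>.2
  rw [h, add_sq, sq_abs]
  have : 0 ≤ 2 * |a| * ‖b‖ := by positivity
  linarith

theorem norm_consE_zero (b : E d) : ‖consE 0 b‖ = ‖b‖ := by
  have h : ‖consE 0 b‖ ^ 2 = ‖b‖ ^ 2 := by
    rw [← real_inner_self_eq_norm_sq, inner_consE, tail_consE, consE_zero,
      real_inner_self_eq_norm_sq]; simp
  exact (sq_eq_sq₀ (norm_nonneg _) (norm_nonneg _)).1 h

theorem consE_add (a a' : ℝ) (b b' : E d) : consE (a + a') (b + b') = consE a b + consE a' b' := by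
  ext i; refine Fin.cases ?_ (fun j => ?_) i <;> simp

theorem consE_smul (c a : ℝ) (b : E d) : consE (c * a) (c • b) = c • consE a b := by
  ext i; refine Fin.cases ?_ (fun j => ?_) i <;> simp

theorem gradient_tensor {f : ℝ → ℝ} {φ : E d → ℝ} (hf : Differentiable ℝ f)
    (hφ : Differentiable ℝ φ) (x : E (d + 1)) :
    gradient (fun x => f (x 0) * φ (tail x)) x =
      consE (deriv f (x 0) * φ (tail x)) (f (x 0) • gradient φ (tail x)) := by
  apply gradient_eq_of_hasFDerivAt
  have h1 : HasFDerivAt (fun x : E (d + 1) => f (x 0))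
      (deriv f (x 0) • (EuclideanSpace.proj (𝕜 := ℝ) 0 : E (d + 1) →L[ℝ] ℝ)) x :=
    (hf (x 0)).hasDerivAt.comp_hasFDerivAt x
      (EuclideanSpace.proj (𝕜 := ℝ) 0 : E (d + 1) →L[ℝ] ℝ).hasFDerivAt
  have h2 : HasFDerivAt (fun x : E (d + 1) => φ (tail x))
      ((fderiv ℝ φ (tail x)).comp (tailL d)) x :=
    (hφ (tail x)).hasFDerivAt.comp x (tailL d).hasFDerivAt
  refine (h1.mul h2).congr_fderiv ?_
  ext y
  simp only [InnerProductSpace.toDual_apply_apply, inner_consE, inner_smul_left,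
    inner_gradient_left, _root_.add_apply, _root_.smul_apply,
    ContinuousLinearMap.comp_apply, tailL_apply, smul_eq_mul, PiLp.proj_apply]
  simp only [conj_trivial]
  ring

theorem isC1Test_tensor {ω : Set (E d)} {f : ℝ → ℝ} {φ : E d → ℝ} (hf : ContDiff ℝ 1 f)
    (hfc : HasCompactSupport f) (hφ : IsC1Test ω φ) :
    IsC1Test (strip ω) fun x => f (x 0) * φ (tail x) := by
  have hK : IsCompact ((fun z : ℝ × E d => consE z.1 z.2) '' (tsupport f ×ˢ tsupport φ)) :=
    (hfc.isCompact.prod hφ.2.1.isCompact).image continuous_consE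
  have hsupp : Function.support (fun x : E (d + 1) => f (x 0) * φ (tail x)) ⊆
      (fun z : ℝ × E d => consE z.1 z.2) '' (tsupport f ×ˢ tsupport φ) := by
    intro x hx
    rw [Function.mem_support, mul_ne_zero_iff] at hx
    exact ⟨(x 0, tail x), ⟨subset_tsupport _ hx.1, subset_tsupport _ hx.2⟩, by simp⟩
  refine ⟨?_, HasCompactSupport.of_support_subset_isCompact hK hsupp,
    (closure_minimal hsupp hK.isClosed).trans ?_⟩
  · exact (hf.comp (EuclideanSpace.proj (𝕜 := ℝ) 0 : E (d + 1) →L[ℝ] ℝ).contDiff).mul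
      (hφ.1.comp (tailL d).contDiff)
  · rintro _ ⟨z, hz, rfl⟩
    simpa [strip] using hφ.2.2 hz.2

theorem IsTest.slice {ω : Set (E d)} {v : E (d + 1) → ℝ} (hv : IsTest (strip ω) v) (t : ℝ) :
    IsTest ω fun X => v (consE t X) := by
  have hK : IsCompact (tail '' tsupport v) := hv.2.1.isCompact.image continuous_tail
  have hsupp : Function.support (fun X => v (consE t X)) ⊆ tail '' tsupport v := fun X hX =>
    ⟨consE t X, subset_tsupport _ hX, by simp⟩
  refine ⟨?_, HasCompactSupport.of_support_subset_isCompact hK hsupp,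
    (closure_minimal hsupp hK.isClosed).trans ?_⟩
  · have : (fun X : E d => consE t X) = fun X => consE t 0 + consL d X := by
      ext X; simp [← consE_add]
    have h2 : ContDiff ℝ ((⊤ : ℕ∞) : WithTop ℕ∞) fun X : E d => consE t X := by
      rw [this]; exact contDiff_const.add (consL d).contDiff
    exact hv.1.comp h2
  · rintro _ ⟨x, hx, rfl⟩
    exact hv.2.2 hx

theorem gradient_slice {v : E (d + 1) → ℝ} (hv : Differentiable ℝ v) (t : ℝ) (X : E d) :
    gradient (fun X => v (consE t X)) X = tail (gradient v (consE t X)) := by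
  apply gradient_eq_of_hasFDerivAt
  have h1 : HasFDerivAt (fun X : E d => consE t X) (consL d) X := by
    have : (fun X : E d => consE t X) = fun X => consE t 0 + consL d X := by
      ext X; simp [← consE_add]
    rw [this]
    exact (consL d).hasFDerivAt.const_add _
  refine ((hv (consE t X)).hasFDerivAt.comp X h1).congr_fderiv ?_
  ext y
  rw [InnerProductSpace.toDual_apply_apply, ContinuousLinearMap.comp_apply, ← inner_gradient_left,
    consL_apply, real_inner_comm, inner_consE, zero_mul, zero_add, real_inner_comm]

end Calculus

/-! ### Admissible fields -/

section Admissible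

variable {d : ℕ} {A : E d → Matrix (Fin (d + 1)) (Fin (d + 1)) ℝ} {ω : Set (E d)} {p : ℝ}

theorem form_consE_zero (X ξ : E d) (η : E (d + 1)) :
    form (A X) (consE 0 ξ) η = A12dot A X ξ * η 0 + form (A22 A X) ξ (tail η) := by
  simp only [form, A12dot, A22, dotProduct, Matrix.mulVec, Fin.sum_univ_succ, consE_zero,
    consE_succ, mul_zero, zero_add, tail_apply, Matrix.submatrix_apply]

theorem form_A22 (X ξ η : E d) : form (A22 A X) ξ η = form (A X) (consE 0 ξ) (consE 0 η) := by
  simp [form_consE_zero]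

theorem bnorm_consE_zero (X ξ : E d) : bnorm (A X) (consE 0 ξ) = bnorm (A22 A X) ξ := by
  rw [bnorm, bnorm, form_A22]

/-- A purely transversal field acts on the longitudinal component of `η` only through `A₁₂·ξ`. This
term decides between the two alternatives. -/
theorem flux_consE_zero (X ξ : E d) (η : E (d + 1)) :
    flux p (A X) (consE 0 ξ) η =
      |form (A22 A X) ξ ξ| ^ ((p - 2) / 2) * A12dot A X ξ * η 0 + flux p (A22 A X) ξ (tail η) := by
  rw [flux, flux, form_A22 X ξ ξ, form_consE_zero X ξ η]; ring

theorem IsAdmissible.elliptic (hA : IsAdmissible ω A) : Elliptic (volume.restrict ω) A := by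
  obtain ⟨h1, h2, ⟨M, hM⟩, c, hc, h4⟩ := hA
  exact elliptic_of_bounds h1 h2 hM hc h4

theorem IsAdmissible.elliptic_A22 (hA : IsAdmissible ω A) :
    Elliptic (volume.restrict ω) (A22 A) := by
  obtain ⟨h1, h2, ⟨M, hM⟩, c, hc, h4⟩ := hA
  refine elliptic_of_bounds (fun i j => h1 _ _) ?_ (M := M) ?_ hc ?_
  · filter_upwards [h2] with X hX
    exact hX.submatrix _
  · filter_upwards [hM] with X hX i j using hX _ _
  · filter_upwards [h4] with X hX ξ
    rw [form_A22, ← norm_consE_zero]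
    exact hX _

theorem Elliptic.comp_tail (hω : MeasurableSet ω) (hA : Elliptic (volume.restrict ω) A) (ℓ : ℝ) :
    Elliptic (volume.restrict (cylinder ω ℓ)) fun x => A (tail x) := by
  obtain ⟨h1, c, K, hc, hK, h2⟩ := hA
  refine ⟨fun i j => ?_, c, K, hc, hK, ae_cylinder_of_ae hω h2⟩
  exact (h1 i j).comp_quasiMeasurePreserving
    ((Measure.quasiMeasurePreserving_snd (μ := volume.restrict (Set.Ioo (-ℓ) ℓ))
    (ν := volume.restrict ω)).comp
      (measurePreserving_splitE_cylinder hω ℓ).quasiMeasurePreserving)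

end Admissible

/-! ### Tensor products of functions of one variable and functions on the cross-section -/

section Tensor

variable {d : ℕ} {ω : Set (E d)} {p ℓ : ℝ}

theorem eLpNorm_cylinder_comp_tail {F : Type*} [NormedAddCommGroup F] (hω : MeasurableSet ω)
    {g : E d → F} (q : ℝ≥0∞) (hg : AEStronglyMeasurable g (volume.restrict ω)) :
    eLpNorm (fun x => g (tail x)) q (volume.restrict (cylinder ω ℓ)) =
      eLpNorm (fun z : ℝ × E d => g z.2) q
        ((volume.restrict (Set.Ioo (-ℓ) ℓ)).prod (volume.restrict ω)) :=
  eLpNorm_comp_measurePreserving (f := splitE d) (g := fun z : ℝ × E d => g z.2)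
    (hg.comp_quasiMeasurePreserving Measure.quasiMeasurePreserving_snd)
      (measurePreserving_splitE_cylinder hω ℓ)

theorem exists_eLpNorm_cylinder_comp_tail_eq {F : Type*} [NormedAddCommGroup F]
    (hω : MeasurableSet ω) (ℓ : ℝ) : ∃ C : ℝ≥0∞, C ≠ ⊤ ∧ ∀ g : E d → F,
      AEStronglyMeasurable g (volume.restrict ω) →
      eLpNorm (fun x => g (tail x)) (ENNReal.ofReal p) (volume.restrict (cylinder ω ℓ)) =
        C * eLpNorm g (ENNReal.ofReal p) (volume.restrict ω) := by
  refine ⟨(volume.restrict (Set.Ioo (-ℓ) ℓ)) Set.univ ^ (1 / ENNReal.ofReal p).toReal,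
    ENNReal.rpow_ne_top_of_nonneg (by positivity) (by simp), fun g hg => ?_⟩
  have hmap : Measure.map Prod.snd ((volume.restrict (Set.Ioo (-ℓ) ℓ)).prod (volume.restrict ω)) =
      (volume.restrict (Set.Ioo (-ℓ) ℓ)) Set.univ • volume.restrict ω := Measure.map_snd_prod
  have hg2 : AEStronglyMeasurable g (Measure.map Prod.snd
      ((volume.restrict (Set.Ioo (-ℓ) ℓ)).prod (volume.restrict ω))) := by
    rw [hmap]; exact hg.smul_measure _
  rw [eLpNorm_cylinder_comp_tail hω _ hg,
    ← Function.comp_def g Prod.snd, ← eLpNorm_map_measure hg2 measurable_snd.aemeasurable, hmap,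
    eLpNorm_smul_measure_of_ne_top ENNReal.ofReal_ne_top, smul_eq_mul]

theorem memLp_mul_comp_tail {F : Type*} [NormedAddCommGroup F] [NormedSpace ℝ F]
    (hω : MeasurableSet ω) {f : ℝ → ℝ} (hf : Continuous f) {q : ℝ≥0∞} {g : E d → F}
    (hg : MemLp g q (volume.restrict ω)) :
    MemLp (fun x => f (x 0) • g (tail x)) q (volume.restrict (cylinder ω ℓ)) := by
  obtain ⟨C, hC⟩ := (isCompact_Icc : IsCompact (Set.Icc (-ℓ) ℓ)).exists_bound_of_continuousOn
    hf.continuousOn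
  have h1 : MemLp (fun x => g (tail x)) q (volume.restrict (cylinder ω ℓ)) :=
    memLp_cylinder_mul hω hg
  have hc0 : Continuous fun x : E (d + 1) => f (x 0) := hf.comp (by fun_prop)
  refine h1.of_le_mul (c := C) (hc0.aestronglyMeasurable.smul h1.1) ?_
  have hm : MeasurableSet (cylinder ω ℓ) := by
    rw [cylinder_eq_preimage]
    exact (splitE d).measurable (measurableSet_Ioo.prod hω)
  filter_upwards [ae_restrict_mem hm] with x hx
  rw [norm_smul]
  exact mul_le_mul_of_nonneg_right (hC _ ⟨hx.1.1.le, hx.1.2.le⟩) (norm_nonneg _)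

theorem measurableSet_cylinder (hω : MeasurableSet ω) :
    MeasurableSet (cylinder ω ℓ) := by
  rw [cylinder_eq_preimage]
  exact (splitE d).measurable (measurableSet_Ioo.prod hω)

theorem isFiniteMeasure_cylinder (hωb : Bornology.IsBounded ω) (ℓ : ℝ) :
    IsFiniteMeasure (volume.restrict (cylinder ω ℓ)) :=
  ⟨by rw [Measure.restrict_apply_univ]; exact (isBounded_cylinder hωb ℓ).measure_lt_top⟩

/-- The factor `f` is free at the ends, since only lateral vanishing is required; the approximants
replace `w` by test functions of the cross-section. -/
theorem memVanishing_tensor (hωo : IsOpen ω) (hωb : Bornology.IsBounded ω) (hp : 2 ≤ p)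
    {f : ℝ → ℝ} (hf : ContDiff ℝ 1 f) {w : E d → ℝ} {Dw : E d → E d}
    (hw : MemVanishing p ω ω w Dw) :
    MemVanishing p (cylinder ω ℓ) (strip ω) (fun x => f (x 0) * w (tail x))
      (fun x => consE (deriv f (x 0) * w (tail x)) (f (x 0) • Dw (tail x))) := by
  have := isFiniteMeasure_cylinder hωb ℓ
  have hωm := hωo.measurableSet
  obtain ⟨⟨hw1, hD1, -⟩, φ, hφ, h1, h2⟩ := hw
  have hf' : Continuous (deriv f) := hf.continuous_deriv (by simp)
  obtain ⟨C1, hC1⟩ := (isCompact_Icc : IsCompact (Set.Icc (-ℓ) ℓ)).exists_bound_of_continuousOn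
    hf.continuous.continuousOn
  obtain ⟨C2, hC2⟩ := (isCompact_Icc : IsCompact (Set.Icc (-ℓ) ℓ)).exists_bound_of_continuousOn
    hf'.continuousOn
  -- The cutoff supplies compact support in `x₁` and equals `1` on `(-ℓ, ℓ)`, so neither `f` nor its
  -- derivative changes on the cylinder.
  let χ : ContDiffBump (0 : ℝ) := ⟨|ℓ| + 1, |ℓ| + 2, by positivity, by linarith⟩
  have hχ1 : ∀ t ∈ Metric.ball (0 : ℝ) (|ℓ| + 1), χ t = 1 := fun t ht =>
    χ.one_of_mem_closedBall (Metric.ball_subset_closedBall ht)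
  set g : ℝ → ℝ := fun t => χ t * f t with hg
  have hgc : ContDiff ℝ 1 g := χ.contDiff.mul hf
  have hgs : HasCompactSupport g := χ.hasCompactSupport.mul_right
  have hball : ∀ t ∈ Set.Ioo (-ℓ) ℓ, t ∈ Metric.ball (0 : ℝ) (|ℓ| + 1) := fun t ht => by
    rw [Metric.mem_ball, dist_zero_right, Real.norm_eq_abs, abs_lt]
    have := le_abs_self ℓ
    exact ⟨by linarith [ht.1], by linarith [ht.2]⟩
  have hgf : ∀ t ∈ Set.Ioo (-ℓ) ℓ, g t = f t := fun t ht => by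
    simp only [hg]; rw [hχ1 t (hball t ht), one_mul]
  have hgf' : ∀ t ∈ Set.Ioo (-ℓ) ℓ, deriv g t = deriv f t := fun t ht => by
    refine Filter.EventuallyEq.deriv_eq ?_
    filter_upwards [isOpen_Ioo.mem_nhds ht] with s hs using hgf s hs
  have hcyl := ae_restrict_mem (μ := volume) (measurableSet_cylinder (ℓ := ℓ) hωm)
  have mw := memLp_mul_comp_tail (ℓ := ℓ) hωm hf.continuous hw1
  have mD : MemLp (fun x => consE (deriv f (x 0) * w (tail x)) (f (x 0) • Dw (tail x)))
      (ENNReal.ofReal p) (volume.restrict (cylinder ω ℓ)) := by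
    have a1 := memLp_mul_comp_tail (ℓ := ℓ) hωm hf' hw1
    have a2 := memLp_mul_comp_tail (ℓ := ℓ) hωm hf.continuous hD1
    refine (a1.norm.add a2.norm).of_le (continuous_consE.comp_aestronglyMeasurable
      (a1.1.prodMk a2.1)) (Eventually.of_forall fun x => ?_)
    refine (norm_consE_le _ _).trans ?_
    rw [Pi.add_apply]
    exact le_abs_self _
  obtain ⟨c1, hc1, hc1'⟩ := exists_eLpNorm_cylinder_comp_tail_eq (F := ℝ) hωm ℓ
  have mφ : ∀ k, AEStronglyMeasurable (φ k) (volume.restrict ω) :=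
    fun k => ((hφ k).isC1Test.memLp (ENNReal.ofReal p) _).1
  have mgφ : ∀ k, AEStronglyMeasurable (gradient (φ k)) (volume.restrict ω) :=
    fun k => ((hφ k).isC1Test.memLp_gradient (ENNReal.ofReal p) _).1
  refine memVanishing_of_tendsto hp (isOpen_strip hωo) mw mD
    (φ := fun k x => g (x 0) * φ k (tail x)) (fun k => isC1Test_tensor hgc hgs (hφ k).isC1Test)
    ?_ ?_
  · have t := ENNReal.Tendsto.const_mul (a := ENNReal.ofReal C1)
      (ENNReal.Tendsto.const_mul (a := c1) h1 (Or.inr hc1)) (Or.inr ENNReal.ofReal_ne_top)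
    rw [mul_zero, mul_zero] at t
    refine tendsto_of_tendsto_of_tendsto_of_le_of_le tendsto_const_nhds t (fun _ => zero_le)
      fun k => ?_
    simp only
    rw [← hc1' (fun x => w x - φ k x) (hw1.1.sub (mφ k))]
    refine eLpNorm_le_mul_eLpNorm_of_ae_le_mul ?_ _
    filter_upwards [hcyl] with x hx
    rw [hgf _ hx.1, ← mul_sub, norm_mul]
    exact mul_le_mul_of_nonneg_right (hC1 _ ⟨hx.1.1.le, hx.1.2.le⟩) (norm_nonneg _)
  · have t := ENNReal.Tendsto.const_mul (a := ENNReal.ofReal (max C1 C2))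
      (ENNReal.Tendsto.const_mul (a := c1) (h1.add h2) (Or.inr hc1)) (Or.inr ENNReal.ofReal_ne_top)
    rw [add_zero, mul_zero, mul_zero] at t
    refine tendsto_of_tendsto_of_tendsto_of_le_of_le tendsto_const_nhds t (fun _ => zero_le)
      fun k => ?_
    simp only
    have n1 := (hw1.1.sub (mφ k)).norm
    have n2 := (hD1.1.sub (mgφ k)).norm
    have hsum : eLpNorm (fun X => ‖w X - φ k X‖ + ‖Dw X - gradient (φ k) X‖) (ENNReal.ofReal p)
        (volume.restrict ω) ≤ eLpNorm (fun X => w X - φ k X) (ENNReal.ofReal p)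
          (volume.restrict ω) + eLpNorm (fun X => Dw X - gradient (φ k) X) (ENNReal.ofReal p)
          (volume.restrict ω) := by
      refine (eLpNorm_add_le n1 n2 (one_le_ofReal_of_two_le hp)).trans (le_of_eq ?_)
      rw [← eLpNorm_norm (fun X => w X - φ k X), ← eLpNorm_norm (fun X => Dw X - gradient (φ k) X)]
      rfl
    refine le_trans ?_ (mul_le_mul_right (mul_le_mul_right hsum _) _)
    rw [← hc1' (fun X => ‖w X - φ k X‖ + ‖Dw X - gradient (φ k) X‖) (n1.add n2)]
    refine eLpNorm_le_mul_eLpNorm_of_ae_le_mul ?_ _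
    filter_upwards [hcyl] with x hx
    rw [gradient_tensor (hgc.differentiable (by simp))
      ((hφ k).isC1Test.1.differentiable (by simp)), hgf _ hx.1, hgf' _ hx.1]
    have e : consE (deriv f (x 0) * w (tail x)) (f (x 0) • Dw (tail x)) -
        consE (deriv f (x 0) * φ k (tail x)) (f (x 0) • gradient (φ k) (tail x)) =
        consE (deriv f (x 0) * (w (tail x) - φ k (tail x)))
          (f (x 0) • (Dw (tail x) - gradient (φ k) (tail x))) := by
      rw [sub_eq_iff_eq_add, ← consE_add]
      congr 1
      · ring
      · rw [smul_sub]; abel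
    rw [e]
    refine (norm_consE_le _ _).trans ?_
    have hx' : x 0 ∈ Set.Icc (-ℓ) ℓ := ⟨hx.1.1.le, hx.1.2.le⟩
    rw [abs_mul, norm_smul, Real.norm_of_nonneg (by positivity :
      0 ≤ ‖w (tail x) - φ k (tail x)‖ + ‖Dw (tail x) - gradient (φ k) (tail x)‖), mul_add]
    exact add_le_add
      (mul_le_mul_of_nonneg_right ((hC2 _ hx').trans (le_max_right _ _)) (abs_nonneg _))
      (mul_le_mul_of_nonneg_right ((hC1 _ hx').trans (le_max_left _ _)) (norm_nonneg _))

end Tensor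

/-! ### Rayleigh bounds on the cylinder and the energy of a perturbed slice -/

section Spectrum

variable {d : ℕ} {ω : Set (E d)} {A : E d → Matrix (Fin (d + 1)) (Fin (d + 1)) ℝ} {p ℓ : ℝ}
  {W : E d → ℝ} {DW : E d → E d}

/-- A smooth bump function at a point of an open set. -/
theorem exists_isTest_eq_one {n : ℕ} {U : Set (E n)} (hU : IsOpen U) {c : E n} (hc : c ∈ U) :
    ∃ φ, IsTest U φ ∧ φ c = 1 := by
  obtain ⟨r, hr, hrU⟩ := Metric.isOpen_iff.1 hU c hc
  let χ : ContDiffBump c := ⟨r / 4, r / 2, by positivity, by linarith⟩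
  refine ⟨χ, ⟨χ.contDiff, χ.hasCompactSupport, ?_⟩, χ.one_of_mem_closedBall ?_⟩
  · rw [χ.tsupport_eq]
    exact (Metric.closedBall_subset_ball (by linarith : r / 2 < r)).trans hrU
  · exact Metric.mem_closedBall_self (by positivity)

theorem exists_isTest_strip (hp : 2 ≤ p) (hωo : IsOpen ω) (hωb : Bornology.IsBounded ω)
    (hne : ω.Nonempty) (hℓ : 0 < ℓ) :
    ∃ φ, IsTest (strip ω) φ ∧ 0 < ∫ x in cylinder ω ℓ, |φ x| ^ p := by
  obtain ⟨X, hX⟩ := hne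
  have hc : consE 0 X ∈ strip ω := by simpa [strip] using hX
  obtain ⟨φ, hφ, h1⟩ := exists_isTest_eq_one (isOpen_strip hωo) hc
  refine ⟨φ, hφ, ?_⟩
  have := isFiniteMeasure_cylinder hωb ℓ
  refine integral_abs_rpow_pos hp (hφ.isC1Test.memLp _ _) fun h => ?_
  have hmem : consE 0 X ∈ cylinder ω ℓ := by simpa [cylinder, hX] using hℓ
  have := Measure.eqOn_open_of_ae_eq h (isOpen_cylinder hωo ℓ) hφ.1.continuous.continuousOn
    continuousOn_const hmem
  rw [h1] at this
  exact one_ne_zero this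

/-- The second clause gives upper bounds from single trial functions (the gap), the third gives
lower bounds from smooth functions (the equality). -/
theorem lambdaM_spec (hp : 2 ≤ p) (hωo : IsOpen ω) (hωb : Bornology.IsBounded ω)
    (hne : ω.Nonempty) (hA : IsAdmissible ω A) (hℓ : 0 < ℓ) :
    IsLeast (mixedEigenvalues p A ω ℓ) (lambdaM p A ω ℓ) ∧
    (∀ u G, MemVanishing p (cylinder ω ℓ) (strip ω) u G →
      lambdaM p A ω ℓ * ∫ x in cylinder ω ℓ, |u x| ^ p ≤
        ∫ x in cylinder ω ℓ, bnorm (A (tail x)) (G x) ^ p) ∧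
    ∀ μ, (∀ φ, IsTest (strip ω) φ → μ * ∫ x in cylinder ω ℓ, |φ x| ^ p ≤
      ∫ x in cylinder ω ℓ, bnorm (A (tail x)) (gradient φ x) ^ p) → μ ≤ lambdaM p A ω ℓ := by
  have := isFiniteMeasure_cylinder hωb ℓ
  obtain ⟨lam, h1, h2, h3⟩ := exists_isLeast_eigenvalue hp (isOpen_strip hωo)
    (hA.elliptic.comp_tail hωo.measurableSet ℓ) (testCompact_cylinder hp hωb hℓ)
    (exists_isTest_strip hp hωo hωb hne hℓ)
  have e : lambdaM p A ω ℓ = lam := h1.csInf_eq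
  rw [e]
  exact ⟨h1, h2, h3⟩

theorem IsFirstEigenfunction.energy_eq (hp : 2 ≤ p) (hA : IsAdmissible ω A)
    (hW : IsFirstEigenfunction p A ω W DW) :
    ∫ X in ω, bnorm (A22 A X) (DW X) ^ p = mu1 p A ω := by
  rw [hW.1.energy_eq hp hA.elliptic_A22, hW.2.1, mul_one]

theorem IsFirstEigenfunction.mu1_nonneg (hp : 2 ≤ p) (hA : IsAdmissible ω A)
    (hW : IsFirstEigenfunction p A ω W DW) : 0 ≤ mu1 p A ω := by
  rw [← hW.energy_eq hp hA]
  exact integral_bnorm_rpow_nonneg _ _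

/-- `∫ |A₂₂ ξ · ξ|^((p-2)/2) (A₁₂ · ξ) θ`. -/
def drift (p : ℝ) (A : E d → Matrix (Fin (d + 1)) (Fin (d + 1)) ℝ) (ω : Set (E d))
    (ξ : E d → E d) (θ : E d → ℝ) : ℝ :=
  ∫ X in ω, |form (A22 A X) (ξ X) (ξ X)| ^ ((p - 2) / 2) * A12dot A X (ξ X) * θ X

/-- Upper bound for the energy of `W + r θ` with longitudinal derivative `-κ W - (κ + 1) r θ`. -/
theorem IsFirstEigenfunction.exists_slice_energy_le (hp : 2 ≤ p) (hωo : IsOpen ω)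
    (hωb : Bornology.IsBounded ω) (hA : IsAdmissible ω A) (hW : IsFirstEigenfunction p A ω W DW)
    {θ : E d → ℝ} (hθ : IsTest ω θ) :
    ∃ C, 0 ≤ C ∧ ∀ κ r : ℝ, |κ| ≤ 1 → |r| ≤ 1 →
      ∫ X in ω, bnorm (A X) (consE (-κ * W X - (κ + 1) * r * θ X)
        (DW X + r • gradient θ X)) ^ p ≤
      mu1 p A ω * (∫ X in ω, |W X + r * θ X| ^ p) - p * κ * drift p A ω DW W -
        p * (κ + 1) * r * drift p A ω DW θ + C * (κ ^ 2 + r ^ 2) := by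
  have : IsFiniteMeasure (volume.restrict ω) := isFiniteMeasure_restrict.2 hωb.measure_lt_top.ne
  have hB := hA.elliptic
  have hB2 := hA.elliptic_A22
  have mW := hW.1.1.1.1
  have mD := hW.1.1.1.2.1
  have mθ : MemLp θ (ENNReal.ofReal p) (volume.restrict ω) := hθ.isC1Test.memLp _ _
  have mg : MemLp (gradient θ) (ENNReal.ofReal p) (volume.restrict ω) :=
    hθ.isC1Test.memLp_gradient _ _
  have hcons : ∀ {a : E d → ℝ} {b : E d → E d}, MemLp a (ENNReal.ofReal p) (volume.restrict ω) →
      MemLp b (ENNReal.ofReal p) (volume.restrict ω) →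
      MemLp (fun X => consE (a X) (b X)) (ENNReal.ofReal p) (volume.restrict ω) := by
    intro a b ha hb
    refine (ha.norm.add hb.norm).of_le
      (continuous_consE.comp_aestronglyMeasurable (ha.1.prodMk hb.1))
      (Eventually.of_forall fun X => (norm_consE_le _ _).trans (le_abs_self _))
  have m0 : MemLp (fun X => consE 0 (DW X)) (ENNReal.ofReal p) (volume.restrict ω) :=
    hcons MemLp.zero mD
  have mM : MemLp (fun X => |W X| + 2 * |θ X| + ‖gradient θ X‖) (ENNReal.ofReal p)
      (volume.restrict ω) := (mW.norm.add (mθ.norm.const_mul 2)).add mg.norm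
  obtain ⟨C, hC0, hC⟩ := hB.exists_integral_bnorm_add_le hp m0 mM
  refine ⟨C, hC0, fun κ r hκ hr => ?_⟩
  -- The slice gradient is `(0, ∇W) + H`, and `H` has size `max |κ| |r|` times the fixed function
  -- `|W| + 2|θ| + |∇θ|`; the `2` bounds `|κ + 1|`.
  set H : E d → E (d + 1) := fun X => consE (-κ * W X - (κ + 1) * r * θ X) (r • gradient θ X)
    with hH
  have mH : MemLp H (ENNReal.ofReal p) (volume.restrict ω) :=
    hcons ((mW.const_mul _).sub (mθ.const_mul _)) (mg.const_smul r)
  have hδ := hC (max |κ| |r|) H (le_max_of_le_left (abs_nonneg _)) (max_le hκ hr) mH ?_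
  swap
  · intro X
    refine (norm_consE_le _ _).trans ?_
    rw [norm_smul, Real.norm_eq_abs]
    have h1 : |-κ * W X - (κ + 1) * r * θ X| ≤ |κ| * |W X| + |κ + 1| * |r| * |θ X| := by
      refine (abs_sub _ _).trans (le_of_eq ?_)
      rw [abs_mul, abs_mul, abs_mul, abs_neg]
    have h2 : |κ + 1| ≤ 2 := (abs_add_le _ _).trans (by rw [abs_one]; linarith)
    have h3 := le_max_left |κ| |r|
    have h4 := le_max_right |κ| |r|
    have a1 := mul_le_mul_of_nonneg_right h3 (abs_nonneg (W X))
    have a2 := mul_le_mul_of_nonneg_right (mul_le_mul h2 h4 (abs_nonneg _) zero_le_two)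
      (abs_nonneg (θ X))
    have a3 := mul_le_mul_of_nonneg_right h4 (norm_nonneg (gradient θ X))
    linarith
  have e0 : ∀ X, consE 0 (DW X) + H X =
      consE (-κ * W X - (κ + 1) * r * θ X) (DW X + r • gradient θ X) := fun X => by
    rw [hH, ← consE_add, zero_add]
  simp only [e0, bnorm_consE_zero] at hδ
  refine hδ.trans ?_
  have hfl : ∀ X, flux p (A X) (consE 0 (DW X)) (H X) =
      -κ * (|form (A22 A X) (DW X) (DW X)| ^ ((p - 2) / 2) * A12dot A X (DW X) * W X) -
      (κ + 1) * r * (|form (A22 A X) (DW X) (DW X)| ^ ((p - 2) / 2) * A12dot A X (DW X) * θ X) +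
      r * flux p (A22 A X) (DW X) (gradient θ X) := by
    intro X
    rw [flux_consE_zero, hH]
    simp only [consE_zero, tail_consE, flux_smul_right]
    ring
  -- The drift integrand is the flux of `(0, ∇W)` against `(a, 0)`, which gives its integrability.
  have hint : ∀ {a : E d → ℝ}, MemLp a (ENNReal.ofReal p) (volume.restrict ω) →
      Integrable (fun X => |form (A22 A X) (DW X) (DW X)| ^ ((p - 2) / 2) * A12dot A X (DW X) *
        a X) (volume.restrict ω) := by
    intro a ha
    have h1 := hB.integrable_flux hp m0 (hcons ha (MemLp.zero (ε := E d)))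
    refine h1.congr (Eventually.of_forall fun X => ?_)
    simp only [flux_consE_zero, consE_zero, tail_consE]
    simp [flux, form]
  -- The equation of `W` converts the transversal first-order term into `μ₁ ∫ |W|^(p-2) W θ`. The
  -- tangent inequality for the mass absorbs it into `μ₁ ∫ |W + rθ|^p`, so only drift terms survive
  -- at first order.
  have hEL : ∫ X in ω, flux p (A22 A X) (DW X) (gradient θ X) =
      mu1 p A ω * ∫ X in ω, |W X| ^ (p - 2) * W X * θ X :=
    hW.1.2.2 θ (gradient θ) (hθ.isC1Test.memVanishing hp hωo)
  have htan := integral_abs_rpow_tangent_le hp mW mθ r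
  rw [hW.2.1] at htan
  have hmu := mul_le_mul_of_nonneg_left htan (hW.mu1_nonneg hp hA)
  have hmax : (max |κ| |r|) ^ 2 ≤ κ ^ 2 + r ^ 2 := by
    rcases max_cases |κ| |r| with h | h <;> rw [h.1, sq_abs] <;> nlinarith
  have hCm := mul_le_mul_of_nonneg_right hmax hC0
  have i1 := (hint mW).const_mul (-κ)
  have i2 := (hint mθ).const_mul ((κ + 1) * r)
  have i3 := (hB2.integrable_flux hp mD mg).const_mul r
  have hsum : ∫ X in ω, flux p (A X) (consE 0 (DW X)) (H X) = -κ * drift p A ω DW W -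
      (κ + 1) * r * drift p A ω DW θ + r * (mu1 p A ω * ∫ X in ω, |W X| ^ (p - 2) * W X * θ X) := by
    rw [← hEL, drift, drift, ← integral_const_mul, ← integral_const_mul, ← integral_const_mul,
      ← integral_sub i1 i2]
    exact (integral_congr_ae (Eventually.of_forall hfl)).trans (integral_add (i1.sub i2) i3)
  rw [hsum, hW.energy_eq hp hA]
  linarith

end Spectrum

/-! ### Exponential trial functions on the cylinder -/

section Trial

variable {d : ℕ} {ω : Set (E d)} {A : E d → Matrix (Fin (d + 1)) (Fin (d + 1)) ℝ} {p ℓ : ℝ}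
  {W : E d → ℝ} {DW : E d → E d}

theorem bnorm_smul {n : ℕ} (B : Matrix (Fin n) (Fin n) ℝ) (c : ℝ) (ξ : E n) :
    bnorm B (c • ξ) = |c| * bnorm B ξ := by
  have : form B (c • ξ) (c • ξ) = c ^ 2 * form B ξ ξ := by
    simp only [form, dotProduct, Matrix.mulVec, PiLp.smul_apply, smul_eq_mul, Finset.mul_sum,
      Finset.sum_mul]
    exact Finset.sum_congr rfl fun i _ => Finset.sum_congr rfl fun j _ => by ring
  rw [bnorm, this, Real.sqrt_mul (sq_nonneg c), Real.sqrt_sq_eq_abs, bnorm]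

/-- The trial functions `e^{-κ τ} (W + s e^{-τ} θ)`, `τ = x₁ + ℓ`. -/
theorem IsFirstEigenfunction.exists_trial (hp : 2 ≤ p) (hωo : IsOpen ω)
    (hωb : Bornology.IsBounded ω) (hA : IsAdmissible ω A) (hW : IsFirstEigenfunction p A ω W DW)
    {θ : E d → ℝ} (hθ : IsTest ω θ) :
    ∃ C, 0 ≤ C ∧ ∀ ℓ κ s : ℝ, |κ| ≤ 1 → |s| ≤ 1 →
      ∃ u G, MemVanishing p (cylinder ω ℓ) (strip ω) u G ∧
        IntegrableOn (fun t => Real.exp (-(p * κ) * (t + ℓ)) *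
          ∫ X in ω, |W X + s * Real.exp (-(t + ℓ)) * θ X| ^ p) (Set.Ioo (-ℓ) ℓ) ∧
        ∫ x in cylinder ω ℓ, |u x| ^ p = ∫ t in Set.Ioo (-ℓ) ℓ,
          Real.exp (-(p * κ) * (t + ℓ)) *
            ∫ X in ω, |W X + s * Real.exp (-(t + ℓ)) * θ X| ^ p ∧
        ∫ x in cylinder ω ℓ, bnorm (A (tail x)) (G x) ^ p ≤
          mu1 p A ω * (∫ x in cylinder ω ℓ, |u x| ^ p) +
          ∫ t in Set.Ioo (-ℓ) ℓ, Real.exp (-(p * κ) * (t + ℓ)) *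
            (-(p * κ * drift p A ω DW W) -
              p * (κ + 1) * (s * Real.exp (-(t + ℓ))) * drift p A ω DW θ +
              C * (κ ^ 2 + (s * Real.exp (-(t + ℓ))) ^ 2)) := by
  obtain ⟨C, hC0, hC⟩ := hW.exists_slice_energy_le hp hωo hωb hA hθ
  refine ⟨C, hC0, fun ℓ κ s hκ hs => ?_⟩
  have hf : ContDiff ℝ 1 fun t : ℝ => Real.exp (-κ * (t + ℓ)) := by fun_prop
  -- With `r = s e^{-τ}`, the longitudinal derivative of `e^{-κτ}(W + rθ)` is `e^{-κτ}(-κW - (κ+1)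
  -- rθ)`, the form required by `exists_slice_energy_le`.
  have hg : ContDiff ℝ 1 fun t : ℝ => s * Real.exp (-(κ + 1) * (t + ℓ)) := by fun_prop
  have hderiv : ∀ a t : ℝ, HasDerivAt (fun t : ℝ => Real.exp (a * (t + ℓ)))
      (a * Real.exp (a * (t + ℓ))) t := fun a t => by
    have := (((hasDerivAt_id t).add_const ℓ).const_mul a).exp
    simpa [mul_comm] using this
  have hf' : ∀ t, deriv (fun t : ℝ => Real.exp (-κ * (t + ℓ))) t =
      -κ * Real.exp (-κ * (t + ℓ)) := fun t => (hderiv _ t).deriv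
  have hg' : ∀ t, deriv (fun t : ℝ => s * Real.exp (-(κ + 1) * (t + ℓ))) t =
      s * (-(κ + 1) * Real.exp (-(κ + 1) * (t + ℓ))) := fun t => ((hderiv _ t).const_mul s).deriv
  have hexp : ∀ t : ℝ, Real.exp (-(κ + 1) * (t + ℓ)) =
      Real.exp (-κ * (t + ℓ)) * Real.exp (-(t + ℓ)) := fun t => by
    rw [← Real.exp_add]; ring_nf
  have hpow : ∀ t : ℝ, |Real.exp (-κ * (t + ℓ))| ^ p = Real.exp (-(p * κ) * (t + ℓ)) := fun t => by
    rw [abs_of_pos (Real.exp_pos _), ← Real.exp_mul]; ring_nf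
  have := isFiniteMeasure_cylinder hωb ℓ
  have : IsFiniteMeasure (volume.restrict ω) := isFiniteMeasure_restrict.2 hωb.measure_lt_top.ne
  have hV := MemVanishing.add_smul hp (isOpen_strip hωo)
    (memVanishing_tensor (ℓ := ℓ) hωo hωb hp hf hW.1.1)
    (memVanishing_tensor (ℓ := ℓ) hωo hωb hp hg (hθ.isC1Test.memVanishing hp hωo)) 1 1
  refine ⟨_, _, hV, ?_⟩
  simp only [hf', hg', one_mul, one_smul] at hV ⊢
  set u : E (d + 1) → ℝ := fun x => Real.exp (-κ * (x 0 + ℓ)) * W (tail x) +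
    s * Real.exp (-(κ + 1) * (x 0 + ℓ)) * θ (tail x) with hu
  set G : E (d + 1) → E (d + 1) := fun x =>
    consE (-κ * Real.exp (-κ * (x 0 + ℓ)) * W (tail x)) (Real.exp (-κ * (x 0 + ℓ)) • DW (tail x)) +
    consE (s * (-(κ + 1) * Real.exp (-(κ + 1) * (x 0 + ℓ))) * θ (tail x))
      ((s * Real.exp (-(κ + 1) * (x 0 + ℓ))) • gradient θ (tail x)) with hG
  have eu : ∀ t X, u (consE t X) =
      Real.exp (-κ * (t + ℓ)) * (W X + s * Real.exp (-(t + ℓ)) * θ X) := fun t X => by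
    simp only [hu, consE_zero, tail_consE, hexp]; ring
  have eG : ∀ t X, G (consE t X) = Real.exp (-κ * (t + ℓ)) •
      consE (-κ * W X - (κ + 1) * (s * Real.exp (-(t + ℓ))) * θ X)
        (DW X + (s * Real.exp (-(t + ℓ))) • gradient θ X) := fun t X => by
    simp only [hG, consE_zero, tail_consE, hexp]
    rw [← consE_add, ← consE_smul]
    congr 1
    · ring
    · rw [smul_add, smul_smul]; congr 2; ring
  obtain ⟨i1, e1⟩ := integral_cylinder hωo.measurableSet (integrable_abs_rpow hp hV.1.1)
  obtain ⟨i2, e2⟩ := integral_cylinder hωo.measurableSet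
    ((hA.elliptic.comp_tail hωo.measurableSet ℓ).integrable_bnorm_rpow hp hV.1.2.1)
  have s1 : ∀ t, ∫ X in ω, |u (consE t X)| ^ p = Real.exp (-(p * κ) * (t + ℓ)) *
      ∫ X in ω, |W X + s * Real.exp (-(t + ℓ)) * θ X| ^ p := fun t => by
    rw [← integral_const_mul]
    refine integral_congr_ae (Eventually.of_forall fun X => ?_)
    simp only
    rw [eu, abs_mul, Real.mul_rpow (abs_nonneg _) (abs_nonneg _), hpow]
  have s2 : ∀ t, ∫ X in ω, bnorm (A (tail (consE t X))) (G (consE t X)) ^ p =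
      Real.exp (-(p * κ) * (t + ℓ)) * ∫ X in ω, bnorm (A X)
        (consE (-κ * W X - (κ + 1) * (s * Real.exp (-(t + ℓ))) * θ X)
        (DW X + (s * Real.exp (-(t + ℓ))) • gradient θ X)) ^ p := fun t => by
    rw [← integral_const_mul]
    refine integral_congr_ae (Eventually.of_forall fun X => ?_)
    simp only
    rw [eG, tail_consE, bnorm_smul, Real.mul_rpow (abs_nonneg _) (bnorm_nonneg _ _), hpow]
  simp only [s1] at i1 e1
  simp only [s2] at i2 e2
  have i3 : IntegrableOn (fun t => Real.exp (-(p * κ) * (t + ℓ)) *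
      (-(p * κ * drift p A ω DW W) -
        p * (κ + 1) * (s * Real.exp (-(t + ℓ))) * drift p A ω DW θ +
        C * (κ ^ 2 + (s * Real.exp (-(t + ℓ))) ^ 2))) (Set.Ioo (-ℓ) ℓ) := by
    refine (Continuous.integrableOn_Icc ?_).mono_set Set.Ioo_subset_Icc_self
    fun_prop
  refine ⟨i1, e1, ?_⟩
  rw [e1, e2, ← integral_const_mul, ← integral_add (i1.const_mul _) i3]
  refine setIntegral_mono_on i2 ((i1.const_mul _).add i3) measurableSet_Ioo fun t ht => ?_
  have hr : |s * Real.exp (-(t + ℓ))| ≤ 1 := by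
    rw [abs_mul, abs_of_pos (Real.exp_pos _)]
    exact mul_le_one₀ hs (Real.exp_pos _).le (Real.exp_le_one_iff.2 (by linarith [ht.1]))
  have := mul_le_mul_of_nonneg_left (hC κ _ hκ hr) (Real.exp_pos (-(p * κ) * (t + ℓ))).le
  refine this.trans (le_of_eq ?_)
  ring

end Trial

/-! ### Energy gap -/

section Gap

variable {d : ℕ} {ω : Set (E d)} {A : E d → Matrix (Fin (d + 1)) (Fin (d + 1)) ℝ} {p ℓ : ℝ}
  {W : E d → ℝ} {DW : E d → E d}

/-- If the drift vanished on all test functions, its density would vanish almost everywhere. Where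
`ξ = 0` the factor `A₁₂·ξ` is zero anyway; elsewhere ellipticity makes the weight positive, so
`A₁₂·ξ` is zero there too. -/
theorem exists_drift_ne_zero (hp : 2 ≤ p) (hωo : IsOpen ω) (hωb : Bornology.IsBounded ω)
    (hA : IsAdmissible ω A) {ξ : E d → E d} (hξ : MemLp ξ (ENNReal.ofReal p) (volume.restrict ω))
    (h0 : ¬ ∀ᵐ X ∂(volume.restrict ω), A12dot A X (ξ X) = 0) :
    ∃ θ, IsTest ω θ ∧ drift p A ω ξ θ ≠ 0 := by
  have : IsFiniteMeasure (volume.restrict ω) := isFiniteMeasure_restrict.2 hωb.measure_lt_top.ne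
  by_contra! hcon
  refine h0 ?_
  set f : E d → ℝ := fun X => |form (A22 A X) (ξ X) (ξ X)| ^ ((p - 2) / 2) * A12dot A X (ξ X)
    with hf
  have hfi : IntegrableOn f ω := by
    have m0 : MemLp (fun X => consE 0 (ξ X)) (ENNReal.ofReal p) (volume.restrict ω) :=
      hξ.of_le (continuous_consE.comp_aestronglyMeasurable (aestronglyMeasurable_const.prodMk hξ.1))
        (Eventually.of_forall fun X => (norm_consE_zero _).le)
    refine (hA.elliptic.integrable_flux hp m0 (memLp_const (consE 1 0))).congr
      (Eventually.of_forall fun X => ?_)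
    simp only [flux_consE_zero, consE_zero, tail_consE, hf]
    simp [flux, form]
  have key : ∀ᵐ X, X ∈ ω → f X = 0 := by
    refine hωo.ae_eq_zero_of_integral_contDiff_smul_eq_zero hfi.locallyIntegrableOn ?_
    intro g hg hgc hgs
    rw [← setIntegral_eq_integral_of_forall_compl_eq_zero (s := ω), ← hcon g ⟨hg, hgc, hgs⟩, drift]
    · exact integral_congr_ae (Eventually.of_forall fun X => by simp [hf, mul_comm])
    · intro x hx
      rw [image_eq_zero_of_notMem_tsupport fun h => hx (hgs h), zero_smul]
  obtain ⟨-, c, K, hc, -, hS⟩ := hA.elliptic_A22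
  filter_upwards [(ae_restrict_iff' hωo.measurableSet).2 key, hS] with X hX ⟨S, hS⟩
  by_contra hne
  have h1 : ξ X ≠ 0 := fun h => hne (by simp [A12dot, h])
  have h2 : 0 < ‖S (ξ X)‖ := (mul_pos hc (norm_pos_iff.2 h1)).trans_le (hS.2 _).1
  have h3 : 0 < form (A22 A X) (ξ X) (ξ X) := by
    rw [hS.1, real_inner_self_eq_norm_sq]; positivity
  exact mul_ne_zero (by positivity) hne hX

theorem integral_exp_neg_mul {a : ℝ} (ha : a ≠ 0) (hℓ : 0 < ℓ) :
    ∫ t in Set.Ioo (-ℓ) ℓ, Real.exp (-a * (t + ℓ)) = (1 - Real.exp (-a * (2 * ℓ))) / a := by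
  rw [← integral_Ioc_eq_integral_Ioo, ← intervalIntegral.integral_of_le (by linarith),
    intervalIntegral.integral_eq_sub_of_hasDerivAt (f := fun t => -(Real.exp (-a * (t + ℓ)) / a))]
  · rw [← two_mul, neg_add_cancel, mul_zero, Real.exp_zero]; ring
  · intro t _
    have := ((((hasDerivAt_id t).add_const ℓ).const_mul (-a)).exp.div_const a).neg
    refine this.congr_deriv ?_
    simp only [id]
    field_simp
  · exact (by fun_prop : Continuous _).intervalIntegrable _ _

theorem integral_exp_neg_mul_le {a : ℝ} (ha : 0 < a) (hℓ : 0 < ℓ) :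
    ∫ t in Set.Ioo (-ℓ) ℓ, Real.exp (-a * (t + ℓ)) ≤ 1 / a := by
  rw [integral_exp_neg_mul ha.ne' hℓ]
  gcongr
  linarith [Real.exp_pos (-a * (2 * ℓ))]

theorem exists_small {a C : ℝ} (ha : 0 < a) (hC : 0 ≤ C) : ∃ k, 0 < k ∧ k ≤ 1 ∧ C * k ≤ a := by
  refine ⟨min 1 (a / (C + 1)), by positivity, min_le_left _ _, ?_⟩
  have h1 : C * min 1 (a / (C + 1)) ≤ (C + 1) * (a / (C + 1)) :=
    mul_le_mul (by linarith) (min_le_right _ _) (by positivity) (by positivity)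
  rwa [mul_div_cancel₀ _ (by positivity)] at h1

/-- With `s = 0` the trial function is `e^{-κτ}W`. Taking `κ` with the sign of the drift and `|κ| =
k`, the excess is `-pk|c| + Ck²` times the mass, at most `-kp|c|/2` times it. Excess and mass carry
the same weight, so neither the length nor the growth of the exponential matters. -/
theorem IsFirstEigenfunction.exists_lambdaM_le_sub_of_drift_ne_zero (hp : 2 ≤ p) (hωo : IsOpen ω)
    (hωb : Bornology.IsBounded ω) (hne : ω.Nonempty) (hA : IsAdmissible ω A)
    (hW : IsFirstEigenfunction p A ω W DW) (hc : drift p A ω DW W ≠ 0) {θ : E d → ℝ}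
    (hθ : IsTest ω θ) : ∃ δ, 0 < δ ∧ ∀ ℓ, 0 < ℓ → lambdaM p A ω ℓ ≤ mu1 p A ω - δ := by
  obtain ⟨C, hC0, hC⟩ := hW.exists_trial hp hωo hωb hA hθ
  set c := drift p A ω DW W
  have hc' : 0 < |c| := abs_pos.2 hc
  obtain ⟨k, hk0, hk1, hk⟩ := exists_small (a := p * |c| / 2) (by positivity) hC0
  refine ⟨k * (p * |c| / 2), by positivity, fun ℓ hℓ => ?_⟩
  have hsg : |SignType.sign c * k| = k := by
    rw [abs_mul, abs_of_pos hk0, ← one_mul k]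
    rcases lt_or_gt_of_ne hc with h | h <;> simp [h]
  obtain ⟨u, G, hV, hi, hM, hE⟩ := hC ℓ (SignType.sign c * k) 0 (hsg.le.trans hk1) (by simp)
  set κ : ℝ := SignType.sign c * k
  have hκc : κ * c = k * |c| := by
    rw [mul_right_comm, sign_mul_self]; ring
  have hκ2 : κ ^ 2 = k ^ 2 := by rw [← sq_abs, hsg]
  simp only [zero_mul, add_zero, hW.2.1, mul_one] at hM hi
  have hM0 : 0 < ∫ x in cylinder ω ℓ, |u x| ^ p := by
    rw [hM]
    have : NeZero (volume.restrict (Set.Ioo (-ℓ) ℓ)) := ⟨by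
      rw [Ne, Measure.restrict_eq_zero, Real.volume_Ioo, ENNReal.ofReal_eq_zero]; linarith⟩
    exact integral_exp_pos hi
  have h1 := ((lambdaM_spec hp hωo hωb hne hA hℓ).2.1 u G hV).trans hE
  simp only [zero_mul, mul_zero, sub_zero, ne_eq, OfNat.ofNat_ne_zero, not_false_eq_true,
    zero_pow, add_zero, integral_mul_const] at h1
  rw [← hM, mul_assoc p, hκc, hκ2] at h1
  refine le_of_mul_le_mul_right (h1.trans ?_) hM0
  have := mul_le_mul_of_nonneg_left (mul_le_mul_of_nonneg_left hk hk0.le) hM0.le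
  linarith

/-- The term linear in `κ` is absent, so the gain must come from `s e^{-τ}θ` near the end `τ = 0`.
It is at least `pk|β|g` with `k = |s|`, against the costs `Ck²` and `Cκ² ∫ e^{-pκτ} ≤ Cκ/p`. The
mass is bounded uniformly in `ℓ`, which makes this fixed gain a gap of the eigenvalue. -/
theorem IsFirstEigenfunction.exists_lambdaM_le_sub_of_drift_eq_zero (hp : 2 ≤ p) (hωo : IsOpen ω)
    (hωb : Bornology.IsBounded ω) (hne : ω.Nonempty) (hA : IsAdmissible ω A)
    (hW : IsFirstEigenfunction p A ω W DW) (hc : drift p A ω DW W = 0) {θ : E d → ℝ}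
    (hθ : IsTest ω θ) (hβ : drift p A ω DW θ ≠ 0) :
    ∃ δ, 0 < δ ∧ ∀ ℓ, 1 / 2 ≤ ℓ → lambdaM p A ω ℓ ≤ mu1 p A ω - δ := by
  have : IsFiniteMeasure (volume.restrict ω) := isFiniteMeasure_restrict.2 hωb.measure_lt_top.ne
  obtain ⟨C, hC0, hC⟩ := hW.exists_trial hp hωo hωb hA hθ
  rw [hc] at hC
  set β := drift p A ω DW θ
  have hβ' : 0 < |β| := abs_pos.2 hβ
  have hp0 : 0 < p := by linarith
  -- `g` is the integral of `e^{-(p+1)τ}` over `0 < τ < 1`, a part of the cylinder as soon as `2ℓ ≥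
  -- 1`.
  set g : ℝ := (1 - Real.exp (-(p + 1))) / (p + 1) with hg
  have hg0 : 0 < g := div_pos (by
    rw [sub_pos, Real.exp_lt_one_iff]; linarith) (by linarith)
  -- This `k` spends half of the gain on the cost quadratic in `s`; the other half is `2D`. Then `κ`
  -- is chosen so that its cost is at most `D`, leaving `-D`.
  obtain ⟨k, hk0, hk1, hk⟩ := exists_small (a := p * |β| * g / 2) (by positivity) hC0
  set D : ℝ := k * (p * |β| * g / 4) with hD
  have hD0 : 0 < D := by positivity
  obtain ⟨κ, hκ0, hκ1, hκ⟩ := exists_small (a := p * D) (by positivity) hC0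
  set s : ℝ := SignType.sign β * k
  have hsk : |s| = k := by
    rw [abs_mul, abs_of_pos hk0, ← one_mul k]
    rcases lt_or_gt_of_ne hβ with h | h <;> simp [h]
  have hsβ : s * β = k * |β| := by
    rw [mul_right_comm, sign_mul_self]; ring
  have hs2 : s ^ 2 = k ^ 2 := by rw [← sq_abs, hsk]
  have mW := hW.1.1.1.1
  have mθ : MemLp θ (ENNReal.ofReal p) (volume.restrict ω) := hθ.isC1Test.memLp _ _
  set C1 : ℝ := ∫ X in ω, |(|W X| + |θ X|)| ^ p
  have hC1 : 0 ≤ C1 := integral_nonneg fun X => by positivity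
  set Mb : ℝ := (C1 + 1) / (p * κ) with hMb
  have hMb0 : 0 < Mb := by positivity
  refine ⟨D / Mb, by positivity, fun ℓ hℓ => ?_⟩
  have hℓ0 : 0 < ℓ := by linarith
  obtain ⟨u, G, hV, hi, hM, hE⟩ := hC ℓ κ s (by rwa [abs_of_pos hκ0]) (hsk.le.trans hk1)
  have hcont : ∀ a : ℝ, IntegrableOn (fun t => Real.exp (-a * (t + ℓ))) (Set.Ioo (-ℓ) ℓ) :=
    fun a => (Continuous.integrableOn_Icc (by fun_prop)).mono_set Set.Ioo_subset_Icc_self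
  have hMle : ∫ x in cylinder ω ℓ, |u x| ^ p ≤ Mb := by
    rw [hM]
    have h1 : ∫ t in Set.Ioo (-ℓ) ℓ, Real.exp (-(p * κ) * (t + ℓ)) *
        ∫ X in ω, |W X + s * Real.exp (-(t + ℓ)) * θ X| ^ p ≤
        ∫ t in Set.Ioo (-ℓ) ℓ, Real.exp (-(p * κ) * (t + ℓ)) * (C1 + 1) := by
      refine setIntegral_mono_on hi ((hcont _).mul_const _) measurableSet_Ioo fun t ht => ?_
      refine mul_le_mul_of_nonneg_left ?_ (Real.exp_pos _).le
      have hr : |s * Real.exp (-(t + ℓ))| ≤ 1 := by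
        rw [abs_mul, abs_of_pos (Real.exp_pos _), hsk]
        exact mul_le_one₀ hk1 (Real.exp_pos _).le (Real.exp_le_one_iff.2 (by linarith [ht.1]))
      refine le_trans (integral_mono (integrable_abs_rpow hp (mW.add (mθ.const_mul _)))
        (integrable_abs_rpow hp (mW.norm.add mθ.norm)) fun X => ?_) (by linarith : C1 ≤ C1 + 1)
      refine Real.rpow_le_rpow (abs_nonneg _) ?_ hp0.le
      refine (abs_add_le _ _).trans (le_trans ?_ (le_abs_self _))
      rw [abs_mul]
      exact add_le_add le_rfl (mul_le_of_le_one_left (abs_nonneg _) hr)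
    rw [integral_mul_const] at h1
    have h2 := mul_le_mul_of_nonneg_right
      (integral_exp_neg_mul_le (mul_pos hp0 hκ0) hℓ0) (by linarith : 0 ≤ C1 + 1)
    refine h1.trans (h2.trans (le_of_eq ?_))
    rw [hMb]; ring
  have hrem : ∫ t in Set.Ioo (-ℓ) ℓ, Real.exp (-(p * κ) * (t + ℓ)) *
      (-(p * κ * 0) - p * (κ + 1) * (s * Real.exp (-(t + ℓ))) * β +
        C * (κ ^ 2 + (s * Real.exp (-(t + ℓ))) ^ 2)) ≤ -D := by
    have h1 : ∀ t ∈ Set.Ioo (-ℓ) ℓ, Real.exp (-(p * κ) * (t + ℓ)) *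
        (-(p * κ * 0) - p * (κ + 1) * (s * Real.exp (-(t + ℓ))) * β +
          C * (κ ^ 2 + (s * Real.exp (-(t + ℓ))) ^ 2)) ≤
        -(p * k * |β|) * Real.exp (-(p + 1) * (t + ℓ)) +
          C * κ ^ 2 * Real.exp (-(p * κ) * (t + ℓ)) + C * k ^ 2 * Real.exp (-1 * (t + ℓ)) := by
      intro t ht
      have hτ : 0 < t + ℓ := by linarith [ht.1]
      set a := Real.exp (-(p * κ) * (t + ℓ)) with ha
      have ha0 : 0 < a := Real.exp_pos _
      have ha1 : a ≤ 1 := Real.exp_le_one_iff.2 (by nlinarith [mul_pos (mul_pos hp0 hκ0) hτ])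
      -- As `κ ≤ 1`, the gain can be bounded below with the weight `e^{-pτ}`; hence `D` does not
      -- depend on `κ`, which is chosen after it.
      have hap : Real.exp (-p * (t + ℓ)) ≤ a := Real.exp_le_exp.2 (by
        have := mul_le_mul_of_nonneg_right (mul_le_mul_of_nonneg_left hκ1 hp0.le) hτ.le
        linarith)
      have he : Real.exp (-1 * (t + ℓ)) = Real.exp (-(t + ℓ)) := by ring_nf
      set e := Real.exp (-(t + ℓ)) with he'
      have he0 : 0 < e := Real.exp_pos _
      have he1 : e ≤ 1 := Real.exp_le_one_iff.2 (by linarith)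
      have hpe : Real.exp (-(p + 1) * (t + ℓ)) = Real.exp (-p * (t + ℓ)) * e := by
        rw [he', ← Real.exp_add]; ring_nf
      rw [he, hpe]
      have b1 : p * k * |β| * (Real.exp (-p * (t + ℓ)) * e) ≤
          p * k * |β| * ((κ + 1) * (a * e)) := by
        refine mul_le_mul_of_nonneg_left ?_ (by positivity)
        have := mul_le_mul_of_nonneg_right hap he0.le
        have h2 : 0 ≤ κ * (a * e) := by positivity
        linarith
      have b2 : C * k ^ 2 * (a * e ^ 2) ≤ C * k ^ 2 * e := by
        refine mul_le_mul_of_nonneg_left ?_ (by positivity)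
        calc a * e ^ 2 ≤ 1 * (e * 1) := by
              rw [sq]
              exact mul_le_mul ha1 (mul_le_mul_of_nonneg_left he1 he0.le) (by positivity) zero_le_one
          _ = e := by ring
      have b3 : a * (-(p * κ * 0) - p * (κ + 1) * (s * e) * β + C * (κ ^ 2 + (s * e) ^ 2)) =
          -(p * k * |β| * ((κ + 1) * (a * e))) + C * κ ^ 2 * a + C * k ^ 2 * (a * e ^ 2) := by
        rw [mul_pow, hs2]
        linear_combination (-(a * p * (κ + 1) * e)) * hsβ
      rw [b3]
      linarith
    refine (setIntegral_mono_on ?_ ((((hcont _).const_mul _).add ((hcont _).const_mul _)).add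
      ((hcont _).const_mul _)) measurableSet_Ioo h1).trans ?_
    · exact (Continuous.integrableOn_Icc (by fun_prop)).mono_set Set.Ioo_subset_Icc_self
    · rw [integral_add' (((hcont _).const_mul _).add ((hcont _).const_mul _))
        ((hcont _).const_mul _), integral_add' ((hcont _).const_mul _) ((hcont _).const_mul _),
        integral_const_mul, integral_const_mul, integral_const_mul]
      have j1 := integral_exp_neg_mul_le (mul_pos hp0 hκ0) hℓ0
      have j2 := integral_exp_neg_mul_le one_pos hℓ0
      have j3 : g ≤ ∫ t in Set.Ioo (-ℓ) ℓ, Real.exp (-(p + 1) * (t + ℓ)) := by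
        rw [integral_exp_neg_mul (by positivity) hℓ0, hg]
        gcongr
        nlinarith
      have k1 := mul_le_mul_of_nonneg_left j1 (by positivity : 0 ≤ C * κ ^ 2)
      have k2 := mul_le_mul_of_nonneg_left j2 (by positivity : 0 ≤ C * k ^ 2)
      have k3 := mul_le_mul_of_nonneg_left j3 (by positivity : 0 ≤ p * k * |β|)
      have k4 : C * κ ^ 2 * (1 / (p * κ)) ≤ D := by
        have : C * κ ^ 2 * (1 / (p * κ)) = C * κ / p := by field_simp
        rw [this, div_le_iff₀ hp0]
        linarith
      have k5 := mul_le_mul_of_nonneg_left hk hk0.le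
      rw [hD] at k4 ⊢
      linarith
  have h1 := ((lambdaM_spec hp hωo hωb hne hA hℓ0).2.1 u G hV).trans
    (hE.trans (add_le_add le_rfl hrem))
  have hM0 : 0 ≤ ∫ x in cylinder ω ℓ, |u x| ^ p := integral_nonneg fun x => by positivity
  -- The excess is at most `-D` and the mass at most `Mb`, so the quotient lies at least `D / Mb`
  -- below `μ₁`; zero mass is impossible because the excess is negative.
  by_contra! hlt
  have h2 := mul_le_mul_of_nonneg_right hlt.le hM0
  rcases hM0.eq_or_lt with h | h
  · rw [← h] at h1; linarith
  · have h3 := mul_lt_mul_of_pos_right hlt h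
    have h4 : D / Mb * (∫ x in cylinder ω ℓ, |u x| ^ p) ≤ D := by
      rw [div_mul_eq_mul_div, div_le_iff₀ hMb0]
      exact mul_le_mul_of_nonneg_left hMle hD0.le
    linarith

theorem IsFirstEigenfunction.limsup_lambdaM_lt (hp : 2 ≤ p) (hωo : IsOpen ω)
    (hωb : Bornology.IsBounded ω) (hne : ω.Nonempty) (hA : IsAdmissible ω A)
    (hW : IsFirstEigenfunction p A ω W DW)
    (h0 : ¬ ∀ᵐ X ∂(volume.restrict ω), A12dot A X (DW X) = 0) :
    limsup (fun ℓ : ℝ => ((lambdaM p A ω ℓ : ℝ) : EReal)) atTop < ((mu1 p A ω : ℝ) : EReal) := by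
  obtain ⟨θ, hθ, hβ⟩ := exists_drift_ne_zero hp hωo hωb hA hW.1.1.1.2.1 h0
  obtain ⟨δ, hδ, h⟩ : ∃ δ, 0 < δ ∧ ∀ ℓ, 1 / 2 ≤ ℓ → lambdaM p A ω ℓ ≤ mu1 p A ω - δ := by
    by_cases hc : drift p A ω DW W = 0
    · exact hW.exists_lambdaM_le_sub_of_drift_eq_zero hp hωo hωb hne hA hc hθ hβ
    · obtain ⟨δ, hδ, h⟩ :=
        hW.exists_lambdaM_le_sub_of_drift_ne_zero hp hωo hωb hne hA hc hθ
      exact ⟨δ, hδ, fun ℓ hℓ => h ℓ (by linarith)⟩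
  refine lt_of_le_of_lt (b := ((mu1 p A ω - δ : ℝ) : EReal)) ?_
    (EReal.coe_lt_coe_iff.2 (by linarith))
  refine limsup_le_of_le (by isBoundedDefault) ?_
  filter_upwards [eventually_ge_atTop (1 / 2 : ℝ)] with ℓ hℓ
  exact EReal.coe_le_coe_iff.2 (h ℓ hℓ)

end Gap

/-! ### Chain rule in the closure of the test functions -/

section ChainRule

variable {n : ℕ} {p : ℝ} {Ω U : Set (E n)} {u : E n → ℝ} {G : E n → E n}

/-- Approximation by test functions that also converge almost everywhere. -/
theorem MemVanishing.exists_seq_tendsto_ae (hp : 2 ≤ p) (h : MemVanishing p Ω U u G) :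
    ∃ φ : ℕ → E n → ℝ, (∀ k, IsTest U (φ k)) ∧
      Tendsto (fun k => eLpNorm (fun x => u x - φ k x) (ENNReal.ofReal p) (volume.restrict Ω))
        atTop (𝓝 0) ∧
      Tendsto (fun k => eLpNorm (fun x => G x - gradient (φ k) x) (ENNReal.ofReal p)
        (volume.restrict Ω)) atTop (𝓝 0) ∧
      ∀ᵐ x ∂(volume.restrict Ω), Tendsto (fun k => φ k x) atTop (𝓝 (u x)) := by
  obtain ⟨⟨hu, -, -⟩, φ, hφ, h1, h2⟩ := h
  have hm : TendstoInMeasure (volume.restrict Ω) φ atTop u := by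
    refine tendstoInMeasure_of_tendsto_eLpNorm (ofReal_ne_zero_of_two_le hp)
      (fun k => (hφ k).1.continuous.aestronglyMeasurable) hu.1 ?_
    refine h1.congr fun k => ?_
    rw [eLpNorm_sub_comm]; rfl
  obtain ⟨ns, hns, hae⟩ := hm.exists_seq_tendsto_ae
  exact ⟨fun k => φ (ns k), fun k => hφ _, h1.comp hns.tendsto_atTop,
    h2.comp hns.tendsto_atTop, hae⟩

theorem tendsto_eLpNorm_of_forall_le_mul {α F : Type*} [MeasurableSpace α] {m : Measure α}
    [NormedAddCommGroup F] {q : ℝ≥0∞} {f : ℕ → α → F} {g : ℕ → α → ℝ} {C : ℝ}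
    (h : ∀ k, ∀ᵐ x ∂m, ‖f k x‖ ≤ C * ‖g k x‖)
    (hg : Tendsto (fun k => eLpNorm (g k) q m) atTop (𝓝 0)) :
    Tendsto (fun k => eLpNorm (f k) q m) atTop (𝓝 0) := by
  have t := ENNReal.Tendsto.const_mul (a := ENNReal.ofReal C) hg (Or.inr ENNReal.ofReal_ne_top)
  rw [mul_zero] at t
  exact tendsto_of_tendsto_of_tendsto_of_le_of_le tendsto_const_nhds t (fun _ => zero_le)
    fun k => eLpNorm_le_mul_eLpNorm_of_ae_le_mul (h k) _

theorem tendsto_eLpNorm_smul_of_bounded {α F : Type*} [MeasurableSpace α] {m : Measure α}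
    [NormedAddCommGroup F] [NormedSpace ℝ F] (hp : 2 ≤ p) {a : ℕ → α → ℝ} {C : ℝ} {g : α → F}
    (ham : ∀ k, AEStronglyMeasurable (a k) m) (ha : ∀ k, ∀ᵐ x ∂m, |a k x| ≤ C)
    (hg : MemLp g (ENNReal.ofReal p) m) (hlim : ∀ᵐ x ∂m, Tendsto (fun k => a k x) atTop (𝓝 0)) :
    Tendsto (fun k => eLpNorm (fun x => a k x • g x) (ENNReal.ofReal p) m) atTop (𝓝 0) := by
  have hp0 : 0 < p := by linarith
  have h1 : Tendsto (fun k => ∫⁻ x, ‖a k x • g x‖ₑ ^ p ∂m) atTop (𝓝 (∫⁻ _, 0 ∂m)) := by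
    refine tendsto_lintegral_of_dominated_convergence'
      (fun x => ENNReal.ofReal |C| ^ p * ‖g x‖ₑ ^ p)
      (fun k => ((ham k).smul hg.1).enorm.pow_const _) (fun k => ?_) ?_ ?_
    · filter_upwards [ha k] with x hx
      rw [enorm_smul, ENNReal.mul_rpow_of_nonneg _ _ hp0.le]
      gcongr
      rw [Real.enorm_eq_ofReal_abs]
      exact ENNReal.ofReal_le_ofReal (hx.trans (le_abs_self _))
    · rw [lintegral_const_mul'' _ (hg.1.enorm.pow_const _), lintegral_enorm_rpow_eq_ofReal hp hg]
      exact ENNReal.mul_ne_top (ENNReal.rpow_ne_top_of_nonneg hp0.le ENNReal.ofReal_ne_top)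
        ENNReal.ofReal_ne_top
    · filter_upwards [hlim] with x hx
      have h2 : Tendsto (fun k => a k x • g x) atTop (𝓝 (0 : F)) := by
        simpa using hx.smul_const (g x)
      have h3 := (ENNReal.continuous_rpow_const (y := p)).tendsto _ |>.comp h2.enorm
      simpa [hp0, Function.comp_def] using h3
  rw [lintegral_zero] at h1
  have h2 := (ENNReal.continuous_rpow_const (y := 1 / p)).tendsto _ |>.comp h1
  simp only [one_div, inv_pos, hp0, ENNReal.zero_rpow_of_pos] at h2
  refine h2.congr fun k => ?_
  rw [eLpNorm_eq_lintegral_rpow_enorm_toReal (ofReal_ne_zero_of_two_le hp) ENNReal.ofReal_ne_top,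
    toReal_ofReal_of_two_le hp, one_div]
  rfl

/-- If `φ k → u` almost everywhere and `∇ φ k → G` in `L^p`, then `b (φ k) ∇ φ k → b (u) G`
in `L^p` for bounded continuous `b`. -/
theorem tendsto_eLpNorm_comp_smul_sub {α F : Type*} [MeasurableSpace α] {m : Measure α}
    [NormedAddCommGroup F] [NormedSpace ℝ F] (hp : 2 ≤ p) {b : ℝ → ℝ} (hb : Continuous b) {L : ℝ}
    (hL : ∀ s, |b s| ≤ L) {v : α → ℝ} {H : α → F} {f : ℕ → α → ℝ} {g : ℕ → α → F}
    (hv : AEStronglyMeasurable v m) (hf : ∀ k, AEStronglyMeasurable (f k) m)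
    (hH : MemLp H (ENNReal.ofReal p) m) (hg : ∀ k, AEStronglyMeasurable (g k) m)
    (h1 : ∀ᵐ x ∂m, Tendsto (fun k => f k x) atTop (𝓝 (v x)))
    (h2 : Tendsto (fun k => eLpNorm (fun x => H x - g k x) (ENNReal.ofReal p) m) atTop (𝓝 0)) :
    Tendsto (fun k => eLpNorm (fun x => b (v x) • H x - b (f k x) • g k x) (ENNReal.ofReal p) m)
      atTop (𝓝 0) := by
  have hbf : ∀ k, AEStronglyMeasurable (fun x => b (f k x)) m :=
    fun k => hb.comp_aestronglyMeasurable (hf k)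
  have hbv := hb.comp_aestronglyMeasurable hv
  have t1 := tendsto_eLpNorm_smul_of_bounded (m := m) hp (a := fun k x => b (v x) - b (f k x))
    (C := L + L) (fun k => hbv.sub (hbf k)) (fun k => Eventually.of_forall fun x =>
      (abs_sub _ _).trans (add_le_add (hL _) (hL _))) hH (by
      filter_upwards [h1] with x hx
      have := ((hb.tendsto _).comp hx).const_sub (b (v x))
      simpa using this)
  have t2 : Tendsto (fun k => eLpNorm (fun x => b (f k x) • (H x - g k x)) (ENNReal.ofReal p) m)
      atTop (𝓝 0) := by
    refine tendsto_eLpNorm_of_forall_le_mul (C := L) (g := fun k x => ‖H x - g k x‖)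
      (fun k => Eventually.of_forall fun x => ?_) (by simpa only [eLpNorm_norm] using h2)
    rw [norm_smul, norm_norm]
    exact mul_le_mul_of_nonneg_right (hL _) (norm_nonneg _)
  have t := t1.add t2
  rw [add_zero] at t
  refine tendsto_of_tendsto_of_tendsto_of_le_of_le tendsto_const_nhds t (fun _ => zero_le)
    fun k => ?_
  refine le_trans (le_of_eq ?_) (eLpNorm_add_le (((hbv.sub (hbf k)).smul hH.1))
    ((hbf k).smul (hH.1.sub (hg k))) (one_le_ofReal_of_two_le hp))
  congr 1
  ext x
  simp only [Pi.add_apply]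
  rw [sub_smul, smul_sub]; abel

theorem IsC1Test.mul_comp {ψ φ : E n → ℝ} (hψ : IsC1Test U ψ) {h : ℝ → ℝ} (hh : ContDiff ℝ 1 h)
    (hφ : ContDiff ℝ 1 φ) : IsC1Test U fun x => ψ x * h (φ x) :=
  ⟨hψ.1.mul (hh.comp hφ), hψ.2.1.mul_right,
    (closure_mono fun _ hx => left_ne_zero_of_mul hx).trans hψ.2.2⟩

theorem gradient_comp {φ : E n → ℝ} {h : ℝ → ℝ} (hh : Differentiable ℝ h)
    (hφ : Differentiable ℝ φ) (x : E n) :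
    gradient (fun x => h (φ x)) x = deriv h (φ x) • gradient φ x := by
  refine gradient_eq_of_hasFDerivAt ?_
  have := (hh (φ x)).hasDerivAt.comp_hasFDerivAt x (hφ x).hasGradientAt.hasFDerivAt
  rwa [map_smul]

theorem gradient_mul {φ ψ : E n → ℝ} (hφ : Differentiable ℝ φ) (hψ : Differentiable ℝ ψ)
    (x : E n) :
    gradient (fun x => φ x * ψ x) x = φ x • gradient ψ x + ψ x • gradient φ x := by
  refine gradient_eq_of_hasFDerivAt ?_
  have := (hφ x).hasGradientAt.hasFDerivAt.mul (hψ x).hasGradientAt.hasFDerivAt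
  rwa [map_add, map_smul, map_smul]

theorem abs_sub_le_of_deriv_le {h : ℝ → ℝ} (hh : Differentiable ℝ h) {L : ℝ}
    (hL : ∀ s, |deriv h s| ≤ L) (a b : ℝ) : |h a - h b| ≤ L * |a - b| :=
  Convex.norm_image_sub_le_of_norm_deriv_le (fun x _ => hh x) (fun _ _ => hL _) convex_univ
    (Set.mem_univ b) (Set.mem_univ a)

/-- Chain and product rule in the closure of the test functions. -/
theorem MemVanishing.mul_comp [IsFiniteMeasure (volume.restrict Ω)] (hp : 2 ≤ p) (hU : IsOpen U)
    (hu : MemVanishing p Ω U u G) {ψ : E n → ℝ} (hψ : IsC1Test U ψ) {h : ℝ → ℝ}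
    (hh : ContDiff ℝ 1 h) {L : ℝ} (hL : ∀ s, |deriv h s| ≤ L) :
    MemVanishing p Ω U (fun x => ψ x * h (u x))
      (fun x => ψ x • deriv h (u x) • G x + h (u x) • gradient ψ x) := by
  obtain ⟨φ, hφ, h1, h2, h3⟩ := hu.exists_seq_tendsto_ae hp
  have hd := hh.differentiable (by simp)
  have hlip := abs_sub_le_of_deriv_le hd hL
  have hbound : ∀ {F : Type} [NormedAddCommGroup F] (f : E n → F), Continuous f →
      HasCompactSupport f → ∃ C, ∀ x, ‖f x‖ ≤ C := fun f hf hc => by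
    obtain ⟨C, hC⟩ := hf.bounded_above_of_compact_support hc
    exact ⟨C, hC⟩
  obtain ⟨C1, hC1⟩ := hbound ψ hψ.1.continuous hψ.2.1
  obtain ⟨C2, hC2⟩ := hbound (gradient ψ) (continuous_gradient hψ.1) hψ.hasCompactSupport_gradient
  have hL0 : 0 ≤ L := (abs_nonneg _).trans (hL 0)
  have mu := hu.1.1
  have mG := hu.1.2.1
  have mφ : ∀ k, AEStronglyMeasurable (φ k) (volume.restrict Ω) :=
    fun k => (hφ k).1.continuous.aestronglyMeasurable
  have mgφ : ∀ k, AEStronglyMeasurable (gradient (φ k)) (volume.restrict Ω) :=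
    fun k => (continuous_gradient (hφ k).isC1Test.1).aestronglyMeasurable
  have mh : MemLp (fun x => h (u x)) (ENNReal.ofReal p) (volume.restrict Ω) := by
    refine ((memLp_const |h 0|).add (mu.norm.const_mul L)).of_le
      (hh.continuous.comp_aestronglyMeasurable mu.1) (Eventually.of_forall fun x => ?_)
    refine le_trans ?_ (le_abs_self _)
    have := hlip (u x) 0
    rw [sub_zero] at this
    have h5 := abs_sub_abs_le_abs_sub (h (u x)) (h 0)
    simp only [Pi.add_apply, Real.norm_eq_abs]
    linarith
  have m1 : MemLp (fun x => deriv h (u x) • G x) (ENNReal.ofReal p) (volume.restrict Ω) := by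
    refine mG.of_le_mul (c := L)
      (((hh.continuous_deriv le_rfl).comp_aestronglyMeasurable mu.1).smul mG.1)
      (Eventually.of_forall fun x => ?_)
    rw [norm_smul]
    exact mul_le_mul_of_nonneg_right (hL _) (norm_nonneg _)
  have m2 : MemLp (fun x => ψ x • deriv h (u x) • G x) (ENNReal.ofReal p) (volume.restrict Ω) := by
    refine m1.of_le_mul (c := C1) (hψ.1.continuous.aestronglyMeasurable.smul m1.1)
      (Eventually.of_forall fun x => ?_)
    rw [norm_smul]
    exact mul_le_mul_of_nonneg_right (hC1 _) (norm_nonneg _)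
  have m3 : MemLp (fun x => h (u x) • gradient ψ x) (ENNReal.ofReal p) (volume.restrict Ω) := by
    refine mh.of_le_mul (c := C2) (mh.1.smul (continuous_gradient hψ.1).aestronglyMeasurable)
      (Eventually.of_forall fun x => ?_)
    rw [norm_smul, mul_comm]
    exact mul_le_mul_of_nonneg_right (hC2 _) (norm_nonneg _)
  have m4 : MemLp (fun x => ψ x * h (u x)) (ENNReal.ofReal p) (volume.restrict Ω) := by
    refine mh.of_le_mul (c := C1) (hψ.1.continuous.aestronglyMeasurable.mul mh.1)
      (Eventually.of_forall fun x => ?_)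
    rw [norm_mul]
    exact mul_le_mul_of_nonneg_right (hC1 _) (norm_nonneg _)
  -- The approximants `ψ h(φₖ)` get compact support from `ψ`, so `h` need not vanish at `0`. Almost
  -- everywhere convergence of `φₖ` handles the factor `h'(φₖ)`, for which only continuity and
  -- boundedness are known.
  refine memVanishing_of_tendsto hp hU m4 (m2.add m3)
    (φ := fun k x => ψ x * h (φ k x)) (fun k => hψ.mul_comp hh (hφ k).isC1Test.1) ?_ ?_
  · refine tendsto_eLpNorm_of_forall_le_mul (C := C1 * L) (g := fun k x => u x - φ k x)
      (fun k => Eventually.of_forall fun x => ?_) h1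
    rw [← mul_sub, norm_mul, mul_assoc]
    exact mul_le_mul (hC1 _) (hlip _ _) (norm_nonneg _) ((norm_nonneg _).trans (hC1 x))
  · have t1 : Tendsto (fun k => eLpNorm (fun x => ψ x • (deriv h (u x) • G x -
        deriv h (φ k x) • gradient (φ k) x)) (ENNReal.ofReal p) (volume.restrict Ω))
        atTop (𝓝 0) := by
      refine tendsto_eLpNorm_of_forall_le_mul (C := C1)
        (g := fun k x => ‖deriv h (u x) • G x - deriv h (φ k x) • gradient (φ k) x‖)
        (fun k => Eventually.of_forall fun x => ?_) ?_
      · rw [norm_smul, norm_norm]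
        exact mul_le_mul_of_nonneg_right (hC1 _) (norm_nonneg _)
      · simpa only [eLpNorm_norm] using tendsto_eLpNorm_comp_smul_sub hp
          (hh.continuous_deriv le_rfl) hL mu.1 mφ mG mgφ h3 h2
    have t2 : Tendsto (fun k => eLpNorm (fun x => (h (u x) - h (φ k x)) • gradient ψ x)
        (ENNReal.ofReal p) (volume.restrict Ω)) atTop (𝓝 0) := by
      refine tendsto_eLpNorm_of_forall_le_mul (C := C2 * L) (g := fun k x => u x - φ k x)
        (fun k => Eventually.of_forall fun x => ?_) h1
      rw [norm_smul, mul_comm, mul_assoc]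
      exact mul_le_mul (hC2 _) (hlip _ _) (norm_nonneg _) ((norm_nonneg _).trans (hC2 x))
    have t := t1.add t2
    rw [add_zero] at t
    refine tendsto_of_tendsto_of_tendsto_of_le_of_le tendsto_const_nhds t (fun _ => zero_le)
      fun k => ?_
    have mdk : AEStronglyMeasurable (fun x => deriv h (φ k x) • gradient (φ k) x)
        (volume.restrict Ω) :=
      ((hh.continuous_deriv le_rfl).comp_aestronglyMeasurable (mφ k)).smul (mgφ k)
    refine le_trans (le_of_eq ?_) (eLpNorm_add_le
      (hψ.1.continuous.aestronglyMeasurable.smul (m1.1.sub mdk))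
      ((mh.1.sub (hh.continuous.comp_aestronglyMeasurable (mφ k))).smul
        (continuous_gradient hψ.1).aestronglyMeasurable) (one_le_ofReal_of_two_le hp))
    congr 1
    ext1 x
    simp only [Pi.add_apply]
    rw [gradient_mul (ψ := fun x => h (φ k x)) (hψ.1.differentiable (by simp))
      (hd.comp ((hφ k).isC1Test.1.differentiable (by simp))),
      gradient_comp hd ((hφ k).isC1Test.1.differentiable (by simp)), smul_sub, sub_smul]
    abel

end ChainRule

/-! ### Picone's inequality -/

section Picone

/-- Eigenfunctions to which this applies are nonnegative, so only values on `[0, ∞)` matter.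
Freezing the derivative at its value at `0` for negative arguments avoids the singularity of powers
and logarithms and keeps the bound global. -/
theorem exists_contDiff_extension {f f' : ℝ → ℝ} {L : ℝ}
    (hf : ∀ s, 0 ≤ s → HasDerivAt f (f' s) s) (hc : ContinuousOn f' (Set.Ici 0))
    (hL : ∀ s, 0 ≤ s → |f' s| ≤ L) :
    ∃ h : ℝ → ℝ, ContDiff ℝ 1 h ∧ (∀ s, |deriv h s| ≤ L) ∧
      ∀ s, 0 ≤ s → h s = f s ∧ deriv h s = f' s := by
  have hk : Continuous fun t : ℝ => f' (max t 0) :=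
    hc.comp_continuous (by fun_prop) fun t => Set.mem_Ici.2 (le_max_right _ _)
  have hd : ∀ s, HasDerivAt (fun s => f 0 + ∫ t in (0 : ℝ)..s, f' (max t 0)) (f' (max s 0)) s :=
    fun s => (intervalIntegral.integral_hasDerivAt_right (hk.intervalIntegrable _ _)
      (hk.stronglyMeasurableAtFilter _ _) hk.continuousAt).const_add _
  refine ⟨_, contDiff_one_iff_deriv.2 ⟨fun s => (hd s).differentiableAt, ?_⟩, fun s => ?_,
    fun s hs => ⟨?_, ?_⟩⟩
  · exact hk.congr fun s => (hd s).deriv.symm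
  · rw [(hd s).deriv]
    exact hL _ (le_max_right _ _)
  · rw [intervalIntegral.integral_congr (g := f') fun t ht => ?_,
      intervalIntegral.integral_eq_sub_of_hasDerivAt (f := f) (f' := f')]
    · ring
    · intro t ht
      rw [Set.uIcc_of_le hs] at ht
      exact hf t ht.1
    · refine (hc.mono fun t ht => ?_).intervalIntegrable
      rw [Set.uIcc_of_le hs] at ht
      exact ht.1
    · rw [Set.uIcc_of_le hs] at ht
      simp only [max_eq_left ht.1]
  · rw [(hd s).deriv, max_eq_left hs]

theorem exists_contDiff_rpow {p ε : ℝ} (hp : 2 ≤ p) (hε : 0 < ε) :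
    ∃ (h : ℝ → ℝ) (L : ℝ), ContDiff ℝ 1 h ∧ (∀ s, |deriv h s| ≤ L) ∧
      ∀ s, 0 ≤ s → h s = (s + ε) ^ (1 - p) ∧ deriv h s = -((p - 1) * (s + ε) ^ (-p)) := by
  have h1 : ∀ s, 0 ≤ s → HasDerivAt (fun s => (s + ε) ^ (1 - p))
      (-((p - 1) * (s + ε) ^ (-p))) s := fun s hs => by
    have := ((hasDerivAt_id s).add_const ε).rpow_const (p := 1 - p)
      (Or.inl (by simp only [id]; linarith))
    refine this.congr_deriv ?_
    simp only [id]
    rw [show 1 - p - 1 = -p by ring]; ring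
  have h2 : ContinuousOn (fun s => -((p - 1) * (s + ε) ^ (-p))) (Set.Ici 0) := by
    refine ((continuousOn_const.mul ((continuousOn_id.add continuousOn_const).rpow_const
      fun s hs => Or.inl ?_))).neg
    have : 0 ≤ s := hs
    exact (show 0 < s + ε by positivity).ne'
  have h3 : ∀ s, 0 ≤ s → |-((p - 1) * (s + ε) ^ (-p))| ≤ (p - 1) * ε ^ (-p) := fun s hs => by
    rw [abs_neg, abs_of_nonneg (mul_nonneg (by linarith) (Real.rpow_nonneg (by linarith) _))]
    exact mul_le_mul_of_nonneg_left
      (Real.rpow_le_rpow_of_nonpos hε (by linarith) (by linarith)) (by linarith)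
  obtain ⟨h, hh⟩ := exists_contDiff_extension h1 h2 h3
  exact ⟨h, _, hh⟩

theorem exists_contDiff_log {ε : ℝ} (hε : 0 < ε) :
    ∃ (h : ℝ → ℝ) (L : ℝ), ContDiff ℝ 1 h ∧ (∀ s, |deriv h s| ≤ L) ∧
      ∀ s, 0 ≤ s → h s = Real.log (s + ε) ∧ deriv h s = (s + ε)⁻¹ := by
  have h1 : ∀ s, 0 ≤ s → HasDerivAt (fun s => Real.log (s + ε)) (s + ε)⁻¹ s := fun s hs => by
    have := ((hasDerivAt_id s).add_const ε).log (by simp only [id]; linarith)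
    simpa using this
  have h2 : ContinuousOn (fun s => (s + ε)⁻¹) (Set.Ici 0) := by
    refine (continuousOn_id.add continuousOn_const).inv₀ fun s hs => ?_
    have : 0 ≤ s := hs
    exact (show 0 < s + ε by positivity).ne'
  have h3 : ∀ s, 0 ≤ s → |(s + ε)⁻¹| ≤ ε⁻¹ := fun s hs => by
    rw [abs_of_nonneg (by positivity)]
    exact inv_anti₀ hε (by linarith)
  obtain ⟨h, hh⟩ := exists_contDiff_extension h1 h2 h3
  exact ⟨h, _, hh⟩

variable {n : ℕ} {p : ℝ} {Ω U : Set (E n)} {B : E n → Matrix (Fin n) (Fin n) ℝ} {lam : ℝ}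
  {w φ : E n → ℝ} {Dw : E n → E n}

theorem IsC1Test.abs_rpow (hp : 2 ≤ p) (hφ : IsC1Test U φ) : IsC1Test U fun x => |φ x| ^ p := by
  have hp0 : p ≠ 0 := by linarith
  refine ⟨hφ.1.norm_rpow (by linarith), ?_, ?_⟩
  · exact hφ.2.1.comp_left (g := fun s : ℝ => |s| ^ p) (by simp [hp0])
  · refine (closure_mono fun x hx => ?_).trans hφ.2.2
    rw [Function.mem_support] at hx ⊢
    exact fun h => hx (by simp [h, hp0])

theorem gradient_abs_rpow (hp : 2 ≤ p) (hφ : Differentiable ℝ φ) (x : E n) :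
    gradient (fun x => |φ x| ^ p) x = (p * |φ x| ^ (p - 2) * φ x) • gradient φ x := by
  have hp1 : 1 < p := by linarith
  rw [gradient_comp (h := fun s : ℝ => |s| ^ p)
    (fun s => (hasDerivAt_abs_rpow s hp1).differentiableAt) hφ, (hasDerivAt_abs_rpow _ hp1).deriv]

/-- The weak equation tested with `|φ|^p (w + ε)^(1-p)`. -/
theorem IsEigenpair.exists_integral_flux_picone [IsFiniteMeasure (volume.restrict Ω)] (hp : 2 ≤ p)
    (hU : IsOpen U) (hw : IsEigenpair p B Ω U lam w Dw) (h0 : 0 ≤ᵐ[volume.restrict Ω] w)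
    {ε : ℝ} (hε : 0 < ε) (hφ : IsC1Test U φ) :
    ∃ H : E n → E n, MemLp H (ENNReal.ofReal p) (volume.restrict Ω) ∧
      (∀ᵐ x ∂(volume.restrict Ω), H x =
        (p * (|φ x| ^ (p - 2) * φ x * (w x + ε) ^ (1 - p))) • gradient φ x -
          ((p - 1) * (|φ x| ^ p * (w x + ε) ^ (-p))) • Dw x) ∧
      ∫ x in Ω, flux p (B x) (Dw x) (H x) =
        lam * ∫ x in Ω, |w x| ^ (p - 2) * w x * (|φ x| ^ p * (w x + ε) ^ (1 - p)) := by
  obtain ⟨h, L, hh, hL, hv⟩ := exists_contDiff_rpow hp hε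
  have hV := hw.1.mul_comp hp hU (hφ.abs_rpow hp) hh hL
  refine ⟨_, hV.1.2.1, ?_, (hw.2.2 _ _ hV).trans ?_⟩
  · filter_upwards [h0] with x hx
    rw [(hv _ hx).1, (hv _ hx).2, gradient_abs_rpow hp (hφ.1.differentiable (by simp))]
    module
  · congr 1
    refine integral_congr_ae ?_
    filter_upwards [h0] with x hx
    rw [(hv _ hx).1]

/-- This is `picone_pointwise` for `(t/y) Sξ` and `Sη`; the powers of `t/y` become the weights. -/
theorem IsRoot.mul_flux_le {B : Matrix (Fin n) (Fin n) ℝ} {c K : ℝ} {S : E n →ₗ[ℝ] E n}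
    (hS : IsRoot B c K S) (hp : 2 ≤ p) (t : ℝ) {y : ℝ} (hy : 0 < y) (ξ η : E n) :
    p * (|t| ^ (p - 2) * t * y ^ (1 - p)) * flux p B ξ η ≤
      (p - 1) * (|t| ^ p * y ^ (-p)) * bnorm B ξ ^ p + bnorm B η ^ p := by
  have := picone_pointwise hp ((t / y) • S ξ) (S η)
  rw [norm_smul, Real.mul_rpow (norm_nonneg _) (norm_nonneg _), Real.mul_rpow (norm_nonneg _)
    (norm_nonneg _), Real.norm_eq_abs, abs_div, abs_of_pos hy, Real.div_rpow (abs_nonneg _) hy.le,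
    Real.div_rpow (abs_nonneg _) hy.le, real_inner_smul_left, div_eq_mul_inv,
    ← Real.rpow_neg hy.le, div_eq_mul_inv, div_eq_mul_inv, ← Real.rpow_neg hy.le] at this
  rw [hS.flux_eq, hS.bnorm_eq, hS.bnorm_eq]
  have e : y ^ (1 - p) = y ^ (-(p - 2)) * y⁻¹ := by
    rw [← Real.rpow_neg_one, ← Real.rpow_add hy]; ring_nf
  rw [e]
  linarith

theorem IsRoot.flux_smul_sub_smul {B : Matrix (Fin n) (Fin n) ℝ} {c K : ℝ} {S : E n →ₗ[ℝ] E n}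
    (hS : IsRoot B c K S) (hp : 2 ≤ p) (a b : ℝ) (ξ η : E n) :
    flux p B ξ (a • η - b • ξ) = a * flux p B ξ η - b * bnorm B ξ ^ p := by
  rw [← hS.flux_self hp, hS.flux_eq, hS.flux_eq, hS.flux_eq, map_sub, map_smul, map_smul,
    inner_sub_right, inner_smul_right, inner_smul_right]
  ring

/-- Picone's inequality. -/
theorem IsRoot.flux_picone_le {B : Matrix (Fin n) (Fin n) ℝ} {c K : ℝ} {S : E n →ₗ[ℝ] E n}
    (hS : IsRoot B c K S) (hp : 2 ≤ p) (t : ℝ) {y : ℝ} (hy : 0 < y) (ξ η : E n) :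
    flux p B ξ ((p * (|t| ^ (p - 2) * t * y ^ (1 - p))) • η -
      ((p - 1) * (|t| ^ p * y ^ (-p))) • ξ) ≤ bnorm B η ^ p := by
  rw [hS.flux_smul_sub_smul hp]
  linarith [hS.mul_flux_le hp t hy ξ η]

/-- Picone's inequality with a part of the left-hand side retained. -/
theorem IsRoot.flux_picone_add_le {B : Matrix (Fin n) (Fin n) ℝ} {c K : ℝ} {S : E n →ₗ[ℝ] E n}
    (hS : IsRoot B c K S) (hp : 2 ≤ p) (t : ℝ) {y : ℝ} (hy : 0 < y) (ξ η : E n) :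
    2 * flux p B ξ ((p * (|t| ^ (p - 2) * t * y ^ (1 - p))) • η -
      ((p - 1) * (|t| ^ p * y ^ (-p))) • ξ) + (p - 1) * (|t| ^ p * y ^ (-p)) * bnorm B ξ ^ p ≤
      2 ^ p * bnorm B η ^ p := by
  rw [hS.flux_smul_sub_smul hp]
  -- Doubling `η` doubles the mixed term at the price `2^p`. Of the two copies of the negative term
  -- in twice the flux, one cancels and the other is retained.
  have := hS.mul_flux_le hp t hy ξ ((2 : ℝ) • η)
  rw [flux_smul_right, bnorm_smul, Real.mul_rpow (abs_nonneg _) (bnorm_nonneg _ _), abs_two] at this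
  linarith

end Picone

/-! ### Positivity of the first eigenfunction -/

section Positivity

variable {n : ℕ} {p : ℝ} {Ω U : Set (E n)} {B : E n → Matrix (Fin n) (Fin n) ℝ} {lam : ℝ}
  {w φ : E n → ℝ} {Dw : E n → E n}

/-- The logarithmic (Caccioppoli) estimate for nonnegative eigenfunctions. -/
theorem IsEigenpair.exists_log_bound [IsFiniteMeasure (volume.restrict Ω)] (hp : 2 ≤ p)
    (hU : IsOpen U) (hB : Elliptic (volume.restrict Ω) B) (hlam : 0 ≤ lam)
    (hw : IsEigenpair p B Ω U lam w Dw) (h0 : 0 ≤ᵐ[volume.restrict Ω] w) (hφ : IsC1Test U φ) :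
    ∃ C : ℝ, ∀ ε, 0 < ε →
      ∫⁻ x in Ω, ENNReal.ofReal (|φ x| ^ p) * ‖(w x + ε)⁻¹ • Dw x‖ₑ ^ p ≤ ENNReal.ofReal C := by
  obtain ⟨c, K, hc, hK, hS⟩ := hB.2
  have hp0 : 0 < p := by linarith
  have hcp : 0 < (p - 1) * c ^ p := mul_pos (by linarith) (Real.rpow_pos_of_pos hc _)
  refine ⟨2 ^ p / ((p - 1) * c ^ p) * ∫ x in Ω, bnorm (B x) (gradient φ x) ^ p, fun ε hε => ?_⟩
  obtain ⟨H, hH, hHe, hHi⟩ := hw.exists_integral_flux_picone hp hU h0 hε hφ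
  have mw := hw.1.1.1
  have mD := hw.1.1.2.1
  have mg : MemLp (gradient φ) (ENNReal.ofReal p) (volume.restrict Ω) := hφ.memLp_gradient _ _
  have i1 := (hB.integrable_flux hp mD hH).const_mul 2
  have i2 := (hB.integrable_bnorm_rpow hp mg).const_mul (2 ^ p)
  set F : E n → ℝ := fun x => |φ x| ^ p * ‖(w x + ε)⁻¹ • Dw x‖ ^ p with hF
  have hF0 : ∀ x, 0 ≤ F x := fun x => by positivity
  have hle : ∀ᵐ x ∂(volume.restrict Ω), (p - 1) * c ^ p * F x ≤
      2 ^ p * bnorm (B x) (gradient φ x) ^ p - 2 * flux p (B x) (Dw x) (H x) := by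
    filter_upwards [hS, h0, hHe] with x ⟨S, hS⟩ hx hHx
    have hy : 0 < w x + ε := add_pos_of_nonneg_of_pos hx hε
    have h1 := hS.flux_picone_add_le hp (φ x) hy (Dw x) (gradient φ x)
    rw [← hHx] at h1
    have h2 : (c * ‖Dw x‖) ^ p ≤ bnorm (B x) (Dw x) ^ p := by
      rw [hS.bnorm_eq]
      exact Real.rpow_le_rpow (by positivity) (hS.2 _).1 hp0.le
    rw [Real.mul_rpow hc.le (norm_nonneg _)] at h2
    have h3 : F x = |φ x| ^ p * (w x + ε) ^ (-p) * ‖Dw x‖ ^ p := by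
      rw [hF]
      simp only
      rw [norm_smul, Real.mul_rpow (norm_nonneg _) (norm_nonneg _), norm_inv,
        Real.norm_of_nonneg hy.le, Real.inv_rpow hy.le, Real.rpow_neg hy.le, mul_assoc]
    have h4 := mul_le_mul_of_nonneg_left h2
      (by have := Real.rpow_nonneg hy.le (-p); have : 0 ≤ p - 1 := by linarith
          positivity : 0 ≤ (p - 1) * (|φ x| ^ p * (w x + ε) ^ (-p)))
    rw [h3]
    linarith
  have mF : AEStronglyMeasurable F (volume.restrict Ω) := by
    refine AEMeasurable.aestronglyMeasurable ?_
    refine (((continuous_abs.comp hφ.1.continuous).measurable.pow_const _).aemeasurable).mul ?_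
    exact (((mw.1.aemeasurable.add_const ε).inv.smul mD.1.aemeasurable).norm).pow_const _
  have iF : Integrable F (volume.restrict Ω) := by
    refine ((i2.sub i1).const_mul ((p - 1) * c ^ p)⁻¹).mono' mF ?_
    filter_upwards [hle] with x hx
    rw [Real.norm_of_nonneg (hF0 x), ← div_eq_inv_mul, le_div_iff₀' hcp]
    exact hx
  -- The right-hand side of the tested equation is nonnegative and can be dropped, which makes the
  -- bound independent of `ε`.
  have hrhs : 0 ≤ ∫ x in Ω, flux p (B x) (Dw x) (H x) := by
    rw [hHi]
    refine mul_nonneg hlam (integral_nonneg_of_ae ?_)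
    filter_upwards [h0] with x hx
    have hx' : 0 ≤ w x := hx
    positivity
  have hint := integral_mono_ae (iF.const_mul ((p - 1) * c ^ p)) (i2.sub i1) hle
  rw [integral_const_mul, integral_sub' i2 i1, integral_const_mul, integral_const_mul] at hint
  have hfin : ∫ x in Ω, F x ≤
      2 ^ p / ((p - 1) * c ^ p) * ∫ x in Ω, bnorm (B x) (gradient φ x) ^ p := by
    rw [div_mul_eq_mul_div, le_div_iff₀' hcp]
    linarith
  refine le_trans (le_of_eq ?_) (ENNReal.ofReal_le_ofReal hfin)
  rw [ofReal_integral_eq_lintegral_ofReal iF (Eventually.of_forall hF0)]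
  refine lintegral_congr fun x => ?_
  rw [hF, ENNReal.ofReal_mul (by positivity), ← ENNReal.ofReal_rpow_of_nonneg (norm_nonneg _) hp0.le,
    ofReal_norm]

/-- Poincaré's inequality on convex sets for `h (u)`. -/
theorem MemVanishing.lintegral_comp_sub_le (hp : 2 ≤ p) {u : E n → ℝ} {G : E n → E n}
    (hu : MemVanishing p Ω U u G) {h : ℝ → ℝ} (hh : ContDiff ℝ 1 h) {L : ℝ}
    (hL : ∀ s, |deriv h s| ≤ L) {K : Set (E n)} (hK : Convex ℝ K) (hKm : MeasurableSet K)
    (hKΩ : K ⊆ Ω) (hKfin : volume K ≠ ⊤) {D : ℝ} (hD : ∀ x ∈ K, ∀ y ∈ K, ‖x - y‖ ≤ D) :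
    ∫⁻ z, ‖h (u z.1) - h (u z.2)‖ₑ ^ p ∂((volume.restrict K).prod (volume.restrict K)) ≤
      ENNReal.ofReal D ^ p * (2 ^ n * (volume K * ∫⁻ x in K, ‖deriv h (u x) • G x‖ₑ ^ p)) := by
  have hp0 : 0 < p := by linarith
  obtain ⟨φ, hφ, -, h2, h3⟩ := hu.exists_seq_tendsto_ae hp
  have hd := hh.differentiable (by simp)
  have hmono : volume.restrict K ≤ volume.restrict Ω := Measure.restrict_mono hKΩ le_rfl
  have mG := hu.1.2.1.mono_measure hmono
  have mu := hu.1.1.1.mono_measure hmono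
  have h3' : ∀ᵐ x ∂(volume.restrict K), Tendsto (fun k => φ k x) atTop (𝓝 (u x)) :=
    ae_mono hmono h3
  have h2' : Tendsto (fun k => eLpNorm (fun x => G x - gradient (φ k) x) (ENNReal.ofReal p)
      (volume.restrict K)) atTop (𝓝 0) :=
    tendsto_of_tendsto_of_tendsto_of_le_of_le tendsto_const_nhds h2 (fun _ => zero_le)
      fun k => eLpNorm_mono_measure _ hmono
  have mφ : ∀ k, AEStronglyMeasurable (φ k) (volume.restrict K) :=
    fun k => (hφ k).1.continuous.aestronglyMeasurable
  have mgφ : ∀ k, MemLp (gradient (φ k)) (ENNReal.ofReal p) (volume.restrict K) :=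
    fun k => (hφ k).isC1Test.memLp_gradient _ _
  have hcd := hh.continuous_deriv le_rfl
  have t1 := tendsto_eLpNorm_comp_smul_sub hp hcd hL mu mφ mG (fun k => (mgφ k).1) h3' h2'
  have hsm : ∀ {v : E n → ℝ} {H : E n → E n}, AEStronglyMeasurable v (volume.restrict K) →
      MemLp H (ENNReal.ofReal p) (volume.restrict K) →
      MemLp (fun x => deriv h (v x) • H x) (ENNReal.ofReal p) (volume.restrict K) :=
    fun hv hH => hH.of_le_mul (c := L) ((hcd.comp_aestronglyMeasurable hv).smul hH.1)
      (Eventually.of_forall fun x => by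
        rw [norm_smul]; exact mul_le_mul_of_nonneg_right (hL _) (norm_nonneg _))
  have t2 := tendsto_integral_norm_rpow hp (fun k => hsm (mφ k) (mgφ k)) (hsm mu mG) t1
  have t3 := (ENNReal.continuous_ofReal.tendsto _).comp t2
  rw [← lintegral_enorm_rpow_eq_ofReal hp (hsm mu mG)] at t3
  have t4 : Tendsto (fun k => ENNReal.ofReal D ^ p * (2 ^ n * (volume K *
      ∫⁻ x in K, ‖deriv h (φ k x) • gradient (φ k) x‖ₑ ^ p))) atTop
      (𝓝 (ENNReal.ofReal D ^ p * (2 ^ n * (volume K *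
        ∫⁻ x in K, ‖deriv h (u x) • G x‖ₑ ^ p)))) := by
    refine ENNReal.Tendsto.const_mul (ENNReal.Tendsto.const_mul (ENNReal.Tendsto.const_mul ?_
      (Or.inr hKfin)) (Or.inr (by simp)))
      (Or.inr (ENNReal.rpow_ne_top_of_nonneg hp0.le ENNReal.ofReal_ne_top))
    refine t3.congr fun k => ?_
    rw [lintegral_enorm_rpow_eq_ofReal hp (hsm (mφ k) (mgφ k))]
    rfl
  -- Fatou's lemma handles the differences, which converge only almost everywhere; the gradient side
  -- converges by the strong `L^p` limit.
  have hlim : ∀ᵐ z ∂((volume.restrict K).prod (volume.restrict K)),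
      liminf (fun k => ‖h (φ k z.1) - h (φ k z.2)‖ₑ ^ p) atTop = ‖h (u z.1) - h (u z.2)‖ₑ ^ p := by
    filter_upwards [Measure.quasiMeasurePreserving_fst.ae h3',
      Measure.quasiMeasurePreserving_snd.ae h3'] with z hz1 hz2
    refine Tendsto.liminf_eq ?_
    have := (((hh.continuous.tendsto _).comp hz1).sub ((hh.continuous.tendsto _).comp hz2)).enorm
    exact ((ENNReal.continuous_rpow_const (y := p)).tendsto _).comp this
  rw [← lintegral_congr_ae hlim]
  refine (lintegral_liminf_le' fun k => ?_).trans ?_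
  · refine Continuous.aemeasurable ?_
    have := hh.continuous.comp (hφ k).1.continuous
    exact (ENNReal.continuous_rpow_const (y := p)).comp
      (((this.comp continuous_fst).sub (this.comp continuous_snd)).enorm)
  · rw [← t4.liminf_eq]
    refine liminf_le_liminf (Eventually.of_forall fun k => ?_)
    have hf : ContDiff ℝ 1 fun x => h (φ k x) := hh.comp (hφ k).isC1Test.1
    refine (lintegral_enorm_sub_rpow_le (by linarith : 1 < p) hf hK hKm hD).trans (le_of_eq ?_)
    congr 3
    refine lintegral_congr fun x => ?_
    rw [gradient_comp hd ((hφ k).isC1Test.1.differentiable (by simp))]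

end Positivity

/-! ### Positivity from connectedness -/

section Connected

variable {n : ℕ} {p : ℝ} {Ω U : Set (E n)} {B : E n → Matrix (Fin n) (Fin n) ℝ} {lam : ℝ}
  {w φ : E n → ℝ} {Dw : E n → E n}

/-- A locally valid alternative between two null sets holds globally on a connected open set. -/
theorem null_or_null_of_locally {ω Z P : Set (E n)} (hωo : IsOpen ω) (hωc : IsPreconnected ω)
    (hcov : volume (ω \ (Z ∪ P)) = 0)
    (hloc : ∀ x ∈ ω, ∃ r, 0 < r ∧
      (volume (Metric.ball x r ∩ Z) = 0 ∨ volume (Metric.ball x r ∩ P) = 0)) :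
    volume (ω ∩ Z) = 0 ∨ volume (ω ∩ P) = 0 := by
  set O : Set (E n) → Set (E n) := fun S => {x | ∃ r, 0 < r ∧ volume (Metric.ball x r ∩ S) = 0}
    with hO
  have hopen : ∀ S, IsOpen (O S) := fun S => by
    rw [Metric.isOpen_iff]
    rintro x ⟨r, hr, h⟩
    refine ⟨r, hr, fun y hy => ⟨r - dist y x, sub_pos.2 hy, ?_⟩⟩
    refine measure_mono_null (Set.inter_subset_inter_left _ ?_) h
    exact Metric.ball_subset_ball' (by linarith)
  have hnull : ∀ S, ω ⊆ O S → volume (ω ∩ S) = 0 := fun S hS => by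
    refine measure_null_of_locally_null _ fun x hx => ?_
    obtain ⟨r, hr, h⟩ := hS hx.1
    refine ⟨Metric.ball x r ∩ (ω ∩ S),
      inter_mem (mem_nhdsWithin_of_mem_nhds (Metric.ball_mem_nhds x hr)) self_mem_nhdsWithin, ?_⟩
    exact measure_mono_null (Set.inter_subset_inter_right _ Set.inter_subset_right) h
  -- At a common point a small ball would be covered by three null sets.
  have hdisj : ω ∩ (O Z ∩ O P) = ∅ := by
    rw [Set.eq_empty_iff_forall_notMem]
    rintro x ⟨hx, ⟨r, hr, h1⟩, ⟨s, hs, h2⟩⟩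
    obtain ⟨t, ht, hB⟩ := Metric.isOpen_iff.1 hωo x hx
    have hpos := Metric.measure_ball_pos volume x (lt_min (lt_min hr hs) ht)
    refine hpos.ne' (measure_mono_null ?_ (measure_union_null (measure_union_null h1 h2) hcov))
    intro y hy
    rw [Metric.mem_ball, lt_min_iff, lt_min_iff] at hy
    by_cases hyZ : y ∈ Z
    · exact Or.inl (Or.inl ⟨hy.1.1, hyZ⟩)
    by_cases hyP : y ∈ P
    · exact Or.inl (Or.inr ⟨hy.1.2, hyP⟩)
    · exact Or.inr ⟨hB hy.2, by simp [hyZ, hyP]⟩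
  have hsub : ω ⊆ O Z ∪ O P := fun x hx => by
    obtain ⟨r, hr, h | h⟩ := hloc x hx
    · exact Or.inl ⟨r, hr, h⟩
    · exact Or.inr ⟨r, hr, h⟩
  rcases isPreconnected_iff_subset_of_disjoint.1 hωc _ _ (hopen Z) (hopen P) hsub hdisj with h | h
  · exact Or.inl (hnull Z h)
  · exact Or.inr (hnull P h)

theorem eq_zero_of_forall_ofReal_rpow_mul_le (hp : 1 ≤ p) {q C : ℝ≥0∞} (hC : C ≠ ⊤)
    (h : ∀ N : ℝ, 0 ≤ N → ENNReal.ofReal N ^ p * q ≤ C) : q = 0 := by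
  by_contra hq
  have hc : C / q ≠ ⊤ := ENNReal.div_ne_top hC hq
  set N : ℝ := (C / q).toReal + 1 with hN
  have hN1 : 1 ≤ N := by rw [hN]; linarith [ENNReal.toReal_nonneg (a := C / q)]
  have h0 := h N (by linarith)
  have hqt : q ≠ ⊤ := by
    rintro rfl
    rw [ENNReal.mul_top] at h0
    · exact hC (top_le_iff.1 h0)
    · exact (ENNReal.rpow_pos (ENNReal.ofReal_pos.2 (by linarith)) ENNReal.ofReal_ne_top).ne'
  rw [← ENNReal.le_div_iff_mul_le (Or.inl hq) (Or.inl hqt)] at h0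
  have h1 : ENNReal.ofReal N ≤ ENNReal.ofReal N ^ p := by
    conv_lhs => rw [← ENNReal.rpow_one (ENNReal.ofReal N)]
    exact ENNReal.rpow_le_rpow_of_exponent_le (by simpa using hN1) hp
  have h2 := h1.trans h0
  rw [ENNReal.ofReal_le_iff_le_toReal hc] at h2
  linarith

/-- On a small ball the oscillation of `log (w + ε)` is bounded uniformly in `ε`, by the logarithmic
estimate and Poincaré. If `{w = 0}` and some `{w ≥ η}` both had positive measure there, the
oscillation would be unbounded as `ε → 0`. -/
theorem IsEigenpair.null_or_null_ball [IsFiniteMeasure (volume.restrict Ω)] (hp : 2 ≤ p)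
    (hΩ : IsOpen Ω) (hB : Elliptic (volume.restrict Ω) B) (hlam : 0 ≤ lam)
    (hw : IsEigenpair p B Ω Ω lam w Dw) (h0 : 0 ≤ᵐ[volume.restrict Ω] w) {x : E n} (hx : x ∈ Ω) :
    ∃ r, 0 < r ∧ (volume (Metric.ball x r ∩ {y | w y = 0}) = 0 ∨
      volume (Metric.ball x r ∩ {y | 0 < w y}) = 0) := by
  have hp0 : 0 < p := by linarith
  obtain ⟨R, hR, hRΩ⟩ := Metric.isOpen_iff.1 hΩ x hx
  set r := R / 4 with hr
  have hr0 : 0 < r := by positivity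
  let χ : ContDiffBump x := ⟨r, 2 * r, hr0, by linarith⟩
  have hχ : IsC1Test Ω χ := by
    refine IsTest.isC1Test ⟨χ.contDiff, χ.hasCompactSupport, ?_⟩
    rw [χ.tsupport_eq]
    exact (Metric.closedBall_subset_ball (show 2 * r < R by linarith)).trans hRΩ
  obtain ⟨C, hC⟩ := hw.exists_log_bound hp hΩ hB hlam h0 hχ
  set K := Metric.ball x r with hK
  have hKΩ : K ⊆ Ω := (Metric.ball_subset_ball (by linarith)).trans hRΩ
  have hKfin : volume K ≠ ⊤ := measure_ball_lt_top.ne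
  have hmono : volume.restrict K ≤ volume.restrict Ω := Measure.restrict_mono hKΩ le_rfl
  have h0K : ∀ᵐ y ∂(volume.restrict K), 0 ≤ w y := ae_mono hmono h0
  have hwK : AEMeasurable w (volume.restrict K) := hw.1.1.1.1.aemeasurable.mono_measure hmono
  set C' : ℝ≥0∞ := ENNReal.ofReal (2 * r) ^ p * (2 ^ n * (volume K * ENNReal.ofReal C)) with hC'
  have hC'fin : C' ≠ ⊤ := by
    refine ENNReal.mul_ne_top (ENNReal.rpow_ne_top_of_nonneg hp0.le ENNReal.ofReal_ne_top)
      (ENNReal.mul_ne_top (by simp) (ENNReal.mul_ne_top hKfin ENNReal.ofReal_ne_top))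
  have hbound : ∀ ε, 0 < ε → ∫⁻ z, ‖Real.log (w z.1 + ε) - Real.log (w z.2 + ε)‖ₑ ^ p
      ∂((volume.restrict K).prod (volume.restrict K)) ≤ C' := by
    intro ε hε
    obtain ⟨g, L, hg, hL, hv⟩ := exists_contDiff_log hε
    have h1 := hw.1.lintegral_comp_sub_le hp hg hL (convex_ball x r) measurableSet_ball hKΩ hKfin
      (D := 2 * r) fun y hy z hz => by
        rw [← dist_eq_norm]
        have := dist_triangle_right y z x
        rw [Metric.mem_ball] at hy hz
        linarith
    have h2 : ∫⁻ y in K, ‖deriv g (w y) • Dw y‖ₑ ^ p ≤ ENNReal.ofReal C := by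
      refine le_trans (le_of_eq ?_) ((lintegral_mono_set hKΩ).trans (hC ε hε))
      refine lintegral_congr_ae ?_
      filter_upwards [h0K, ae_restrict_mem measurableSet_ball] with y hy hyK
      rw [(hv _ hy).2, χ.one_of_mem_closedBall (Metric.ball_subset_closedBall hyK)]
      simp
    refine le_trans (le_of_eq ?_) (h1.trans ?_)
    · refine lintegral_congr_ae ?_
      filter_upwards [Measure.quasiMeasurePreserving_fst.ae h0K,
        Measure.quasiMeasurePreserving_snd.ae h0K] with z hz1 hz2
      rw [(hv _ hz1).1, (hv _ hz2).1]
    · rw [hC']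
      gcongr
  have hprod : ∀ η, 0 < η →
      volume (K ∩ {y | η ≤ w y}) * volume (K ∩ {y | w y = 0}) = 0 := by
    intro η hη
    refine eq_zero_of_forall_ofReal_rpow_mul_le (by linarith : 1 ≤ p) hC'fin fun N hN => ?_
    -- With this `ε` the logarithms on the two sets differ by at least `N`, and Chebyshev's
    -- inequality on the product applies.
    set ε := η * Real.exp (-N) with hε
    have hε0 : 0 < ε := by positivity
    refine le_trans ?_ (hbound ε hε0)
    have hm : AEMeasurable (fun z : E n × E n =>
        ‖Real.log (w z.1 + ε) - Real.log (w z.2 + ε)‖ₑ ^ p)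
        ((volume.restrict K).prod (volume.restrict K)) := by
      have hl : AEMeasurable (fun y => Real.log (w y + ε)) (volume.restrict K) :=
        Real.measurable_log.comp_aemeasurable (hwK.add_const ε)
      have a1 := hl.comp_quasiMeasurePreserving
        (Measure.quasiMeasurePreserving_fst (ν := volume.restrict K))
      have a2 := hl.comp_quasiMeasurePreserving
        (Measure.quasiMeasurePreserving_snd (μ := volume.restrict K))
      exact (a1.sub a2).enorm.pow_const _
    refine le_trans ?_ (mul_meas_ge_le_lintegral₀ hm (ENNReal.ofReal N ^ p))
    gcongr
    have e1 : volume (K ∩ {y | η ≤ w y}) ≤ volume.restrict K {y | η ≤ w y} := by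
      rw [Set.inter_comm]; exact Measure.le_restrict_apply _ _
    have e2 : volume (K ∩ {y | w y = 0}) ≤ volume.restrict K {y | w y = 0} := by
      rw [Set.inter_comm]; exact Measure.le_restrict_apply _ _
    refine (mul_le_mul' e1 e2).trans ?_
    rw [← Measure.prod_prod]
    refine measure_mono ?_
    rintro ⟨y, z⟩ ⟨hy, hz⟩
    have hy' : η ≤ w y := hy
    have hz' : w z = 0 := hz
    simp only [Set.mem_ofPred_eq, hz', zero_add]
    gcongr
    rw [Real.enorm_eq_ofReal_abs]
    refine ENNReal.ofReal_le_ofReal (le_trans ?_ (le_abs_self _))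
    have h5 : Real.log η ≤ Real.log (w y + ε) := Real.log_le_log hη (by linarith)
    have h6 : Real.log ε = Real.log η + -N := by
      rw [hε, Real.log_mul hη.ne' (Real.exp_pos _).ne', Real.log_exp]
    linarith
  refine ⟨r, hr0, ?_⟩
  by_cases hZ : volume (K ∩ {y | w y = 0}) = 0
  · exact Or.inl hZ
  · right
    have hsub : K ∩ {y | 0 < w y} ⊆ ⋃ k : ℕ, K ∩ {y | 1 / ((k : ℝ) + 1) ≤ w y} := by
      rintro y ⟨hyK, hy⟩
      obtain ⟨k, hk⟩ := exists_nat_one_div_lt (show 0 < w y from hy)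
      exact Set.mem_iUnion.2 ⟨k, hyK, hk.le⟩
    refine measure_mono_null hsub (measure_iUnion_null fun k => ?_)
    exact (mul_eq_zero.1 (hprod _ (by positivity))).resolve_right hZ

/-- A nonnegative eigenfunction on a connected open set is positive almost everywhere. -/
theorem IsEigenpair.ae_pos [IsFiniteMeasure (volume.restrict Ω)] (hp : 2 ≤ p)
    (hΩ : IsOpen Ω) (hΩc : IsPreconnected Ω) (hB : Elliptic (volume.restrict Ω) B) (hlam : 0 ≤ lam)
    (hw : IsEigenpair p B Ω Ω lam w Dw) (h0 : 0 ≤ᵐ[volume.restrict Ω] w) :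
    ∀ᵐ x ∂(volume.restrict Ω), 0 < w x := by
  have h0' : volume (Ω \ ({y | w y = 0} ∪ {y | 0 < w y})) = 0 := by
    have := (ae_restrict_iff' hΩ.measurableSet).1 h0
    refine measure_mono_null (fun y hy => ?_) (ae_iff.1 this)
    exact fun h => hy.2 ((lt_or_eq_of_le (h hy.1)).elim Or.inr fun h => Or.inl h.symm)
  rcases null_or_null_of_locally (Z := {y | w y = 0}) (P := {y | 0 < w y}) hΩ hΩc h0'
    (fun x hx => hw.null_or_null_ball hp hΩ hB hlam h0 hx) with h | h
  · refine (ae_restrict_iff' hΩ.measurableSet).2 ?_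
    have h1 : ∀ᵐ y, ¬ (y ∈ Ω ∩ {y | w y = 0}) := measure_eq_zero_iff_ae_notMem.1 h
    filter_upwards [h1, (ae_restrict_iff' hΩ.measurableSet).1 h0] with y hy hy0 hyΩ
    exact lt_of_le_of_ne (hy0 hyΩ) fun h => hy ⟨hyΩ, h.symm⟩
  · refine absurd ?_ hw.2.1
    refine (ae_restrict_iff' hΩ.measurableSet).2 ?_
    have h1 : ∀ᵐ y, ¬ (y ∈ Ω ∩ {y | 0 < w y}) := measure_eq_zero_iff_ae_notMem.1 h
    filter_upwards [h1, (ae_restrict_iff' hΩ.measurableSet).1 h0] with y hy hy0 hyΩ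
    exact le_antisymm (not_lt.1 fun h => hy ⟨hyΩ, h⟩) (hy0 hyΩ)

end Connected

/-! ### Equality of the eigenvalues -/

section Equality

variable {d : ℕ} {ω : Set (E d)} {A : E d → Matrix (Fin (d + 1)) (Fin (d + 1)) ℝ} {p ℓ : ℝ}
  {W : E d → ℝ} {DW : E d → E d}

theorem IsFirstEigenfunction.lambdaM_le_mu1 (hp : 2 ≤ p) (hωo : IsOpen ω)
    (hωb : Bornology.IsBounded ω) (hne : ω.Nonempty) (hA : IsAdmissible ω A)
    (hW : IsFirstEigenfunction p A ω W DW) (hℓ : 0 < ℓ) : lambdaM p A ω ℓ ≤ mu1 p A ω := by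
  have hV := memVanishing_tensor (ℓ := ℓ) hωo hωb hp (contDiff_const (c := (1 : ℝ))) hW.1.1
  have h := (lambdaM_spec hp hωo hωb hne hA hℓ).2.1 _ _ hV
  have e1 := (integral_cylinder hωo.measurableSet (integrable_abs_rpow hp hV.1.1)).2
  have e2 := (integral_cylinder hωo.measurableSet
    ((hA.elliptic.comp_tail hωo.measurableSet ℓ).integrable_bnorm_rpow hp hV.1.2.1)).2
  simp only [deriv_const, zero_mul, one_mul, one_smul, tail_consE, bnorm_consE_zero, hW.2.1,
    hW.energy_eq hp hA, setIntegral_const, smul_eq_mul] at h e1 e2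
  rw [e1, e2, mul_one, mul_comm] at h
  refine le_of_mul_le_mul_left h ?_
  rw [measureReal_def, Real.volume_Ioo]
  exact ENNReal.toReal_pos (by simpa using hℓ) ENNReal.ofReal_ne_top

/-- The energy of a slice controls its mass if `A₁₂ · ∇W = 0`. -/
theorem IsFirstEigenfunction.mu1_mul_integral_slice_le (hp : 2 ≤ p) (hωo : IsOpen ω)
    (hωb : Bornology.IsBounded ω) (hωc : IsPreconnected ω) (hA : IsAdmissible ω A)
    (hW : IsFirstEigenfunction p A ω W DW)
    (h0 : ∀ᵐ X ∂(volume.restrict ω), A12dot A X (DW X) = 0)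
    {v : E (d + 1) → ℝ} (hv : IsTest (strip ω) v) (t : ℝ) :
    mu1 p A ω * ∫ X in ω, |v (consE t X)| ^ p ≤
      ∫ X in ω, bnorm (A X) (gradient v (consE t X)) ^ p := by
  have : IsFiniteMeasure (volume.restrict ω) := isFiniteMeasure_restrict.2 hωb.measure_lt_top.ne
  have hp0 : 0 < p := by linarith
  have hB := hA.elliptic
  have hB2 := hA.elliptic_A22
  obtain ⟨c, K, -, -, hS⟩ := hB.2
  have hφ := (hv.slice t).isC1Test
  have hpos := hW.1.ae_pos hp hωo hωc hB2 (hW.mu1_nonneg hp hA) hW.2.2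
  have mφ : MemLp (fun X => v (consE t X)) (ENNReal.ofReal p) (volume.restrict ω) := hφ.memLp _ _
  have mW := hW.1.1.1.1
  have mg : MemLp (fun X => gradient v (consE t X)) (ENNReal.ofReal p) (volume.restrict ω) := by
    obtain ⟨C, hC⟩ := hv.integrable_gradient_bound
    refine (memLp_const C).of_le ?_ (Eventually.of_forall fun X => (hC _).trans (le_abs_self C))
    exact ((continuous_gradient hv.isC1Test.1).comp
      (continuous_consE.comp (by fun_prop : Continuous fun X => (t, X)))).aestronglyMeasurable
  have key : ∀ k : ℕ, mu1 p A ω * ∫ X in ω, |W X| ^ (p - 2) * W X *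
      (|v (consE t X)| ^ p * (W X + 1 / ((k : ℝ) + 1)) ^ (1 - p)) ≤
      ∫ X in ω, bnorm (A X) (gradient v (consE t X)) ^ p := by
    intro k
    have hε : 0 < 1 / ((k : ℝ) + 1) := by positivity
    obtain ⟨H, hH, hHe, hHi⟩ := hW.1.exists_integral_flux_picone hp hωo hW.2.2 hε hφ
    rw [← hHi]
    refine integral_mono_ae (hB2.integrable_flux hp hW.1.1.1.2.1 hH)
      (hB.integrable_bnorm_rpow hp mg) ?_
    filter_upwards [hS, hHe, h0, hpos] with X ⟨S, hS⟩ hX h0X hWX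
    -- Picone is applied to the full matrix `A` and the field `(0, ∇W)`, whereas the equation of `W`
    -- involves `A₂₂`. The two fluxes agree because `A₁₂·∇W = 0` removes the longitudinal component
    -- of `∇v`.
    have h1 := hS.flux_picone_le hp (v (consE t X)) (add_pos hWX hε) (consE 0 (DW X))
      (gradient v (consE t X))
    refine le_trans (le_of_eq ?_) h1
    rw [flux_consE_zero, h0X, mul_zero, zero_mul, zero_add, hX,
      gradient_slice (hv.1.differentiable (by simp))]
    congr 1
  -- Where `W > 0`, the ratio `W^(p-1) (W + ε)^(1-p)` is at most `1` and tends to `1`; positivity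
  -- almost everywhere is what recovers the whole mass of the slice.
  have hlim : Tendsto (fun k : ℕ => ∫ X in ω, |W X| ^ (p - 2) * W X *
      (|v (consE t X)| ^ p * (W X + 1 / ((k : ℝ) + 1)) ^ (1 - p))) atTop
      (𝓝 (∫ X in ω, |v (consE t X)| ^ p)) := by
    refine tendsto_integral_of_dominated_convergence (fun X => |v (consE t X)| ^ p) (fun k => ?_)
      (integrable_abs_rpow hp mφ) (fun k => ?_) ?_
    · refine AEMeasurable.aestronglyMeasurable ?_
      have a1 := mW.1.aemeasurable
      have a2 := mφ.1.aemeasurable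
      exact (((continuous_abs.measurable.comp_aemeasurable a1).pow_const _).mul a1).mul
        (((continuous_abs.measurable.comp_aemeasurable a2).pow_const _).mul
          ((a1.add_const _).pow_const _))
    · filter_upwards [hpos] with X hX
      have hε : 0 < 1 / ((k : ℝ) + 1) := by positivity
      rw [abs_of_pos hX, rpow_sub_two_mul_self hp hX.le, Real.norm_of_nonneg (by positivity),
        mul_left_comm]
      refine mul_le_of_le_one_right (by positivity) ?_
      have h1 : (W X + 1 / ((k : ℝ) + 1)) ^ (1 - p) ≤ W X ^ (1 - p) :=
        Real.rpow_le_rpow_of_nonpos hX (by linarith) (by linarith)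
      refine (mul_le_mul_of_nonneg_left h1 (by positivity)).trans (le_of_eq ?_)
      rw [← Real.rpow_add hX]; simp
    · filter_upwards [hpos] with X hX
      have h1 : Tendsto (fun k : ℕ => (W X + 1 / ((k : ℝ) + 1)) ^ (1 - p)) atTop
          (𝓝 (W X ^ (1 - p))) := by
        have := (tendsto_one_div_add_atTop_nhds_zero_nat (𝕜 := ℝ)).const_add (W X)
        rw [add_zero] at this
        exact this.rpow_const (Or.inl hX.ne')
      have h2 := (h1.const_mul (|v (consE t X)| ^ p)).const_mul (|W X| ^ (p - 2) * W X)
      refine h2.congr' (Eventually.of_forall fun k => rfl) |>.trans_eq ?_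
      rw [abs_of_pos hX, rpow_sub_two_mul_self hp hX.le, mul_left_comm, ← Real.rpow_add hX]
      simp
  exact le_of_tendsto (hlim.const_mul _) (Eventually.of_forall key)

theorem IsFirstEigenfunction.lambdaM_eq_mu1 (hp : 2 ≤ p) (hωo : IsOpen ω)
    (hωb : Bornology.IsBounded ω) (hωc : IsConnected ω) (hA : IsAdmissible ω A)
    (hW : IsFirstEigenfunction p A ω W DW)
    (h0 : ∀ᵐ X ∂(volume.restrict ω), A12dot A X (DW X) = 0) (hℓ : 0 < ℓ) :
    lambdaM p A ω ℓ = mu1 p A ω := by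
  refine le_antisymm (hW.lambdaM_le_mu1 hp hωo hωb hωc.nonempty hA hℓ)
    ((lambdaM_spec hp hωo hωb hωc.nonempty hA hℓ).2.2 _ fun v hv => ?_)
  have := isFiniteMeasure_cylinder hωb ℓ
  obtain ⟨i1, e1⟩ := integral_cylinder hωo.measurableSet (ℓ := ℓ)
    (integrable_abs_rpow hp (hv.isC1Test.memLp _ _))
  obtain ⟨i2, e2⟩ := integral_cylinder hωo.measurableSet (ℓ := ℓ)
    ((hA.elliptic.comp_tail hωo.measurableSet ℓ).integrable_bnorm_rpow hp
      (hv.isC1Test.memLp_gradient _ _))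
  simp only [tail_consE] at i2 e2
  rw [e1, e2, ← integral_const_mul]
  exact integral_mono (i1.const_mul _) i2 fun t =>
    hW.mu1_mul_integral_slice_le hp hωo hωb hωc.isPreconnected hA h0 hv t

end Equality

end MixedGap

end

theorem theorem1p2 {d : ℕ} (hd : 1 ≤ d) (p : ℝ) (hp : 2 ≤ p)
    (ω : Set (MixedGap.E d)) (hωo : IsOpen ω) (hωb : Bornology.IsBounded ω) (hωc : IsConnected ω)
    (A : MixedGap.E d → Matrix (Fin (d + 1)) (Fin (d + 1)) ℝ) (hA : MixedGap.IsAdmissible ω A)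
    (W : MixedGap.E d → ℝ) (DW : MixedGap.E d → MixedGap.E d)
    (hW : MixedGap.IsFirstEigenfunction p A ω W DW) :
    (∀ ℓ : ℝ, 0 < ℓ → IsLeast (MixedGap.mixedEigenvalues p A ω ℓ) (MixedGap.lambdaM p A ω ℓ)) ∧
    (¬ (∀ᵐ X ∂(volume.restrict ω), MixedGap.A12dot A X (DW X) = 0) →
      limsup (fun ℓ : ℝ => ((MixedGap.lambdaM p A ω ℓ : ℝ) : EReal)) atTop <
        ((MixedGap.mu1 p A ω : ℝ) : EReal)) ∧
    ((∀ᵐ X ∂(volume.restrict ω), MixedGap.A12dot A X (DW X) = 0) →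
      ∀ ℓ : ℝ, 0 < ℓ → MixedGap.lambdaM p A ω ℓ = MixedGap.mu1 p A ω) := by
  exact ⟨fun ℓ hℓ => (MixedGap.lambdaM_spec hp hωo hωb hωc.nonempty hA hℓ).1,
    hW.limsup_lambdaM_lt hp hωo hωb hωc.nonempty hA,
    fun h0 _ hℓ => hW.lambdaM_eq_mu1 hp hωo hωb hωc hA h0 hℓ⟩
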